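/- Let $H$ be a separable complex Hilbert space of infinite dimension and $\hat H = H\oplus H$. A (possibly unbounded) operator on $H$ is called regular if it is closed and densely defined. Let $R(H)$ be the set of regular operators on $H$; write ${}^rR$ for this set with the Riesz topology, induced from the operator norm by the bounded transform $A\mapsto A(1+A^*A)^{-1/2}$, and ${}^gR$ for this set with the graph topology, induced from the operator norm by the map taking $A$ to the orthogonal projection of $\hat H$ onto the graph of $A$. Let $R_K\subset R(H)$ be the set of regular operators with compact resolvent, that is, those for which both $(1+A^*A)^{-1}$ and $(1+AA^*)^{-1}$ are compact. A regular operator $A$ is invertible if $A\colon\operatorname{dom}(A)\to H$ is bijective with bounded inverse; $\operatorname{Spec}(A)$ is the set of all $z\in\mathbb C$ such that $A-z$ is not invertible. Let $R^{sa}\subset R(H)$ be the set of self-adjoint operators, $R^{+}$ (resp. $R^{-}$) the set of those $A\in R^{sa}$ that are positive (resp. negative) on some closed invariant subspace of finite codimension, and $R^{*}=R^{sa}\setminus(R^{+}\cup R^{-})$. A prefix $r$ or $g$ indicates the topology, and all subsets carry the subspace topology. 1. Let $X$ be one of the spaces ${}^rR^{*}$, ${}^gR^{sa}$, ${}^gR^{-}$,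 ${}^gR^{+}$, ${}^gR^{*}$, and let $X_K=X\cap R_K$. Then the subspaces of $X$ and of $X_K$ consisting of invertible operators are contractible. Moreover, for every real $\lambda\ge 0$ the subspaces $$X^\lambda=\{A\in X : \operatorname{Spec}(A)\cap[-\lambda,\lambda]=\emptyset\}\quad\text{and}\quad X_K^\lambda=X_K\cap X^\lambda$$ are contractible. 2. Let $X={}^rR$ or $X={}^gR$, and let $X_K=X\cap R_K$. Then the subspaces of $X$ and of $X_K$ consisting of invertible operators are contractible. Moreover, for every real $\lambda\ge 0$ the subspaces $$X^\lambda=\{A\in X : \operatorname{Spec}(\hat A)\cap[-\lambda,\lambda]=\emptyset\},\quad\text{where}\quad \hat A=\begin{pmatrix}0&A^*\\A&0\end{pmatrix}\ \text{on}\ \hat H\ \text{with domain}\ \operatorname{dom}(A)\oplus\operatorname{dom}(A^*),$$ and $X_K^\lambda=X_K\cap X^\lambda$ are contractible. -/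

import Mathlib

open scoped ComplexOrder InnerProductSpace LinearPMap

noncomputable section

namespace RegOp

/-! ### Regular operators -/

/-- The regular (closed and densely defined) operators on `H`. -/
def Reg (H : Type*) [NormedAddCommGroup H] [InnerProductSpace ℂ H] : Type _ :=
  {A : H →ₗ.[ℂ] H // A.IsClosed ∧ Dense (A.domain : Set H)}

/-- `A : dom A → E` is bijective and its inverse is a bounded operator on `E`. -/
def IsInvertible {E : Type*} [NormedAddCommGroup E] [InnerProductSpace ℂ E]
    (A : E →ₗ.[ℂ] E) : Prop :=
  Function.Bijective A.toFun ∧ ∃ B : E →L[ℂ] E, ∀ x : A.domain, B (A x) = x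

/-- The spectrum of an unbounded operator: all `z` such that `A - z`, with domain `dom A`,
is not invertible. -/
def Spec {E : Type*} [NormedAddCommGroup E] [InnerProductSpace ℂ E]
    (A : E →ₗ.[ℂ] E) : Set ℂ :=
  {z | ¬ IsInvertible ((-(z • LinearMap.id) : E →ₗ[ℂ] E) +ᵥ A)}

/-- The real interval `[-l, l]`, as a subset of the complex plane. -/
def symmInterval (l : ℝ) : Set ℂ := (fun t : ℝ => (t : ℂ)) '' Set.Icc (-l) l

variable {H : Type*} [NormedAddCommGroup H] [InnerProductSpace ℂ H]

/-- The graph of `A`, as a subspace of the Hilbert sum `H ⊕ H`. -/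
def graphSubmodule (A : H →ₗ.[ℂ] H) : Submodule ℂ (WithLp 2 (H × H)) :=
  A.graph.comap (WithLp.linearEquiv 2 ℂ (H × H)).toLinearMap

theorem mem_graphSubmodule (A : H →ₗ.[ℂ] H) (p : WithLp 2 (H × H)) :
    p ∈ graphSubmodule A ↔ ∃ h : p.fst ∈ A.domain, A ⟨p.fst, h⟩ = p.snd := by
  unfold graphSubmodule
  rw [Submodule.mem_comap, LinearPMap.mem_graph_iff]
  constructor
  · rintro ⟨⟨y, hy⟩, h1, h2⟩
    have h1' : y = p.fst := h1
    subst h1'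
    exact ⟨hy, h2⟩
  · rintro ⟨h, h2⟩
    exact ⟨⟨p.fst, h⟩, rfl, h2⟩

theorem isClosed_graphSubmodule (A : Reg H) :
    IsClosed (graphSubmodule A.1 : Set (WithLp 2 (H × H))) :=
  A.2.1.preimage (WithLp.prod_continuous_ofLp 2 H H)

variable [CompleteSpace H]

instance (A : Reg H) : (graphSubmodule A.1).HasOrthogonalProjection :=
  haveI : CompleteSpace (graphSubmodule A.1) :=
    (isClosed_graphSubmodule A).completeSpace_coe
  inferInstance

/-- The orthogonal projection of `H ⊕ H` onto the graph of `A`. -/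
def graphProj (A : Reg H) : WithLp 2 (H × H) →L[ℂ] WithLp 2 (H × H) :=
  (graphSubmodule A.1).starProjection

/-! ### The bounded operators `(1 + A* A)⁻¹` and `(1 + A A*)⁻¹` -/

/-- The inclusion of `H` as the first summand of `H ⊕ H`. -/
def inl₂ : H →L[ℂ] WithLp 2 (H × H) :=
  (WithLp.prodContinuousLinearEquiv 2 ℂ H H).symm.toContinuousLinearMap.comp
    (ContinuousLinearMap.inl ℂ H H)

/-- The inclusion of `H` as the second summand of `H ⊕ H`. -/
def inr₂ : H →L[ℂ] WithLp 2 (H × H) :=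
  (WithLp.prodContinuousLinearEquiv 2 ℂ H H).symm.toContinuousLinearMap.comp
    (ContinuousLinearMap.inr ℂ H H)

/-- The projection of `H ⊕ H` to the first summand. -/
def fst₂ : WithLp 2 (H × H) →L[ℂ] H :=
  (ContinuousLinearMap.fst ℂ H H).comp
    (WithLp.prodContinuousLinearEquiv 2 ℂ H H).toContinuousLinearMap

/-- The projection of `H ⊕ H` to the second summand. -/
def snd₂ : WithLp 2 (H × H) →L[ℂ] H :=
  (ContinuousLinearMap.snd ℂ H H).comp
    (WithLp.prodContinuousLinearEquiv 2 ℂ H H).toContinuousLinearMap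

/-- The bounded operator `(1 + A* A)⁻¹`: it is the upper left corner of the projection
onto the graph of `A`. See `resolvent_spec` and `resolvent_unique`. -/
def resolvent (A : Reg H) : H →L[ℂ] H := fst₂.comp ((graphProj A).comp inl₂)

/-- The bounded operator `(1 + A A*)⁻¹`: the lower right corner of the projection onto the
graph of `A` is `1 - (1 + A A*)⁻¹`. See `coresolvent_spec` and `coresolvent_unique`. -/
def coresolvent (A : Reg H) : H →L[ℂ] H :=
  ContinuousLinearMap.id ℂ H - snd₂.comp ((graphProj A).comp inr₂)

theorem graphProj_mem (A : Reg H) (p : WithLp 2 (H × H)) :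
    ∃ h : (graphProj A p).fst ∈ A.1.domain,
      A.1 ⟨(graphProj A p).fst, h⟩ = (graphProj A p).snd :=
  (mem_graphSubmodule A.1 _).1 (Submodule.starProjection_apply_mem _ _)

theorem graphProj_inner (A : Reg H) (p : WithLp 2 (H × H)) (z : A.1.domain) :
    ⟪p.fst - (graphProj A p).fst, (z : H)⟫_ℂ + ⟪p.snd - (graphProj A p).snd, A.1 z⟫_ℂ = 0 := by
  have h := Submodule.starProjection_inner_eq_zero (K := graphSubmodule A.1) p
    (WithLp.toLp 2 ((z : H), A.1 z)) ((mem_graphSubmodule A.1 _).2 ⟨z.2, rfl⟩)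
  rw [WithLp.prod_inner_apply] at h
  exact h

/-- `(1 + A* A) (resolvent A x) = x`; in particular `resolvent A x` is in `dom (A* A)`. -/
theorem resolvent_spec (A : Reg H) (x : H) :
    ∃ (h : resolvent A x ∈ A.1.domain) (h' : A.1 ⟨resolvent A x, h⟩ ∈ (A.1†).domain),
      resolvent A x + A.1† ⟨A.1 ⟨resolvent A x, h⟩, h'⟩ = x := by
  obtain ⟨h, hA⟩ := graphProj_mem A (inl₂ x)
  have key : ∀ z : A.1.domain,
      ⟪x - resolvent A x, (z : H)⟫_ℂ = ⟪A.1 ⟨resolvent A x, h⟩, A.1 z⟫_ℂ := by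
    intro z
    have := graphProj_inner A (inl₂ x) z
    rw [← hA] at this
    have e : (inl₂ x).snd - A.1 ⟨(graphProj A (inl₂ x)).fst, h⟩ =
        - A.1 ⟨resolvent A x, h⟩ := zero_sub _
    rw [e, inner_neg_left, ← sub_eq_add_neg, sub_eq_zero] at this
    exact this
  have h' : A.1 ⟨resolvent A x, h⟩ ∈ (A.1†).domain :=
    LinearPMap.mem_adjoint_domain_of_exists _ ⟨_, key⟩
  refine ⟨h, h', ?_⟩
  rw [LinearPMap.adjoint_apply_eq A.2.2 ⟨_, h'⟩ key]
  abel

/-- `1 + A* A` is injective, so `resolvent A` is its inverse. -/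
theorem resolvent_unique (A : Reg H) (x y : H) (h : y ∈ A.1.domain)
    (h' : A.1 ⟨y, h⟩ ∈ (A.1†).domain) (hy : y + A.1† ⟨A.1 ⟨y, h⟩, h'⟩ = x) :
    y = resolvent A x := by
  obtain ⟨k, k', hk⟩ := resolvent_spec A x
  have e := hy.trans hk.symm
  have hw : y - resolvent A x ∈ A.1.domain := A.1.domain.sub_mem h k
  have hAw : A.1 ⟨y - resolvent A x, hw⟩ = A.1 ⟨y, h⟩ - A.1 ⟨resolvent A x, k⟩ :=
    A.1.map_sub ⟨y, h⟩ ⟨_, k⟩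
  have f1 := LinearPMap.adjoint_isFormalAdjoint A.2.2 ⟨_, h'⟩ ⟨_, hw⟩
  have f2 := LinearPMap.adjoint_isFormalAdjoint A.2.2 ⟨_, k'⟩ ⟨_, hw⟩
  have e2 : A.1† ⟨A.1 ⟨y, h⟩, h'⟩ - A.1† ⟨A.1 ⟨resolvent A x, k⟩, k'⟩ =
      -(y - resolvent A x) := by
    have e1 := eq_sub_of_add_eq' hy
    have e3 := eq_sub_of_add_eq' hk
    rw [e1, e3]
    abel
  have g : ⟪-(y - resolvent A x), y - resolvent A x⟫_ℂ =
      ⟪A.1 ⟨y - resolvent A x, hw⟩, A.1 ⟨y - resolvent A x, hw⟩⟫_ℂ := by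
    rw [← e2, inner_sub_left, f1, f2, ← inner_sub_left]
    simp only [hAw]
  rw [inner_neg_left, inner_self_eq_norm_sq_to_K, inner_self_eq_norm_sq_to_K] at g
  have g' : -(‖y - resolvent A x‖ ^ 2) = ‖A.1 ⟨y - resolvent A x, hw⟩‖ ^ 2 := by
    exact_mod_cast g
  have : ‖y - resolvent A x‖ = 0 := by
    nlinarith [sq_nonneg ‖A.1 ⟨y - resolvent A x, hw⟩‖, sq_nonneg ‖y - resolvent A x‖]
  exact sub_eq_zero.1 (norm_eq_zero.1 this)

/-- `(1 + A A*) (coresolvent A x) = x`; in particular `coresolvent A x` is in `dom (A A*)`. -/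
theorem coresolvent_spec (A : Reg H) (x : H) :
    ∃ (h : coresolvent A x ∈ (A.1†).domain)
      (h' : A.1† ⟨coresolvent A x, h⟩ ∈ A.1.domain),
      coresolvent A x + A.1 ⟨A.1† ⟨coresolvent A x, h⟩, h'⟩ = x := by
  obtain ⟨h, hA⟩ := graphProj_mem A (inr₂ x)
  have key : ∀ z : A.1.domain,
      ⟪(graphProj A (inr₂ x)).fst, (z : H)⟫_ℂ = ⟪coresolvent A x, A.1 z⟫_ℂ := by
    intro z
    have := graphProj_inner A (inr₂ x) z
    have e : (inr₂ x).fst - (graphProj A (inr₂ x)).fst =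
        - (graphProj A (inr₂ x)).fst := zero_sub _
    rw [e, inner_neg_left, neg_add_eq_zero] at this
    exact this
  have hd : coresolvent A x ∈ (A.1†).domain :=
    LinearPMap.mem_adjoint_domain_of_exists _ ⟨_, key⟩
  have hv : A.1† ⟨coresolvent A x, hd⟩ = (graphProj A (inr₂ x)).fst :=
    LinearPMap.adjoint_apply_eq A.2.2 ⟨_, hd⟩ key
  refine ⟨hd, hv ▸ h, ?_⟩
  have : A.1 ⟨A.1† ⟨coresolvent A x, hd⟩, hv ▸ h⟩ = (graphProj A (inr₂ x)).snd := by
    rw [← hA]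
    congr 1
    exact Subtype.ext hv
  rw [this]
  exact sub_add_cancel _ _

/-- `1 + A A*` is injective, so `coresolvent A` is its inverse. -/
theorem coresolvent_unique (A : Reg H) (x y : H) (h : y ∈ (A.1†).domain)
    (h' : A.1† ⟨y, h⟩ ∈ A.1.domain) (hy : y + A.1 ⟨A.1† ⟨y, h⟩, h'⟩ = x) :
    y = coresolvent A x := by
  obtain ⟨k, k', hk⟩ := coresolvent_spec A x
  set c := coresolvent A x
  have hw : y - c ∈ (A.1†).domain := (A.1†).domain.sub_mem h k
  have hAw : A.1† ⟨y - c, hw⟩ = A.1† ⟨y, h⟩ - A.1† ⟨c, k⟩ :=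
    (A.1†).map_sub ⟨y, h⟩ ⟨_, k⟩
  have f1 := LinearPMap.adjoint_isFormalAdjoint A.2.2 ⟨_, hw⟩ ⟨_, h'⟩
  have f2 := LinearPMap.adjoint_isFormalAdjoint A.2.2 ⟨_, hw⟩ ⟨_, k'⟩
  have e2 : A.1 ⟨A.1† ⟨y, h⟩, h'⟩ - A.1 ⟨A.1† ⟨c, k⟩, k'⟩ = -(y - c) := by
    have e1 := eq_sub_of_add_eq' hy
    have e3 := eq_sub_of_add_eq' hk
    rw [e1, e3]
    abel
  have g : ⟪y - c, -(y - c)⟫_ℂ = ⟪A.1† ⟨y - c, hw⟩, A.1† ⟨y - c, hw⟩⟫_ℂ := by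
    rw [← e2, inner_sub_right]
    change ⟪((⟨y - c, hw⟩ : (A.1†).domain) : H), _⟫_ℂ -
      ⟪((⟨y - c, hw⟩ : (A.1†).domain) : H), _⟫_ℂ = _
    rw [← f1, ← f2, ← inner_sub_right]
    simp only [hAw]
    rfl
  rw [inner_neg_right, inner_self_eq_norm_sq_to_K, inner_self_eq_norm_sq_to_K] at g
  have g' : -(‖y - c‖ ^ 2) = ‖A.1† ⟨y - c, hw⟩‖ ^ 2 := by
    exact_mod_cast g
  have : ‖y - c‖ = 0 := by
    nlinarith [sq_nonneg ‖A.1† ⟨y - c, hw⟩‖, sq_nonneg ‖y - c‖]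
  exact sub_eq_zero.1 (norm_eq_zero.1 this)

/-! ### The bounded transform -/

theorem inner_resolvent (A : Reg H) (x y : H) (h : resolvent A x ∈ A.1.domain)
    (k : resolvent A y ∈ A.1.domain) :
    ⟪x, resolvent A y⟫_ℂ = ⟪resolvent A x, resolvent A y⟫_ℂ +
      ⟪A.1 ⟨resolvent A x, h⟩, A.1 ⟨resolvent A y, k⟩⟫_ℂ := by
  obtain ⟨h1, h2, h3⟩ := resolvent_spec A x
  have f := LinearPMap.adjoint_isFormalAdjoint A.2.2 ⟨_, h2⟩ ⟨_, k⟩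
  rw [← f]
  change _ = _ + ⟪_, resolvent A y⟫_ℂ
  rw [← inner_add_left, h3]

theorem resolvent_nonneg (A : Reg H) : 0 ≤ resolvent A := by
  rw [ContinuousLinearMap.nonneg_iff_isPositive, ContinuousLinearMap.isPositive_iff_complex]
  intro x
  obtain ⟨h, -, -⟩ := resolvent_spec A x
  have e := inner_resolvent A x x h h
  rw [inner_self_eq_norm_sq_to_K, inner_self_eq_norm_sq_to_K] at e
  have e' : ⟪resolvent A x, x⟫_ℂ =
      ((‖resolvent A x‖ ^ 2 + ‖A.1 ⟨resolvent A x, h⟩‖ ^ 2 : ℝ) : ℂ) := by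
    rw [← inner_conj_symm, e]
    simp
  rw [e']
  constructor
  · exact congrArg Complex.ofReal (Complex.ofReal_re _)
  · change 0 ≤ (Complex.ofReal _).re
    rw [Complex.ofReal_re]
    exact add_nonneg (sq_nonneg _) (sq_nonneg _)

/-- The positive bounded operator `(1 + A* A)^(-1/2)`. -/
def resolventSqrt (A : Reg H) : H →L[ℂ] H := CFC.sqrt (resolvent A)

theorem resolventSqrt_sq (A : Reg H) (x : H) :
    resolventSqrt A (resolventSqrt A x) = resolvent A x := by
  have h := CFC.sqrt_mul_sqrt_self (resolvent A) (resolvent_nonneg A)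
  exact congrArg (fun T : H →L[ℂ] H => T x) h

theorem resolventSqrt_inner (A : Reg H) (x y : H) :
    ⟪resolventSqrt A x, y⟫_ℂ = ⟪x, resolventSqrt A y⟫_ℂ := by
  have h : (resolventSqrt A).IsPositive :=
    (ContinuousLinearMap.nonneg_iff_isPositive _).1 (CFC.sqrt_nonneg (resolvent A))
  exact h.isSymmetric x y

theorem denseRange_resolventSqrt (A : Reg H) : DenseRange (resolventSqrt A) := by
  have h : (LinearMap.range (resolventSqrt A).toLinearMap)ᗮ = ⊥ := by
    rw [Submodule.eq_bot_iff]
    intro x hx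
    have h1 : resolventSqrt A x = 0 := by
      rw [← inner_self_eq_zero (𝕜 := ℂ), ← resolventSqrt_inner]
      exact (Submodule.mem_orthogonal _ _).1 hx _ ⟨resolventSqrt A x, rfl⟩
    have h2 : resolvent A x = 0 := by rw [← resolventSqrt_sq, h1, map_zero]
    obtain ⟨h, h', e⟩ := resolvent_spec A x
    have h3 : (⟨resolvent A x, h⟩ : A.1.domain) = 0 := Subtype.ext h2
    have h4 : (⟨A.1 ⟨resolvent A x, h⟩, h'⟩ : (A.1†).domain) = 0 := by
      apply Subtype.ext
      change A.1 ⟨resolvent A x, h⟩ = 0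
      rw [h3, A.1.map_zero]
    rw [h4, (A.1†).map_zero, h2, add_zero] at e
    exact e.symm
  have h' := (Submodule.dense_iff_topologicalClosure_eq_top).2
    ((Submodule.topologicalClosure_eq_top_iff).2 h)
  exact h'

theorem norm_apply_resolvent_le (A : Reg H) (x : H) (h : resolvent A x ∈ A.1.domain) :
    ‖A.1 ⟨resolvent A x, h⟩‖ ≤ ‖resolventSqrt A x‖ := by
  have e := inner_resolvent A x x h h
  have e0 : ⟪x, resolvent A x⟫_ℂ = ⟪resolventSqrt A x, resolventSqrt A x⟫_ℂ := by
    rw [← resolventSqrt_sq, ← resolventSqrt_inner]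
  rw [e0, inner_self_eq_norm_sq_to_K, inner_self_eq_norm_sq_to_K, inner_self_eq_norm_sq_to_K] at e
  have e' : ‖resolventSqrt A x‖ ^ 2 =
      ‖resolvent A x‖ ^ 2 + ‖A.1 ⟨resolvent A x, h⟩‖ ^ 2 := by
    exact_mod_cast e
  exact le_of_sq_le_sq (by nlinarith [sq_nonneg ‖resolvent A x‖]) (norm_nonneg _)

/-- `A (1 + A* A)^(-1/2)` is defined on all of `H` and has norm at most one. -/
theorem apply_resolventSqrt (A : Reg H) (x : H) :
    ∃ h : resolventSqrt A x ∈ A.1.domain, ‖A.1 ⟨resolventSqrt A x, h⟩‖ ≤ ‖x‖ := by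
  obtain ⟨u, hu, hx⟩ := mem_closure_iff_seq_limit.1 (denseRange_resolventSqrt A x)
  choose y hy using hu
  have hd : ∀ n, resolvent A (y n) ∈ A.1.domain := fun n => (resolvent_spec A (y n)).1
  let v : ℕ → H := fun n => A.1 ⟨resolvent A (y n), hd n⟩
  have hv : ∀ n, ‖v n‖ ≤ ‖u n‖ := fun n => by
    rw [← hy n]
    exact norm_apply_resolvent_le A (y n) (hd n)
  have hvd : ∀ m n, dist (v m) (v n) ≤ dist (u m) (u n) := fun m n => by
    have hmn : resolvent A (y m - y n) ∈ A.1.domain := (resolvent_spec A _).1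
    have e : A.1 ⟨resolvent A (y m - y n), hmn⟩ = v m - v n := by
      rw [← A.1.map_sub]
      congr 1
      exact Subtype.ext (map_sub _ _ _)
    rw [dist_eq_norm, dist_eq_norm, ← hy m, ← hy n, ← map_sub, ← e]
    exact norm_apply_resolvent_le A _ hmn
  have hc : CauchySeq v := by
    have hcu := hx.cauchySeq
    rw [Metric.cauchySeq_iff] at hcu ⊢
    intro ε hε
    obtain ⟨N, hN⟩ := hcu ε hε
    exact ⟨N, fun m hm n hn => (hvd m n).trans_lt (hN m hm n hn)⟩
  obtain ⟨w, hw⟩ := cauchySeq_tendsto_of_complete hc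
  have hlim : Filter.Tendsto (fun n => (resolventSqrt A (u n), v n)) Filter.atTop
      (nhds (resolventSqrt A x, w)) :=
    (((resolventSqrt A).continuous.tendsto x).comp hx).prodMk_nhds hw
  have hmem : (resolventSqrt A x, w) ∈ (A.1.graph : Set (H × H)) := by
    refine A.2.1.mem_of_tendsto hlim (Filter.Eventually.of_forall fun n => ?_)
    rw [← hy n, resolventSqrt_sq]
    exact A.1.mem_graph ⟨_, hd n⟩
  obtain ⟨z, hz1, hz2⟩ := (LinearPMap.mem_graph_iff A.1).1 hmem
  have hz1' : (z : H) = resolventSqrt A x := hz1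
  have hz2' : A.1 z = w := hz2
  refine ⟨hz1' ▸ z.2, ?_⟩
  have e : A.1 ⟨resolventSqrt A x, hz1' ▸ z.2⟩ = w := by
    rw [← hz2']
    congr 1
    exact Subtype.ext hz1'.symm
  rw [e]
  exact le_of_tendsto_of_tendsto' hw.norm hx.norm hv

/-- The bounded transform `A (1 + A* A)^(-1/2)`. -/
def boundedTransform (A : Reg H) : H →L[ℂ] H :=
  LinearMap.mkContinuous
    { toFun := fun x => A.1 ⟨resolventSqrt A x, (apply_resolventSqrt A x).1⟩
      map_add' := fun x y => by
        rw [← A.1.map_add]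
        congr 1
        exact Subtype.ext (map_add _ _ _)
      map_smul' := fun c x => by
        rw [RingHom.id_apply, ← A.1.map_smul]
        congr 1
        exact Subtype.ext (map_smul _ _ _) }
    1 fun x => by
      rw [one_mul]
      exact (apply_resolventSqrt A x).2

/-! ### The two topologies -/

variable (H) in
/-- The Riesz topology, induced from the operator norm by the bounded transform. -/
abbrev rieszTopology : TopologicalSpace (Reg H) :=
  TopologicalSpace.induced boundedTransform inferInstance

variable (H) in
/-- The graph topology, induced from the operator norm by the projection onto the graph. -/
abbrev graphTopology : TopologicalSpace (Reg H) :=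
  TopologicalSpace.induced graphProj inferInstance

/-- The subset `S` of the topological space `(Y, t)` is contractible in the subspace topology. -/
def IsContractibleIn {Y : Type*} (t : TopologicalSpace Y) (S : Set Y) : Prop :=
  @ContractibleSpace S (TopologicalSpace.induced Subtype.val t)

/-! ### Classes of regular operators -/

variable (H) in
/-- Invertible regular operators. -/
def RegInv : Set (Reg H) := {A | IsInvertible A.1}

variable (H) in
/-- Regular operators with compact resolvent. -/
def RegK : Set (Reg H) :=
  {A | IsCompactOperator (resolvent A) ∧ IsCompactOperator (coresolvent A)}

variable (H) in
/-- Self-adjoint regular operators. -/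
def RegSA : Set (Reg H) := {A | IsSelfAdjoint A.1}

/-- `A` is positive on some closed invariant subspace of finite codimension. -/
def IsEssPositive (A : H →ₗ.[ℂ] H) : Prop :=
  ∃ V : Submodule ℂ H, IsClosed (V : Set H) ∧ FiniteDimensional ℂ (H ⧸ V) ∧
    ∀ x : A.domain, (x : H) ∈ V → A x ∈ V ∧ 0 ≤ (⟪A x, (x : H)⟫_ℂ).re

/-- `A` is negative on some closed invariant subspace of finite codimension. -/
def IsEssNegative (A : H →ₗ.[ℂ] H) : Prop :=
  ∃ V : Submodule ℂ H, IsClosed (V : Set H) ∧ FiniteDimensional ℂ (H ⧸ V) ∧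
    ∀ x : A.domain, (x : H) ∈ V → A x ∈ V ∧ (⟪A x, (x : H)⟫_ℂ).re ≤ 0

variable (H) in
/-- Essentially positive self-adjoint regular operators. -/
def RegPos : Set (Reg H) := {A | A ∈ RegSA H ∧ IsEssPositive A.1}

variable (H) in
/-- Essentially negative self-adjoint regular operators. -/
def RegNeg : Set (Reg H) := {A | A ∈ RegSA H ∧ IsEssNegative A.1}

variable (H) in
/-- Self-adjoint regular operators that are neither essentially positive nor essentially
negative. -/
def RegStar : Set (Reg H) :=
  {A | A ∈ RegSA H ∧ ¬ IsEssPositive A.1 ∧ ¬ IsEssNegative A.1}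

/-- The operator `(x, y) ↦ (A* y, A x)` on `H ⊕ H`, with domain `dom A ⊕ dom A*`. -/
def hat (A : H →ₗ.[ℂ] H) : WithLp 2 (H × H) →ₗ.[ℂ] WithLp 2 (H × H) where
  domain := (A.domain.prod (A†).domain).comap (WithLp.linearEquiv 2 ℂ (H × H)).toLinearMap
  toFun :=
    { toFun := fun p => WithLp.toLp 2 (A† ⟨p.1.snd, p.2.2⟩, A ⟨p.1.fst, p.2.1⟩)
      map_add' := fun p q => by
        have h1 := (A†).map_add ⟨p.1.snd, p.2.2⟩ ⟨q.1.snd, q.2.2⟩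
        have h2 := A.map_add ⟨p.1.fst, p.2.1⟩ ⟨q.1.fst, q.2.1⟩
        exact congrArg (WithLp.toLp 2) (Prod.ext h1 h2)
      map_smul' := fun c p => by
        have h1 := (A†).map_smul c ⟨p.1.snd, p.2.2⟩
        have h2 := A.map_smul c ⟨p.1.fst, p.2.1⟩
        exact congrArg (WithLp.toLp 2) (Prod.ext h1 h2) }

variable (H) in
/-- Regular operators whose spectrum does not meet `[-l, l]`. -/
def SpecAvoids (l : ℝ) : Set (Reg H) := {A | Spec A.1 ∩ symmInterval l = ∅}

variable (H) in
/-- Regular operators `A` such that the spectrum of `hat A` does not meet `[-l, l]`. -/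
def HatSpecAvoids (l : ℝ) : Set (Reg H) := {A | Spec (hat A.1) ∩ symmInterval l = ∅}

end RegOp

end

noncomputable section

namespace RegOp

open Topology unitInterval

universe u

set_option linter.unusedSectionVars false

/-! An invertible regular operator is known through its bounded inverse `B`, and the spectral
condition becomes `l * ‖B‖ < 1`. For self-adjoint operators this is the spectral radius formula; for
`hat A` it is the same formula for the self-adjoint operator `hatOp B`, which is inverse to `hat A`
and has the norm of `B`. Plain invertibility is the case `l = 0`. The two topologies then call for
different arguments.

Graph topology. `B` and the projection onto the graph are norm continuous functions of each other,
so the question concerns injective operators `B` with dense range in the norm topology, possibly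
self-adjoint, compact or with a condition on the sign. `B` need not be invertible, which permits an
explicit contraction: deform `B` to a multiple of `K B K`, with `K` positive, injective and compact,
then push this operator to infinity by isometries whose adjoints tend strongly to zero, filling the
space set free with a fixed operator `S` (the identity, its negative or a symmetry) compressed by
`K`. Compactness of `K` turns strong continuity into norm continuity. See
`ContractionData.injective_contraction` and `IsContractionClass.contractibleSpace`.

Riesz topology. The bounded transform `a` ranges over the contractions with `1 - star a * a`
injective; invertibility of `A` means invertibility of `a`, and the spectral gap is a lower bound of
`a`. The admissible absolute values form a convex set, so by polar decomposition
(`contractibleSpace_contractiveUnits`) the space is dominated by the unitary group or by the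
symmetries with two infinite-dimensional eigenspaces.

That these two are contractible is Kuiper's theorem. Compact families of invertible operators are
first made to fix an infinite-dimensional subspace and are then removed by an infinite swindle
(`homotopic_one_of_compactSpace`). Compact families of symmetries are conjugate to a constant one by
continuous families of unitaries (`exists_unitary_conj`). The step from compact families to the
whole space is `contractibleSpace_of_compactlyContractible`, a nerve argument for locally convex
sets. -/

/-! ### Contractibility of locally convex spaces of maps into which compact spaces contract -/

/-- The product of the simplex spanned by `s` with the unit interval. -/
def simplexCylinder {ι : Type*} (s : Finset ι) : Set ((ι → ℝ) × ℝ) :=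
  {z | (∀ i, 0 ≤ z.1 i) ∧ (∀ i, i ∉ s → z.1 i = 0) ∧ ∑ i ∈ s, z.1 i = 1 ∧ 0 ≤ z.2 ∧ z.2 ≤ 1}

/-- The boundary of the product of a simplex with the unit interval. -/
def simplexCylinderBoundary {ι : Type*} (s : Finset ι) : Set ((ι → ℝ) × ℝ) :=
  {z | z ∈ simplexCylinder s ∧ ((∃ i ∈ s, z.1 i = 0) ∨ z.2 = 0 ∨ z.2 = 1)}

/-- Every continuous map from a compact Hausdorff space to `Y` is homotopic to a constant. -/
def CompactlyContractible (Y : Type u) [TopologicalSpace Y] : Prop :=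
  ∀ (T : Type u) [TopologicalSpace T] [CompactSpace T] [T2Space T] (f : C(T, Y)),
    f.Nullhomotopic

theorem isClosed_simplexCylinder {ι : Type*} (s : Finset ι) : IsClosed (simplexCylinder s) := by
  have e : simplexCylinder s = (⋂ i, {z : (ι → ℝ) × ℝ | 0 ≤ z.1 i}) ∩
      (⋂ i, ⋂ (_ : i ∉ s), {z : (ι → ℝ) × ℝ | z.1 i = 0}) ∩
      {z : (ι → ℝ) × ℝ | ∑ i ∈ s, z.1 i = 1} ∩ {z : (ι → ℝ) × ℝ | 0 ≤ z.2} ∩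
      {z : (ι → ℝ) × ℝ | z.2 ≤ 1} := by
    ext z
    simp [simplexCylinder, and_assoc]
  rw [e]
  refine ((((isClosed_iInter fun i => ?_).inter (isClosed_iInter fun i => isClosed_iInter
    fun _ => ?_)).inter ?_).inter ?_).inter ?_
  · exact isClosed_le continuous_const (by fun_prop)
  · exact isClosed_eq (by fun_prop) continuous_const
  · exact isClosed_eq (by fun_prop) continuous_const
  · exact isClosed_le continuous_const (by fun_prop)
  · exact isClosed_le (by fun_prop) continuous_const

theorem isCompact_simplexCylinder {ι : Type*} (s : Finset ι) : IsCompact (simplexCylinder s) := by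
  have h : IsCompact ((Set.univ.pi fun _ : ι => Set.Icc (0 : ℝ) 1) ×ˢ Set.Icc (0 : ℝ) 1) :=
    (isCompact_univ_pi fun _ => isCompact_Icc).prod isCompact_Icc
  refine h.of_isClosed_subset (isClosed_simplexCylinder s) ?_
  rintro ⟨z, t⟩ ⟨h0, h1, h2, h3, h4⟩
  refine ⟨fun i _ => ⟨h0 i, ?_⟩, h3, h4⟩
  by_cases hi : i ∈ s
  · exact h2 ▸ Finset.single_le_sum (f := z) (fun j _ => h0 j) hi
  · simp [show z i = 0 from h1 i hi]

theorem isClosed_simplexCylinderBoundary {ι : Type*} (s : Finset ι) :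
    IsClosed (simplexCylinderBoundary s) := by
  have e : simplexCylinderBoundary s = simplexCylinder s ∩
      ((⋃ i ∈ s, {z : (ι → ℝ) × ℝ | z.1 i = 0}) ∪ ({z : (ι → ℝ) × ℝ | z.2 = 0} ∪
        {z : (ι → ℝ) × ℝ | z.2 = 1})) := by
    ext z
    simp [simplexCylinderBoundary, and_or_left]
  rw [e]
  refine (isClosed_simplexCylinder s).inter ((Set.Finite.isClosed_biUnion s.finite_toSet
    fun i _ => ?_).union (IsClosed.union ?_ ?_))
  · exact isClosed_eq (by fun_prop) continuous_const
  · exact isClosed_eq (by fun_prop) continuous_const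
  · exact isClosed_eq (by fun_prop) continuous_const

/-- A normalized distance to the boundary of the product of a simplex with the unit interval. -/
def boundaryDepth {ι : Type*} (s : Finset ι) (hs : s.Nonempty) (z : (ι → ℝ) × ℝ) : ℝ :=
  min (s.inf' hs fun i => s.card * z.1 i) (min (2 * z.2) (2 * (1 - z.2)))

open Classical in
/-- Radial projection of the product of a simplex with the unit interval to its boundary. -/
def boundaryProj {ι : Type*} (s : Finset ι) (hs : s.Nonempty) (z : (ι → ℝ) × ℝ) : (ι → ℝ) × ℝ :=
  (fun i => if i ∈ s then (z.1 i - boundaryDepth s hs z / s.card) / (1 - boundaryDepth s hs z)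
    else 0, 1 / 2 + (z.2 - 1 / 2) / (1 - boundaryDepth s hs z))

/-! ### Radial projection to the boundary of a cylinder, and extension of maps from it. -/

section Boundary

variable {ι : Type*} {s : Finset ι} (hs : s.Nonempty)

theorem continuous_boundaryDepth : Continuous (boundaryDepth s hs) := by
  unfold boundaryDepth
  refine Continuous.min ?_ (by fun_prop)
  exact Continuous.finset_inf'_apply hs fun i _ => by fun_prop

theorem boundaryDepth_nonneg {z : (ι → ℝ) × ℝ} (hz : z ∈ simplexCylinder s) :
    0 ≤ boundaryDepth s hs z := by
  refine le_min ((Finset.le_inf'_iff _ _).2 fun i _ => mul_nonneg (Nat.cast_nonneg _) (hz.1 i))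
    (le_min ?_ ?_) <;> linarith [hz.2.2.2.1, hz.2.2.2.2]

theorem boundaryDepth_eq_zero {z : (ι → ℝ) × ℝ} (hz : z ∈ simplexCylinderBoundary s) :
    boundaryDepth s hs z = 0 := by
  refine le_antisymm ?_ (boundaryDepth_nonneg hs hz.1)
  rcases hz.2 with ⟨i, hi, h⟩ | h | h
  · refine (min_le_left _ _).trans ((Finset.inf'_le _ hi).trans ?_)
    simp [h]
  · refine (min_le_right _ _).trans ((min_le_left _ _).trans ?_)
    simp [h]
  · refine (min_le_right _ _).trans ((min_le_right _ _).trans ?_)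
    simp [h]

theorem boundaryProj_of_mem {z : (ι → ℝ) × ℝ} (hz : z ∈ simplexCylinderBoundary s) :
    boundaryProj s hs z = z := by
  unfold boundaryProj
  rw [boundaryDepth_eq_zero hs hz]
  refine Prod.ext (funext fun i => ?_) ?_
  · by_cases hi : i ∈ s
    · simp [hi]
    · simp [hi, hz.1.2.1 i hi]
  · simp

/-- The centre, with equal barycentric coordinates and height `1 / 2`, is the only point of depth
one. Every other `z` is the convex combination of its projection and the centre with weights `1 - d`
and `d`, and the term attaining the minimum in the depth becomes the boundary condition that holds.
-/
theorem boundaryProj_mem {z : (ι → ℝ) × ℝ} (hz : z ∈ simplexCylinder s)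
    (hd : boundaryDepth s hs z < 1) : boundaryProj s hs z ∈ simplexCylinderBoundary s := by
  have hc : (0 : ℝ) < s.card := Nat.cast_pos.2 hs.card_pos
  set d := boundaryDepth s hs z with hd'
  have hpos : 0 < 1 - d := by linarith
  have h1 : ∀ i ∈ s, d ≤ s.card * z.1 i := fun i hi =>
    (min_le_left _ _).trans (Finset.inf'_le _ hi)
  have h2 : d ≤ 2 * z.2 := (min_le_right _ _).trans (min_le_left _ _)
  have h3 : d ≤ 2 * (1 - z.2) := (min_le_right _ _).trans (min_le_right _ _)
  have h4 : ∀ i ∈ s, d / s.card ≤ z.1 i := fun i hi => by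
    rw [div_le_iff₀ hc, mul_comm]
    exact h1 i hi
  have e2 : (boundaryProj s hs z).2 = 1 / 2 + (z.2 - 1 / 2) / (1 - d) := rfl
  have e1 : ∀ i ∈ s, (boundaryProj s hs z).1 i = (z.1 i - d / s.card) / (1 - d) := fun i hi => by
    simp [boundaryProj, hi, hd']
  have e0 : ∀ i, i ∉ s → (boundaryProj s hs z).1 i = 0 := fun i hi => by
    simp [boundaryProj, hi]
  refine ⟨⟨fun i => ?_, e0, ?_, ?_, ?_⟩, ?_⟩
  · by_cases hi : i ∈ s
    · rw [e1 i hi]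
      exact div_nonneg (sub_nonneg.2 (h4 i hi)) hpos.le
    · rw [e0 i hi]
  · rw [Finset.sum_congr rfl e1, ← Finset.sum_div, Finset.sum_sub_distrib, hz.2.2.1,
      Finset.sum_const, nsmul_eq_mul, mul_div_cancel₀ _ hc.ne', div_self hpos.ne']
  · rw [e2]
    have : -(1 / 2) ≤ (z.2 - 1 / 2) / (1 - d) := by
      rw [le_div_iff₀ hpos]
      linarith
    linarith
  · rw [e2]
    have : (z.2 - 1 / 2) / (1 - d) ≤ 1 / 2 := by
      rw [div_le_iff₀ hpos]
      linarith
    linarith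
  · rcases min_choice (s.inf' hs fun i => (s.card : ℝ) * z.1 i) (min (2 * z.2) (2 * (1 - z.2)))
      with h | h
    · left
      obtain ⟨i, hi, h'⟩ := Finset.exists_mem_eq_inf' hs fun i => (s.card : ℝ) * z.1 i
      refine ⟨i, hi, ?_⟩
      have : d = s.card * z.1 i := h.trans h'
      rw [e1 i hi, this, mul_div_cancel_left₀ _ hc.ne']
      simp
    · right
      rcases min_choice (2 * z.2) (2 * (1 - z.2)) with h' | h'
      · left
        have : d = 2 * z.2 := h.trans h'
        rw [e2]
        have : (z.2 - 1 / 2) / (1 - d) = -(1 / 2) := by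
          rw [div_eq_iff hpos.ne']
          linarith
        linarith
      · right
        have : d = 2 * (1 - z.2) := h.trans h'
        rw [e2]
        have : (z.2 - 1 / 2) / (1 - d) = 1 / 2 := by
          rw [div_eq_iff hpos.ne']
          linarith
        linarith

/-- Maps from the boundary of the product of a simplex with the interval extend. -/
theorem exists_extension_simplexCylinder {ι E : Type u} {s : Finset ι} (hs : s.Nonempty)
    [TopologicalSpace E] {G : Set E} (hnull : CompactlyContractible G) {f : (ι → ℝ) × ℝ → E}
    (hf : ContinuousOn f (simplexCylinderBoundary s))
    (hG : Set.MapsTo f (simplexCylinderBoundary s) G) :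
    ∃ g : (ι → ℝ) × ℝ → E, ContinuousOn g (simplexCylinder s) ∧
      Set.MapsTo g (simplexCylinder s) G ∧ Set.EqOn g f (simplexCylinderBoundary s) := by
  classical
  have hB : IsCompact (simplexCylinderBoundary s) :=
    (isCompact_simplexCylinder s).of_isClosed_subset (isClosed_simplexCylinderBoundary s)
      fun z hz => hz.1
  have : CompactSpace (simplexCylinderBoundary s) := isCompact_iff_compactSpace.1 hB
  let f' : C(simplexCylinderBoundary s, G) :=
    ⟨fun z => ⟨f z, hG z.2⟩, (continuousOn_iff_continuous_domRestrict.1 hf).subtype_mk _⟩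
  obtain ⟨y, ⟨h⟩⟩ := hnull _ f'
  -- In the outer collar the nullhomotopy is run at time `2 * boundaryDepth` along the radial
  -- projection; by depth `1 / 2` it has reached the constant, which fills the core. The centre,
  -- where the projection is undefined, is thus avoided.
  let C₁ : Set ((ι → ℝ) × ℝ) := simplexCylinder s ∩ {z | boundaryDepth s hs z ≤ 1 / 2}
  let C₂ : Set ((ι → ℝ) × ℝ) := simplexCylinder s ∩ {z | 1 / 2 ≤ boundaryDepth s hs z}
  have hC₁ : IsClosed C₁ := (isClosed_simplexCylinder s).inter
    (isClosed_le (continuous_boundaryDepth hs) continuous_const)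
  have hC₂ : IsClosed C₂ := (isClosed_simplexCylinder s).inter
    (isClosed_le continuous_const (continuous_boundaryDepth hs))
  have hU : simplexCylinder s = C₁ ∪ C₂ := by
    ext z
    constructor
    · intro hz
      rcases le_total (boundaryDepth s hs z) (1 / 2) with h | h
      · exact Or.inl ⟨hz, h⟩
      · exact Or.inr ⟨hz, h⟩
    · rintro (h | h) <;> exact h.1
  have m1 : ∀ z ∈ C₁, 2 * boundaryDepth s hs z ∈ I := fun z hz =>
    ⟨mul_nonneg zero_le_two (boundaryDepth_nonneg hs hz.1), by
      have := hz.2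
      simp only [Set.mem_ofPred_eq] at this
      linarith⟩
  have m2 : ∀ z ∈ C₁, boundaryProj s hs z ∈ simplexCylinderBoundary s := fun z hz =>
    boundaryProj_mem hs hz.1 (lt_of_le_of_lt hz.2 (by norm_num))
  let k : C₁ → E := fun z => h (⟨2 * boundaryDepth s hs z, m1 z z.2⟩, ⟨boundaryProj s hs z, m2 z z.2⟩)
  have hk : Continuous k := by
    refine continuous_subtype_val.comp (h.continuous.comp (Continuous.prodMk
      (Continuous.subtype_mk ?_ _) (Continuous.subtype_mk ?_ _)))
    · exact continuous_const.mul ((continuous_boundaryDepth hs).comp continuous_subtype_val)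
    · have hd : Continuous fun z : C₁ => boundaryDepth s hs z :=
        (continuous_boundaryDepth hs).comp continuous_subtype_val
      have hne : ∀ z : C₁, 1 - boundaryDepth s hs z ≠ 0 := fun z => by
        have := z.2.2
        simp only [Set.mem_ofPred_eq] at this
        intro h
        linarith
      refine Continuous.prodMk (continuous_pi fun i => ?_) ?_
      · by_cases hi : i ∈ s
        · simp only [hi, if_true]
          refine Continuous.div (Continuous.sub ?_ (hd.div_const _)) (continuous_const.sub hd) hne
          exact ((continuous_apply i).comp continuous_fst).comp continuous_subtype_val
        · simp only [hi, if_false]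
          exact continuous_const
      · refine continuous_const.add (Continuous.div (Continuous.sub ?_ continuous_const)
          (continuous_const.sub hd) hne)
        exact continuous_snd.comp continuous_subtype_val
  let g : (ι → ℝ) × ℝ → E := fun z => if hz : z ∈ C₁ then k ⟨z, hz⟩ else y
  have hg₁ : ∀ z (hz : z ∈ C₁), g z = k ⟨z, hz⟩ := fun z hz => dif_pos hz
  have hg₂ : ∀ z ∈ C₂, g z = y := fun z hz => by
    by_cases hz' : z ∈ C₁
    · rw [hg₁ z hz']
      have e : (⟨2 * boundaryDepth s hs z, m1 z hz'⟩ : I) = 1 := by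
        apply Subtype.ext
        have := hz.2
        have h' := hz'.2
        simp only [Set.mem_ofPred_eq] at this h'
        change 2 * boundaryDepth s hs z = 1
        linarith
      change (h (⟨2 * boundaryDepth s hs z, m1 z hz'⟩, _) : E) = y
      rw [e, h.apply_one]
      rfl
    · exact dif_neg hz'
  refine ⟨g, ?_, ?_, ?_⟩
  · rw [hU]
    refine ContinuousOn.union_of_isClosed ?_ ?_ hC₁ hC₂
    · rw [continuousOn_iff_continuous_domRestrict]
      refine hk.congr fun z => ?_
      exact (hg₁ z z.2).symm
    · exact continuousOn_const.congr hg₂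
  · intro z hz
    rw [hU] at hz
    rcases hz with hz | hz
    · rw [hg₁ z hz]
      exact (h _).2
    · rw [hg₂ z hz]
      exact y.2
  · intro z hz
    have hd := boundaryDepth_eq_zero hs hz
    have hz' : z ∈ C₁ := ⟨hz.1, by simp [hd]⟩
    rw [hg₁ z hz']
    have e : (⟨2 * boundaryDepth s hs z, m1 z hz'⟩ : I) = 0 := Subtype.ext (by simp [hd])
    have e' : (⟨boundaryProj s hs z, m2 z hz'⟩ : simplexCylinderBoundary s) = ⟨z, hz⟩ :=
      Subtype.ext (boundaryProj_of_mem hs hz)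
    change (h (⟨2 * boundaryDepth s hs z, m1 z hz'⟩, ⟨boundaryProj s hs z, m2 z hz'⟩) : E) = f z
    rw [e, e', h.apply_zero]
    rfl

end Boundary

/-! ### Homotopies constructed simplex by simplex. -/

section Simplexwise

variable {ι E : Type u} [TopologicalSpace E] {G : Set E}

/-- `F` is, on the cylinders over the admissible simplices with at most `n` vertices, a homotopy
in `G` from `b` to the constant `g₀`. -/
def IsCylinderHomotopy (G : Set E) (P : Finset ι → Prop) (b : (ι → ℝ) → E) (g₀ : E) (n : ℕ)
    (F : (ι → ℝ) × ℝ → E) : Prop :=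
  ∀ s : Finset ι, s.Nonempty → P s → s.card ≤ n → ContinuousOn F (simplexCylinder s) ∧
    Set.MapsTo F (simplexCylinder s) G ∧ (∀ z ∈ simplexCylinder s, z.2 = 0 → F z = b z.1) ∧
    ∀ z ∈ simplexCylinder s, z.2 = 1 → F z = g₀

theorem simplexCylinder_erase [DecidableEq ι] {s : Finset ι} {z : (ι → ℝ) × ℝ}
    (hz : z ∈ simplexCylinder s) {i : ι} (h0 : z.1 i = 0) :
    z ∈ simplexCylinder (s.erase i) := by
  refine ⟨hz.1, fun j hj => ?_, ?_, hz.2.2.2⟩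
  · by_cases hji : j = i
    · rw [hji, h0]
    · exact hz.2.1 j fun h => hj (Finset.mem_erase.2 ⟨hji, h⟩)
  · rw [Finset.sum_erase _ h0]
    exact hz.2.2.1

theorem nonempty_of_mem_simplexCylinder {s : Finset ι} {z : (ι → ℝ) × ℝ}
    (hz : z ∈ simplexCylinder s) : s.Nonempty := by
  rw [Finset.nonempty_iff_ne_empty]
  rintro rfl
  simpa using hz.2.2.1

theorem subset_of_mem_simplexCylinder {s t : Finset ι} {z : (ι → ℝ) × ℝ}
    (hs : ∀ i ∈ s, z.1 i ≠ 0) (ht : z ∈ simplexCylinder t) : s ⊆ t := fun i hi => by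
  by_contra h
  exact hs i hi (ht.2.1 i h)

/-- The old values on the faces, with `b` at the bottom and `g₀` at the top, form a continuous map
on the boundary of each cylinder over a simplex with `n + 1` vertices, so
`exists_extension_simplexCylinder` applies. Different simplices of this size meet only in proper
faces. -/
theorem IsCylinderHomotopy.exists_succ (hnull : CompactlyContractible G) {P : Finset ι → Prop}
    (hP : ∀ s t : Finset ι, t ⊆ s → t.Nonempty → P s → P t) {b : (ι → ℝ) → E} {g₀ : E}
    (hg₀ : g₀ ∈ G)
    (hb : ∀ s, P s → ContinuousOn (fun z : (ι → ℝ) × ℝ => b z.1) (simplexCylinder s))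
    (hbG : ∀ s, P s → ∀ z ∈ simplexCylinder s, b z.1 ∈ G) {n : ℕ} {F : (ι → ℝ) × ℝ → E}
    (hF : IsCylinderHomotopy G P b g₀ n F) :
    ∃ F' : (ι → ℝ) × ℝ → E, IsCylinderHomotopy G P b g₀ (n + 1) F' ∧
      ∀ s, P s → s.card ≤ n → Set.EqOn F' F (simplexCylinder s) := by
  classical
  let f : (ι → ℝ) × ℝ → E := fun z => if z.2 = 0 then b z.1 else if z.2 = 1 then g₀ else F z
  have hf0 : ∀ z, z.2 = 0 → f z = b z.1 := fun z h => if_pos h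
  have hf1 : ∀ z, z.2 = 1 → f z = g₀ := fun z h => by simp [f, h]
  have hface : ∀ s, P s → s.card ≤ n + 1 → ∀ i ∈ s, ∀ z ∈ simplexCylinder s, z.1 i = 0 →
      z ∈ simplexCylinder (s.erase i) ∧ (s.erase i).Nonempty ∧ P (s.erase i) ∧
        (s.erase i).card ≤ n := by
    intro s hs hc i hi z hz h0
    have h1 := simplexCylinder_erase hz h0
    have h2 := nonempty_of_mem_simplexCylinder h1
    refine ⟨h1, h2, hP _ _ (Finset.erase_subset _ _) h2 hs, ?_⟩
    rw [Finset.card_erase_of_mem hi]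
    omega
  have hfF : ∀ s, s.Nonempty → P s → s.card ≤ n → Set.EqOn f F (simplexCylinder s) := by
    intro s hne hs hc z hz
    obtain ⟨-, -, h0, h1⟩ := hF s hne hs hc
    by_cases hz0 : z.2 = 0
    · rw [hf0 z hz0, h0 z hz hz0]
    by_cases hz1 : z.2 = 1
    · rw [hf1 z hz1, h1 z hz hz1]
    simp [f, hz0, hz1]
  have hext : ∀ s : Finset ι, s.Nonempty → P s → s.card = n + 1 → ∃ g : (ι → ℝ) × ℝ → E,
      ContinuousOn g (simplexCylinder s) ∧ Set.MapsTo g (simplexCylinder s) G ∧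
        Set.EqOn g f (simplexCylinderBoundary s) := by
    intro s hne hs hc
    refine exists_extension_simplexCylinder hne hnull ?_ ?_
    · have e : simplexCylinderBoundary s =
          (⋃ i : s, (simplexCylinder s ∩ {z : (ι → ℝ) × ℝ | z.1 i = 0})) ∪
          ((simplexCylinder s ∩ {z : (ι → ℝ) × ℝ | z.2 = 0}) ∪
            (simplexCylinder s ∩ {z : (ι → ℝ) × ℝ | z.2 = 1})) := by
        ext z
        simp [simplexCylinderBoundary, and_or_left]
      have hcl := isClosed_simplexCylinder s
      have c1 : ∀ i : s, IsClosed (simplexCylinder s ∩ {z : (ι → ℝ) × ℝ | z.1 i = 0}) := fun i =>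
        hcl.inter (isClosed_eq (by fun_prop) continuous_const)
      have c2 : IsClosed (simplexCylinder s ∩ {z : (ι → ℝ) × ℝ | z.2 = 0}) :=
        hcl.inter (isClosed_eq (by fun_prop) continuous_const)
      have c3 : IsClosed (simplexCylinder s ∩ {z : (ι → ℝ) × ℝ | z.2 = 1}) :=
        hcl.inter (isClosed_eq (by fun_prop) continuous_const)
      rw [e]
      refine ContinuousOn.union_of_isClosed ?_ (ContinuousOn.union_of_isClosed ?_ ?_ c2 c3)
        (isClosed_iUnion_of_finite c1) (c2.union c3)
      · refine LocallyFinite.continuousOn_iUnion (locallyFinite_of_finite _) c1 fun i => ?_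
        rintro z ⟨hz, h0⟩
        obtain ⟨h1, h2, h3, h4⟩ := hface s hs hc.le i i.2 z hz h0
        have hsub : simplexCylinder s ∩ {z : (ι → ℝ) × ℝ | z.1 i = 0} ⊆
            simplexCylinder (s.erase i) := fun w hw => (hface s hs hc.le i i.2 w hw.1 hw.2).1
        exact (((hF _ h2 h3 h4).1.mono hsub).congr fun w hw =>
          hfF _ h2 h3 h4 (hsub hw)) z ⟨hz, h0⟩
      · exact ((hb s hs).mono Set.inter_subset_left).congr fun z hz => hf0 z hz.2
      · exact continuousOn_const.congr fun z hz => hf1 z hz.2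
    · rintro z ⟨hz, ⟨i, hi, h⟩ | h | h⟩
      · obtain ⟨h1, h2, h3, h4⟩ := hface s hs hc.le i hi z hz h
        rw [hfF _ h2 h3 h4 h1]
        exact (hF _ h2 h3 h4).2.1 h1
      · rw [hf0 z h]
        exact hbG s hs z hz
      · rw [hf1 z h]
        exact hg₀
  have : Nonempty E := ⟨g₀⟩
  choose! ext hext1 hext2 hext3 using hext
  -- A point with no vanishing coordinate on `s` determines `s`, so the extensions over different
  -- simplices can be chosen independently.
  let full : (ι → ℝ) × ℝ → Finset ι → Prop := fun z s =>
    P s ∧ s.card = n + 1 ∧ z ∈ simplexCylinder s ∧ ∀ i ∈ s, z.1 i ≠ 0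
  let F' : (ι → ℝ) × ℝ → E := fun z => if h : ∃ s, full z s then ext h.choose z else F z
  have hF'1 : ∀ s z, full z s → F' z = ext s z := by
    intro s z h
    have h' : ∃ s, full z s := ⟨s, h⟩
    have e : h'.choose = s := by
      obtain ⟨-, -, k1, k2⟩ := h'.choose_spec
      exact Finset.Subset.antisymm (subset_of_mem_simplexCylinder k2 h.2.2.1)
        (subset_of_mem_simplexCylinder h.2.2.2 k1)
    change dite _ _ _ = _
    rw [dif_pos h', e]
  have hF'2 : ∀ s, s.card ≤ n → Set.EqOn F' F (simplexCylinder s) := by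
    intro s hc z hz
    refine dif_neg ?_
    rintro ⟨t, -, k1, k2, k3⟩
    have := Finset.card_le_card (subset_of_mem_simplexCylinder k3 hz)
    omega
  have hF'3 : ∀ s, s.Nonempty → P s → s.card = n + 1 →
      Set.EqOn F' (ext s) (simplexCylinder s) := by
    intro s hne hs hc z hz
    by_cases h : ∀ i ∈ s, z.1 i ≠ 0
    · exact hF'1 s z ⟨hs, hc, hz, h⟩
    · push Not at h
      obtain ⟨i, hi, h0⟩ := h
      obtain ⟨h1, h2, h3, h4⟩ := hface s hs hc.le i hi z hz h0
      rw [hF'2 _ h4 h1, hext3 s hne hs hc ⟨hz, Or.inl ⟨i, hi, h0⟩⟩, hfF _ h2 h3 h4 h1]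
  refine ⟨F', fun s hne hs hc => ?_, fun s _ hc => hF'2 s hc⟩
  rcases Nat.le_succ_iff.1 hc with hc | hc
  · have e := hF'2 s hc
    obtain ⟨k1, k2, k3, k4⟩ := hF s hne hs hc
    exact ⟨k1.congr e, k2.congr e.symm, fun z hz h => (e hz).trans (k3 z hz h),
      fun z hz h => (e hz).trans (k4 z hz h)⟩
  · have e := hF'3 s hne hs hc
    refine ⟨(hext1 s hne hs hc).congr e, (hext2 s hne hs hc).congr e.symm, fun z hz h => ?_,
      fun z hz h => ?_⟩
    · rw [e hz, hext3 s hne hs hc ⟨hz, Or.inr (Or.inl h)⟩, hf0 z h]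
    · rw [e hz, hext3 s hne hs hc ⟨hz, Or.inr (Or.inr h)⟩, hf1 z h]

/-- Each stage agrees with the earlier ones on their simplices, so the limit can be read off at the
stage given by the number of nonzero barycentric coordinates. Stage zero is vacuous, since
admissible simplices are nonempty. -/
theorem exists_cylinderHomotopy (hnull : CompactlyContractible G) {P : Finset ι → Prop}
    (hP : ∀ s t : Finset ι, t ⊆ s → t.Nonempty → P s → P t) {b : (ι → ℝ) → E} {g₀ : E}
    (hg₀ : g₀ ∈ G)
    (hb : ∀ s, P s → ContinuousOn (fun z : (ι → ℝ) × ℝ => b z.1) (simplexCylinder s))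
    (hbG : ∀ s, P s → ∀ z ∈ simplexCylinder s, b z.1 ∈ G) :
    ∃ F : (ι → ℝ) × ℝ → E, ∀ n, IsCylinderHomotopy G P b g₀ n F := by
  classical
  let step : ∀ n, {F // IsCylinderHomotopy G P b g₀ n F} →
      {F // IsCylinderHomotopy G P b g₀ (n + 1) F} := fun n F =>
    ⟨(F.2.exists_succ hnull hP hg₀ hb hbG).choose,
      (F.2.exists_succ hnull hP hg₀ hb hbG).choose_spec.1⟩
  have hstep : ∀ n F s, P s → s.card ≤ n → Set.EqOn (step n F).1 F.1 (simplexCylinder s) :=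
    fun n F => (F.2.exists_succ hnull hP hg₀ hb hbG).choose_spec.2
  let S : ∀ n, {F // IsCylinderHomotopy G P b g₀ n F} := fun n =>
    Nat.rec ⟨fun _ => g₀, fun s hne _ hc => (Nat.not_succ_le_zero _ (hne.card_pos.trans_le hc)).elim⟩ step n
  have hS : ∀ n s, P s → s.card ≤ n → Set.EqOn (S n).1 (S s.card).1 (simplexCylinder s) := by
    intro n s hs hc
    induction n, hc using Nat.le_induction with
    | base => exact fun _ _ => rfl
    | succ n hc ih => exact (hstep n (S n) s hs hc).trans ih
  let F : (ι → ℝ) × ℝ → E := fun z => (S (Function.support z.1).ncard).1 z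
  have hF : ∀ s, P s → Set.EqOn F (S s.card).1 (simplexCylinder s) := by
    intro s hs z hz
    let t := s.filter fun i => z.1 i ≠ 0
    have ht : t ⊆ s := Finset.filter_subset _ _
    have hts : Function.support z.1 = t := by
      ext i
      simp only [Function.mem_support, Finset.coe_filter, Set.mem_ofPred_eq, t]
      refine ⟨fun h => ⟨?_, h⟩, fun h => h.2⟩
      by_contra h'
      exact h (hz.2.1 i h')
    have hzt : z ∈ simplexCylinder t := by
      refine ⟨hz.1, fun i hi => ?_, ?_, hz.2.2.2⟩
      · by_contra h
        exact hi (by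
          have : i ∈ (t : Set ι) := hts ▸ h
          exact this)
      · rw [Finset.sum_filter_ne_zero]
        exact hz.2.2.1
    have hcard : (Function.support z.1).ncard = t.card := by
      rw [hts, Set.ncard_coe_finset]
    change (S (Function.support z.1).ncard).1 z = _
    rw [hcard]
    exact (hS s.card t (hP s t ht (nonempty_of_mem_simplexCylinder hzt) hs)
      (Finset.card_le_card ht) hzt).symm
  refine ⟨F, fun n s hne hs _ => ?_⟩
  obtain ⟨k1, k2, k3, k4⟩ := (S s.card).2 s hne hs le_rfl
  have e := hF s hs
  exact ⟨k1.congr e, k2.congr e.symm, fun z hz h => (e hz).trans (k3 z hz h),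
    fun z hz h => (e hz).trans (k4 z hz h)⟩

end Simplexwise

/-- The ball around the vertex `i` of largest radius contains everything: another vertex `j` has
distance less than `r j / 4 + r i / 4 ≤ r i / 2` from `i`. -/
theorem exists_convexHull_subset_of_forall_mem_ball {E : Type u} [NormedAddCommGroup E]
    [NormedSpace ℝ E] {G : Set E} {r : G → ℝ}
    (hr : ∀ x : G, convexHull ℝ (G ∩ Metric.ball (x : E) (r x)) ⊆ G) {s : Finset G}
    (hs : s.Nonempty) {x : G} (hx : ∀ i ∈ s, dist x i < r i / 4) :
    convexHull ℝ (insert (x : E) (Subtype.val '' (s : Set G))) ⊆ G := by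
  obtain ⟨i, hi, hmax⟩ := s.exists_max_image r hs
  refine (convexHull_mono ?_).trans (hr i)
  have hpos : 0 < r i := by
    have := (dist_nonneg (x := x) (y := i)).trans_lt (hx i hi)
    linarith
  rintro y (rfl | ⟨j, hj, rfl⟩)
  · refine ⟨x.2, ?_⟩
    rw [Metric.mem_ball]
    have : dist (x : E) i < r i / 4 := hx i hi
    linarith
  · refine ⟨j.2, ?_⟩
    rw [Metric.mem_ball]
    have h1 : dist (x : E) i < r i / 4 := hx i hi
    have h2 : dist (x : E) j < r j / 4 := hx j hj
    have h3 := hmax j hj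
    have h4 := dist_triangle_left (j : E) i x
    linarith

/-- A locally convex subset of a normed space into which all compact spaces contract is
contractible. -/
theorem contractibleSpace_of_compactlyContractible {E : Type u} [NormedAddCommGroup E]
    [NormedSpace ℝ E] {G : Set E} (hne : G.Nonempty)
    (hloc : ∀ x ∈ G, ∃ r > 0, convexHull ℝ (G ∩ Metric.ball x r) ⊆ G)
    (hnull : CompactlyContractible G) : ContractibleSpace G := by
  classical
  obtain ⟨g₀, hg₀⟩ := hne
  have hloc' : ∀ x : G, ∃ r > 0, convexHull ℝ (G ∩ Metric.ball (x : E) r) ⊆ G :=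
    fun x => hloc x x.2
  choose r hr0 hr using hloc'
  -- The identity is moved linearly to `x ↦ ∑ φ i x • i`. This map factors through the nerve of the
  -- cover, over which the homotopy `F` below leads to a constant.
  obtain ⟨φ, hφ⟩ := PartitionOfUnity.exists_isSubordinate (ι := G) (X := G) (s := Set.univ)
    isClosed_univ (fun i => Metric.ball i (r i / 4)) (fun _ => Metric.isOpen_ball) fun x _ =>
      Set.mem_iUnion.2 ⟨x, Metric.mem_ball_self (by linarith [hr0 x])⟩
  have hφd : ∀ (i x : G), φ i x ≠ 0 → dist x i < r i / 4 := fun i x h =>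
    hφ i (subset_closure h)
  let P : Finset G → Prop := fun s => convexHull ℝ (Subtype.val '' (s : Set G)) ⊆ G
  let b : (G → ℝ) → E := fun z => ∑ᶠ i, z i • (i : E)
  have hb' : ∀ (s : Finset G) (z : (G → ℝ) × ℝ), z ∈ simplexCylinder s →
      b z.1 = ∑ i ∈ s, z.1 i • (i : E) := fun s z hz => by
    refine finsum_eq_sum_of_support_subset _ fun i hi => ?_
    by_contra h
    exact hi (by simp [hz.2.1 i h])
  have hbc : ∀ (s : Finset G) (z : (G → ℝ) × ℝ), z ∈ simplexCylinder s →
      b z.1 ∈ convexHull ℝ (Subtype.val '' (s : Set G)) := fun s z hz => by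
    rw [hb' s z hz]
    exact (convex_convexHull ℝ _).sum_mem (fun i _ => hz.1 i) hz.2.2.1
      fun i hi => subset_convexHull ℝ _ ⟨i, hi, rfl⟩
  obtain ⟨F, hF⟩ := exists_cylinderHomotopy (G := G) hnull (P := P) (b := b) (g₀ := g₀)
    (fun s t hts _ hs => (convexHull_mono (Set.image_mono (Finset.coe_subset.2 hts))).trans hs)
    hg₀ (fun s _ => by
      have : ContinuousOn (fun z : (G → ℝ) × ℝ => ∑ i ∈ s, z.1 i • (i : E)) (simplexCylinder s) := by
        fun_prop
      exact this.congr fun z hz => hb' s z hz)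
    (fun s hs z hz => hs (hbc s z hz))
  -- On `A s` the partition of unity takes values in the single simplex `s`. These closed sets form
  -- a locally finite cover, so continuity of `F` on each cylinder separately is enough for
  -- continuity of `K`.
  let A : Finset G → Set G := fun s => closure {x | φ.finsupport x = s}
  have hA1 : ∀ s, ∀ x ∈ A s, ∀ i, i ∉ s → φ i x = 0 := by
    intro s x hx i hi
    have hcl : IsClosed {x : G | φ i x = 0} := isClosed_eq (φ i).continuous continuous_const
    refine closure_minimal ?_ hcl hx
    rintro y rfl
    by_contra h
    exact hi ((φ.mem_finsupport y).2 h)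
  have hA2 : ∀ s, ∀ x ∈ A s, ∀ t ∈ I, ((fun i => φ i x, t) : (G → ℝ) × ℝ) ∈ simplexCylinder s := by
    intro s x hx t ht
    refine ⟨fun i => φ.nonneg i x, hA1 s x hx, ?_, ht.1, ht.2⟩
    refine φ.sum_finsupport' (Set.mem_univ x) fun i hi => ?_
    by_contra h
    exact (φ.mem_finsupport x).1 hi (hA1 s x hx i h)
  have hA3 : ∀ x : G, x ∈ A (φ.finsupport x) := fun x => subset_closure rfl
  have hself : ∀ x : G, (φ.finsupport x).Nonempty := fun x =>
    nonempty_of_mem_simplexCylinder (hA2 _ x (hA3 x) 0 ⟨le_rfl, zero_le_one⟩)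
  have hhull : ∀ x : G, convexHull ℝ (insert (x : E) (Subtype.val '' (φ.finsupport x : Set G))) ⊆
      G := fun x => exists_convexHull_subset_of_forall_mem_ball hr (hself x)
        fun i hi => hφd i x ((φ.mem_finsupport x).1 hi)
  have hA4 : ∀ s, (A s).Nonempty → P s := by
    intro s hs
    obtain ⟨y, rfl⟩ := closure_nonempty_iff.1 hs
    exact (convexHull_mono (Set.subset_insert _ _)).trans (hhull y)
  have hAfin : LocallyFinite A := by
    refine LocallyFinite.closure fun x => ⟨_, φ.eventually_finsupport_subset x, ?_⟩
    refine (φ.fintsupport x).powerset.finite_toSet.subset ?_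
    rintro s ⟨y, rfl, hy⟩
    exact Finset.mem_coe.2 (Finset.mem_powerset.2 hy)
  let K : G × I → E := fun q => F (fun i => φ i q.1, q.2)
  have hK : Continuous K := by
    refine LocallyFinite.continuous (f := fun s => Prod.fst ⁻¹' A s)
      (hAfin.preimage_continuous continuous_fst) ?_ (fun s => isClosed_closure.preimage
        continuous_fst) fun s => ?_
    · exact Set.eq_univ_of_forall fun q => Set.mem_iUnion.2 ⟨_, hA3 q.1⟩
    · rintro ⟨x, t⟩ hx
      have hx' : x ∈ A s := hx
      have hcont : Continuous fun q : G × I => ((fun i => φ i q.1, q.2) : (G → ℝ) × ℝ) := by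
        refine Continuous.prodMk (continuous_pi fun i => ?_) ?_
        · exact (φ i).continuous.comp continuous_fst
        · exact continuous_subtype_val.comp continuous_snd
      have h1 := (hF s.card s (nonempty_of_mem_simplexCylinder (hA2 s x hx' t t.2))
        (hA4 s ⟨x, hx'⟩) le_rfl).1
      exact (h1.comp hcont.continuousOn fun q hq => hA2 s q.1 hq q.2 q.2.2) _ hx
  have hKs : ∀ x : G, _ := fun x =>
    hF (φ.finsupport x).card (φ.finsupport x) (hself x) (hA4 _ ⟨x, hA3 x⟩) le_rfl
  have hKG : ∀ q, K q ∈ G := fun q => (hKs q.1).2.1 (hA2 _ q.1 (hA3 q.1) q.2 q.2.2)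
  have hK0 : ∀ x : G, K (x, 0) = b (fun i => φ i x) := fun x =>
    (hKs x).2.2.1 _ (hA2 _ x (hA3 x) 0 ⟨le_rfl, zero_le_one⟩) rfl
  have hK1 : ∀ x : G, K (x, 1) = g₀ := fun x =>
    (hKs x).2.2.2 _ (hA2 _ x (hA3 x) 1 ⟨zero_le_one, le_rfl⟩) rfl
  have hlin : ∀ q : I × G, (1 - (q.1 : ℝ)) • (q.2 : E) + (q.1 : ℝ) • K (q.2, 0) ∈ G := by
    rintro ⟨t, x⟩
    refine hhull x ?_
    refine (convex_convexHull ℝ _) (subset_convexHull ℝ _ (Set.mem_insert _ _))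
      (convexHull_mono (Set.subset_insert _ _) ?_) (sub_nonneg.2 t.2.2) t.2.1 (by ring)
    change K (x, 0) ∈ _
    rw [hK0]
    exact hbc _ (fun i => φ i x, 0) (hA2 _ x (hA3 x) 0 ⟨le_rfl, zero_le_one⟩)
  rw [contractible_iff_id_nullhomotopic]
  let f₁ : C(G, G) := ⟨fun x => ⟨K (x, 0), hKG _⟩, by fun_prop⟩
  refine ⟨⟨g₀, hg₀⟩, ContinuousMap.Homotopic.trans (g := f₁) ⟨⟨⟨fun q => ⟨_, hlin q⟩, ?_⟩, ?_, ?_⟩⟩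
    ⟨⟨⟨fun q => ⟨K (q.2, q.1), hKG _⟩, ?_⟩, ?_, ?_⟩⟩⟩
  · fun_prop
  · intro x
    exact Subtype.ext (by simp)
  · intro x
    exact Subtype.ext (by simp [f₁])
  · fun_prop
  · intro x
    rfl
  · intro x
    exact Subtype.ext (hK1 x)

/-! ### Separable Hilbert spaces -/

section Hilbert

variable {H : Type*} [NormedAddCommGroup H] [InnerProductSpace ℂ H] [CompleteSpace H]
  {E : Type*} [NormedAddCommGroup E] [InnerProductSpace ℂ E] [CompleteSpace E]

/-- Orthonormal vectors have distance `√2`, so the balls of radius `1 / 2` around them are disjoint.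
-/
theorem countable_of_orthonormal [TopologicalSpace.SeparableSpace H] {ι : Type*} {v : ι → H}
    (hv : Orthonormal ℂ v) : Countable ι := by
  have h : (Set.univ : Set ι).PairwiseDisjoint fun i => Metric.ball (v i) (1 / 2) := by
    intro i _ j _ hij
    refine Metric.ball_disjoint_ball ?_
    have h0 : ⟪v i, v j⟫_ℂ = 0 := hv.2 hij
    have h1 : ‖v i - v j‖ ^ 2 = 2 := by
      have := @norm_sub_sq ℂ _ _ _ _ (v i) (v j)
      rw [h0, hv.1 i, hv.1 j] at this
      simp at this
      linarith
    rw [dist_eq_norm]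
    nlinarith [norm_nonneg (v i - v j)]
  rw [← Set.countable_univ_iff]
  exact h.countable_of_isOpen (fun i _ => Metric.isOpen_ball)
    fun i _ => ⟨v i, Metric.mem_ball_self (by norm_num)⟩

theorem exists_hilbertBasis_nat [TopologicalSpace.SeparableSpace H]
    (hH : ¬ FiniteDimensional ℂ H) : Nonempty (HilbertBasis ℕ ℂ H) := by
  obtain ⟨w, b, hb⟩ := exists_hilbertBasis ℂ H
  have hc : Countable w := countable_of_orthonormal b.orthonormal
  have hinf : Infinite w := by
    by_contra h
    have hfin : Finite w := not_infinite_iff_finite.1 h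
    have := Fintype.ofFinite w
    exact hH (b.toOrthonormalBasis.toBasis.finiteDimensional_of_finite)
  obtain ⟨e⟩ : Nonempty (ℕ ≃ w) := by
    obtain ⟨d⟩ := nonempty_denumerable w
    exact ⟨(Denumerable.eqv w).symm⟩
  refine ⟨HilbertBasis.mk (v := fun n => b (e n)) (b.orthonormal.comp e e.injective) ?_⟩
  have : Set.range (fun n => b (e n)) = Set.range b := e.surjective.range_comp b
  rw [this, b.dense_span]

theorem nonempty_linearIsometryEquiv [TopologicalSpace.SeparableSpace H]
    [TopologicalSpace.SeparableSpace E] (hH : ¬ FiniteDimensional ℂ H)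
    (hE : ¬ FiniteDimensional ℂ E) : Nonempty (H ≃ₗᵢ[ℂ] E) := by
  obtain ⟨b⟩ := exists_hilbertBasis_nat hH
  obtain ⟨b'⟩ := exists_hilbertBasis_nat hE
  exact ⟨b.repr.trans b'.repr.symm⟩

theorem star_mul_self_eq_one {V : H →L[ℂ] H} (hV : ∀ x, ‖V x‖ = ‖x‖) : star V * V = 1 :=
  V.norm_map_iff_adjoint_comp_self.1 hV

/-- The isometry taking a Hilbert basis to an orthonormal sequence. -/
theorem exists_isometry_of_orthonormal (b : HilbertBasis ℕ ℂ H) {v : ℕ → E}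
    (hv : Orthonormal ℂ v) : ∃ V : H →L[ℂ] E, (∀ x, ‖V x‖ = ‖x‖) ∧
      ∀ x, HasSum (fun n => b.repr x n • v n) (V x) := by
  refine ⟨(hv.orthogonalFamily.linearIsometry.comp b.repr.toLinearIsometry).toContinuousLinearMap,
    fun x => ?_, fun x => ?_⟩
  · exact LinearIsometry.norm_map _ x
  · exact hv.orthogonalFamily.hasSum_linearIsometry (b.repr x)

/-- A closed subspace containing each vector of a sequence contains the closed span. -/
theorem mem_of_hasSum_smul {v : ℕ → E} {c : ℕ → ℂ} {x : E}
    (h : HasSum (fun n => c n • v n) x) {K : Submodule ℂ E} (hK : IsClosed (K : Set E))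
    (hv : ∀ n, v n ∈ K) : x ∈ K :=
  hK.mem_of_tendsto h (Filter.Eventually.of_forall fun _ =>
    K.sum_mem fun n _ => K.smul_mem _ (hv n))

/-! ### The countable direct sum of copies of a Hilbert space -/

/-- The Hilbert sum of countably many copies of `H`. -/
abbrev HilbertPower (H : Type*) [NormedAddCommGroup H] := lp (fun _ : ℕ => H) 2

instance [TopologicalSpace.SeparableSpace H] :
    TopologicalSpace.SeparableSpace (HilbertPower H) := by
  rw [← TopologicalSpace.isSeparable_univ_iff]
  have h1 : TopologicalSpace.IsSeparable
      (⋃ n : ℕ, Set.range fun x : H => (lp.single 2 n x : HilbertPower H)) :=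
    TopologicalSpace.IsSeparable.iUnion fun n =>
      TopologicalSpace.isSeparable_range (lp.isometry_single (E := fun _ : ℕ => H) n).continuous
  refine (h1.span (R := ℂ)).closure.mono fun f _ => ?_
  refine mem_closure_of_tendsto (lp.hasSum_single (by norm_num) f)
    (Filter.Eventually.of_forall fun s => ?_)
  exact Submodule.sum_mem _ fun n _ =>
    Submodule.subset_span (Set.mem_iUnion.2 ⟨n, ⟨f n, rfl⟩⟩)

theorem not_finiteDimensional_hilbertPower (hH : ¬ FiniteDimensional ℂ H) :
    ¬ FiniteDimensional ℂ (HilbertPower H) := by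
  intro h
  refine hH (FiniteDimensional.of_injective (lp.lsingle (𝕜 := ℂ) (E := fun _ : ℕ => H) 2 0) ?_)
  exact (lp.isometry_single (E := fun _ : ℕ => H) (p := 2) 0).injective

theorem summable_norm_sq (f : HilbertPower H) : Summable fun n => ‖f n‖ ^ 2 := by
  simpa using (lp.memℓp f).summable (by norm_num)

theorem norm_sq_eq_tsum (f : HilbertPower H) : ‖f‖ ^ 2 = ∑' n, ‖f n‖ ^ 2 := by
  simpa using lp.norm_rpow_eq_tsum (p := 2) (by norm_num) f

/-- The unilateral shift. -/
def powerShift : HilbertPower H →ₗᵢ[ℂ] HilbertPower H where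
  toFun f := ⟨fun n => Nat.casesOn n 0 fun k => f k, memℓp_gen (by
    rw [← summable_nat_add_iff 1]
    simpa using summable_norm_sq f)⟩
  map_add' f g := by
    ext n
    cases n
    · exact (add_zero (0 : H)).symm
    · rfl
  map_smul' c f := by
    ext n
    cases n <;> simp
  norm_map' f := by
    rw [← sq_eq_sq₀ (norm_nonneg _) (norm_nonneg _), norm_sq_eq_tsum f]
    refine (norm_sq_eq_tsum _).trans ?_
    rw [Summable.tsum_eq_zero_add (summable_norm_sq _)]
    simp

/-- The operator acting by `x` in every summand. -/
def powerMap (x : H →L[ℂ] H) : HilbertPower H →L[ℂ] HilbertPower H :=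
  lp.mapCLM 2 (fun _ => x) (norm_nonneg x) fun _ => le_rfl

@[simp] theorem powerMap_apply (x : H →L[ℂ] H) (f : HilbertPower H) (n : ℕ) :
    powerMap x f n = x (f n) := rfl

@[simp] theorem powerShift_zero (f : HilbertPower H) : powerShift f 0 = 0 := rfl

@[simp] theorem powerShift_succ (f : HilbertPower H) (n : ℕ) : powerShift f (n + 1) = f n := rfl

theorem inner_powerMap (x : H →L[ℂ] H) (f g : HilbertPower H) :
    ⟪powerMap x f, g⟫_ℂ = ⟪f, powerMap (star x) g⟫_ℂ := by
  rw [lp.inner_eq_tsum, lp.inner_eq_tsum]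
  refine tsum_congr fun n => ?_
  rw [powerMap_apply, powerMap_apply, ContinuousLinearMap.star_eq_adjoint,
    ContinuousLinearMap.adjoint_inner_right]

/-- A unital endomorphism `amp` of the algebra of bounded operators absorbing the identity
representation: `amp x` is the orthogonal sum of copies of `x` and of `amp x`. -/
structure Amplification (H : Type*) [NormedAddCommGroup H] [InnerProductSpace ℂ H]
    [CompleteSpace H] where
  /-- the inclusion of the first summand -/
  head : H →L[ℂ] H
  /-- the inclusion of the remaining summands -/
  tail : H →L[ℂ] H
  /-- the representation -/
  amp : (H →L[ℂ] H) →⋆ₐ[ℂ] (H →L[ℂ] H)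
  head_star_head : star head * head = 1
  tail_star_tail : star tail * tail = 1
  head_add_tail : head * star head + tail * star tail = 1
  amp_eq : ∀ x, amp x = head * x * star head + tail * amp x * star tail

/-- `H` is isometric to `HilbertPower H`, where `head` is the inclusion of the coordinate zero,
`tail` the unilateral shift and `amp` the diagonal action. -/
theorem exists_amplification [TopologicalSpace.SeparableSpace H]
    (hH : ¬ FiniteDimensional ℂ H) : Nonempty (Amplification H) := by
  obtain ⟨θ⟩ := nonempty_linearIsometryEquiv hH (not_finiteDimensional_hilbertPower hH)
  let head : H →L[ℂ] H := θ.symm.toContinuousLinearEquiv.toContinuousLinearMap.comp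
    (lp.singleContinuousLinearMap (𝕜 := ℂ) (fun _ : ℕ => H) 2 0)
  let tail : H →L[ℂ] H := (θ.symm.toContinuousLinearEquiv.toContinuousLinearMap.comp
    powerShift.toContinuousLinearMap).comp θ.toContinuousLinearEquiv.toContinuousLinearMap
  let amp : (H →L[ℂ] H) → (H →L[ℂ] H) := fun x =>
    (θ.symm.toContinuousLinearEquiv.toContinuousLinearMap.comp (powerMap x)).comp
      θ.toContinuousLinearEquiv.toContinuousLinearMap
  have hhead : ∀ x, θ (head x) = lp.single 2 0 x := fun x => θ.apply_symm_apply _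
  have htail : ∀ x, θ (tail x) = powerShift (θ x) := fun x => θ.apply_symm_apply _
  have hamp : ∀ x y, θ (amp x y) = powerMap x (θ y) := fun x y => θ.apply_symm_apply _
  have hhead' : ∀ x, star head x = θ x 0 := fun x => by
    refine ext_inner_right ℂ fun y => ?_
    rw [ContinuousLinearMap.star_eq_adjoint, ContinuousLinearMap.adjoint_inner_left,
      ← θ.inner_map_map, hhead, lp.inner_single_right]
  have htail' : ∀ x n, θ (star tail x) n = θ x (n + 1) := fun x n => by
    refine ext_inner_right ℂ fun y => ?_
    rw [← lp.inner_single_right (𝕜 := ℂ), ← θ.apply_symm_apply (lp.single 2 n y),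
      θ.inner_map_map, ContinuousLinearMap.star_eq_adjoint, ContinuousLinearMap.adjoint_inner_left,
      ← θ.inner_map_map, htail, θ.apply_symm_apply]
    have : (powerShift (lp.single 2 n y : HilbertPower H)) = lp.single 2 (n + 1) y := by
      ext k
      cases k <;> simp [lp.single_apply, Pi.single_apply]
    rw [this, lp.inner_single_right]
  have hampstar : ∀ x, amp (star x) = star (amp x) := fun x => by
    refine ContinuousLinearMap.ext fun y => ext_inner_left ℂ fun z => ?_
    rw [ContinuousLinearMap.star_eq_adjoint (amp x), ContinuousLinearMap.adjoint_inner_right,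
      ← θ.inner_map_map, ← θ.inner_map_map, hamp, hamp, inner_powerMap]
  refine ⟨{
    head := head
    tail := tail
    amp :=
      { toFun := amp
        map_one' := ?_
        map_mul' := ?_
        map_zero' := ?_
        map_add' := ?_
        commutes' := ?_
        map_star' := hampstar }
    head_star_head := ?_
    tail_star_tail := ?_
    head_add_tail := ?_
    amp_eq := ?_ }⟩
  · ext y
    refine θ.injective (lp.ext (funext fun n => ?_))
    rw [hamp]
    rfl
  · intro x x'
    ext y
    refine θ.injective (lp.ext (funext fun n => ?_))
    change θ (amp (x * x') y) n = θ (amp x (amp x' y)) n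
    rw [hamp, hamp, powerMap_apply, powerMap_apply, hamp, powerMap_apply]
    rfl
  · ext y
    refine θ.injective (lp.ext (funext fun n => ?_))
    rw [hamp]
    simp
  · intro x x'
    ext y
    refine θ.injective (lp.ext (funext fun n => ?_))
    change θ (amp (x + x') y) n = θ (amp x y + amp x' y) n
    rw [map_add, hamp, hamp, hamp]
    simp
  · intro c
    ext y
    refine θ.injective (lp.ext (funext fun n => ?_))
    change θ (amp (algebraMap ℂ (H →L[ℂ] H) c) y) n = θ (c • y) n
    rw [hamp, map_smul, powerMap_apply]
    simp [Algebra.algebraMap_eq_smul_one]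
  · ext y
    change star head (head y) = y
    rw [hhead', hhead]
    simp
  · ext y
    refine θ.injective (lp.ext (funext fun n => ?_))
    change θ (star tail (tail y)) n = θ y n
    rw [htail', htail, powerShift_succ]
  · ext y
    refine θ.injective (lp.ext (funext fun n => ?_))
    change θ (head (star head y) + tail (star tail y)) n = θ y n
    rw [map_add, hhead, htail, hhead']
    cases n with
    | zero => simp
    | succ n => simp [htail', lp.single_apply]
  · intro x
    ext y
    refine θ.injective (lp.ext (funext fun n => ?_))
    change θ (amp x y) n = θ (head (x (star head y)) + tail (amp x (star tail y))) n
    rw [map_add, hhead, htail, hhead', hamp, hamp]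
    cases n with
    | zero => simp
    | succ n => simp [htail', lp.single_apply]

end Hilbert

/-! ### Rotations and homotopies of invertible elements -/

theorem homotopic_mul {T Y : Type*} [TopologicalSpace T] [TopologicalSpace Y] [Mul Y]
    [ContinuousMul Y] {f f' g g' : C(T, Y)} (hf : f.Homotopic f') (hg : g.Homotopic g') :
    (f * g).Homotopic (f' * g') := by
  obtain ⟨F⟩ := hf
  obtain ⟨G⟩ := hg
  exact ⟨⟨⟨fun p => F p * G p, by fun_prop⟩, fun x => by simp, fun x => by simp⟩⟩

section Rotation

variable {A : Type*} [Ring A] [Algebra ℂ A]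

/-- Two columns `e₁, e₂` and two rows `f₁, f₂` with `fᵢ eⱼ = δᵢⱼ`. -/
structure IsDualPair (e₁ e₂ f₁ f₂ : A) : Prop where
  h₁₁ : f₁ * e₁ = 1
  h₂₂ : f₂ * e₂ = 1
  h₁₂ : f₁ * e₂ = 0
  h₂₁ : f₂ * e₁ = 0

/-- The rotation in the plane of a dual pair. -/
def rot (e₁ e₂ f₁ f₂ : A) (c s : ℂ) : A :=
  1 + (c - 1) • (e₁ * f₁ + e₂ * f₂) + s • (e₂ * f₁ - e₁ * f₂)

/-- On the range of the idempotent `p` the element `j` is a complex structure, `j * j = -p`, so the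
rotation multiplies there like the complex number `c + i s`; off this range it is the identity. -/
theorem IsDualPair.rot_mul_rot {e₁ e₂ f₁ f₂ : A} (h : IsDualPair e₁ e₂ f₁ f₂) {c s : ℂ}
    (hcs : c ^ 2 + s ^ 2 = 1) : rot e₁ e₂ f₁ f₂ c s * rot e₁ e₂ f₁ f₂ c (-s) = 1 := by
  have r₁₁ : ∀ z, f₁ * (e₁ * z) = z := fun z => by rw [← mul_assoc, h.h₁₁, one_mul]
  have r₂₂ : ∀ z, f₂ * (e₂ * z) = z := fun z => by rw [← mul_assoc, h.h₂₂, one_mul]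
  have r₁₂ : ∀ z, f₁ * (e₂ * z) = 0 := fun z => by rw [← mul_assoc, h.h₁₂, zero_mul]
  have r₂₁ : ∀ z, f₂ * (e₁ * z) = 0 := fun z => by rw [← mul_assoc, h.h₂₁, zero_mul]
  set p := e₁ * f₁ + e₂ * f₂ with hp
  set j := e₂ * f₁ - e₁ * f₂ with hj
  have hpp : p * p = p := by
    simp only [hp, mul_add, add_mul, mul_assoc, r₁₁, r₂₂, r₁₂, r₂₁, mul_zero, add_zero, zero_add]
  have hpj : p * j = j := by
    simp only [hp, hj, mul_sub, add_mul, mul_assoc, r₁₁, r₂₂, r₁₂, r₂₁, mul_zero, add_zero,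
      zero_add]
  have hjp : j * p = j := by
    simp only [hp, hj, mul_add, sub_mul, mul_assoc, r₁₁, r₂₂, r₁₂, r₂₁, mul_zero,
      sub_zero, zero_sub]
    abel
  have hjj : j * j = -p := by
    simp only [hp, hj, mul_sub, sub_mul, mul_assoc, r₁₁, r₂₂, r₁₂, r₂₁, mul_zero,
      sub_zero, zero_sub]
    abel
  have hs : s ^ 2 = 1 - c ^ 2 := by linear_combination hcs
  change (1 + (c - 1) • p + s • j) * (1 + (c - 1) • p + (-s) • j) = 1
  simp only [mul_add, add_mul, one_mul, mul_one, smul_mul_assoc, mul_smul_comm, hpp, hpj, hjp, hjj]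
  have e : ((c - 1) • (c - 1) • p + s • s • p) = (2 - 2 * c) • p := by
    rw [smul_smul, smul_smul, ← add_smul]
    congr 1
    linear_combination hs
  have e' : 1 + (c - 1) • p + s • j + ((c - 1) • p + (c - 1) • (c - 1) • p + (c - 1) • s • j) +
      (-s • j + -s • (c - 1) • j + -s • s • -p) =
      1 + (2 * c - 2) • p + ((c - 1) • (c - 1) • p + s • s • p) := by
    module
  have e'' : (1 : A) + (2 * c - 2) • p + (2 - 2 * c) • p = 1 := by module
  refine Eq.trans ?_ (e'.trans (by rw [e, e'']))
  module

theorem IsDualPair.rot_zero_one_mul {e₁ e₂ f₁ f₂ : A} (h : IsDualPair e₁ e₂ f₁ f₂) :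
    rot e₁ e₂ f₁ f₂ 0 1 * e₁ = e₂ := by
  simp only [rot, zero_sub, neg_smul, one_smul, add_mul, sub_mul, neg_mul, one_mul, mul_assoc,
    h.h₁₁, h.h₂₁, mul_one, mul_zero, add_zero, sub_zero]
  abel

theorem rot_one_zero (e₁ e₂ f₁ f₂ : A) : rot e₁ e₂ f₁ f₂ 1 0 = 1 := by
  simp [rot]

/-- The rotation in the plane of a dual pair, by the angle `t π / 2`, as a unit. -/
def IsDualPair.rotUnit {e₁ e₂ f₁ f₂ : A} (h : IsDualPair e₁ e₂ f₁ f₂) (t : ℝ) : Aˣ where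
  val := rot e₁ e₂ f₁ f₂ (Real.cos (t * (Real.pi / 2))) (Real.sin (t * (Real.pi / 2)))
  inv := rot e₁ e₂ f₁ f₂ (Real.cos (t * (Real.pi / 2))) (-Real.sin (t * (Real.pi / 2)))
  val_inv := h.rot_mul_rot (by exact_mod_cast Real.cos_sq_add_sin_sq _)
  inv_val := by
    have := h.rot_mul_rot (c := Real.cos (t * (Real.pi / 2)))
      (s := -Real.sin (t * (Real.pi / 2))) (by
        rw [neg_sq]
        exact_mod_cast Real.cos_sq_add_sin_sq _)
    rwa [neg_neg] at this

theorem IsDualPair.rotUnit_zero {e₁ e₂ f₁ f₂ : A} (h : IsDualPair e₁ e₂ f₁ f₂) :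
    h.rotUnit 0 = 1 := by
  apply Units.ext
  simp [rotUnit, rot_one_zero]

theorem IsDualPair.val_rotUnit_one {e₁ e₂ f₁ f₂ : A} (h : IsDualPair e₁ e₂ f₁ f₂) :
    (h.rotUnit 1 : A) = rot e₁ e₂ f₁ f₂ 0 1 := by
  simp [rotUnit]

end Rotation

/-! ### Norm continuous families of rotations and unipotents. -/

section RotationHomotopy

variable {A : Type*} [NormedRing A] [NormedAlgebra ℂ A] {T : Type*} [TopologicalSpace T]

theorem exists_rotation_homotopic_one {e₁ e₂ f₁ f₂ : T → A}
    (h : ∀ x, IsDualPair (e₁ x) (e₂ x) (f₁ x) (f₂ x)) (he₁ : Continuous e₁) (he₂ : Continuous e₂)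
    (hf₁ : Continuous f₁) (hf₂ : Continuous f₂) :
    ∃ r : C(T, Aˣ), r.Homotopic 1 ∧ ∀ x, r x = (h x).rotUnit 1 := by
  let F : I × T → Aˣ := fun q => (h q.2).rotUnit q.1
  have hc : Continuous F := by
    rw [Units.continuous_iff]
    constructor
    · change Continuous fun q : I × T => rot (e₁ q.2) (e₂ q.2) (f₁ q.2) (f₂ q.2)
        (Real.cos (q.1 * (Real.pi / 2))) (Real.sin (q.1 * (Real.pi / 2)))
      unfold rot
      fun_prop
    · change Continuous fun q : I × T => rot (e₁ q.2) (e₂ q.2) (f₁ q.2) (f₂ q.2)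
        (Real.cos (q.1 * (Real.pi / 2))) (-Real.sin (q.1 * (Real.pi / 2)))
      unfold rot
      fun_prop
  have h0 : ∀ x, F (0, x) = 1 := fun x => (h x).rotUnit_zero
  have h1 : ∀ x, F (1, x) = (h x).rotUnit 1 := fun x => by simp only [F, Set.Icc.coe_one]
  exact ⟨⟨fun x => F (1, x), by fun_prop⟩,
    ContinuousMap.Homotopic.symm ⟨⟨⟨F, hc⟩, h0, fun x => rfl⟩⟩, h1⟩

/-- The unipotent `1 - n` is homotopic to `1`. -/
theorem exists_unipotent_homotopic_one {n : T → A} (hn : Continuous n) (h : ∀ x, n x * n x = 0) :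
    ∃ r : C(T, Aˣ), r.Homotopic 1 ∧ ∀ x, (r x : A) = 1 - n x := by
  let F : I × T → Aˣ := fun q =>
    { val := 1 - ((q.1 : ℝ) : ℂ) • n q.2
      inv := 1 + ((q.1 : ℝ) : ℂ) • n q.2
      val_inv := by simp [sub_mul, mul_add, h]
      inv_val := by simp [mul_sub, add_mul, h] }
  have hc : Continuous F := by
    rw [Units.continuous_iff]
    constructor
    · change Continuous fun q : I × T => 1 - ((q.1 : ℝ) : ℂ) • n q.2
      fun_prop
    · change Continuous fun q : I × T => 1 + ((q.1 : ℝ) : ℂ) • n q.2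
      fun_prop
  refine ⟨⟨fun x => F (1, x), by fun_prop⟩,
    ContinuousMap.Homotopic.symm ⟨⟨⟨_, hc⟩, fun x => ?_, fun x => ?_⟩⟩, fun x => ?_⟩
  · exact Units.ext (by simp [F])
  · rfl
  · simp [F]

end RotationHomotopy

/-! ### Absorption -/

section Absorption

variable {H : Type*} [NormedAddCommGroup H] [InnerProductSpace ℂ H] [CompleteSpace H]

namespace Amplification

variable (a : Amplification H)

theorem head_star_tail : star a.head * a.tail = 0 := by
  have h := congrArg (fun z => star a.head * z * a.tail) a.head_add_tail
  simp only [mul_add, add_mul, mul_assoc, a.tail_star_tail, mul_one] at h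
  rw [← mul_assoc, a.head_star_head, one_mul] at h
  exact left_eq_add.1 h.symm

theorem tail_star_head : star a.tail * a.head = 0 := by
  have h := congrArg star a.head_star_tail
  simpa using h

theorem head_star_head' (z : H →L[ℂ] H) : star a.head * (a.head * z) = z := by
  rw [← mul_assoc, a.head_star_head, one_mul]

theorem tail_star_tail' (z : H →L[ℂ] H) : star a.tail * (a.tail * z) = z := by
  rw [← mul_assoc, a.tail_star_tail, one_mul]

theorem head_star_tail' (z : H →L[ℂ] H) : star a.head * (a.tail * z) = 0 := by
  rw [← mul_assoc, a.head_star_tail, zero_mul]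

theorem tail_star_head' (z : H →L[ℂ] H) : star a.tail * (a.head * z) = 0 := by
  rw [← mul_assoc, a.tail_star_head, zero_mul]

theorem amp_mul_tail (x : H →L[ℂ] H) : a.amp x * a.tail = a.tail * a.amp x := by
  conv_lhs => rw [a.amp_eq]
  simp only [add_mul, mul_assoc, a.head_star_tail, a.tail_star_tail, mul_one, mul_zero, zero_add]

theorem head_mul_amp (x : H →L[ℂ] H) : star a.head * a.amp x = x * star a.head := by
  conv_lhs => rw [a.amp_eq]
  simp only [mul_add, mul_assoc, a.head_star_head', a.head_star_tail', add_zero]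

theorem tail_mul_amp (x : H →L[ℂ] H) : star a.tail * a.amp x = a.amp x * star a.tail := by
  conv_lhs => rw [a.amp_eq]
  simp only [mul_add, mul_assoc, a.tail_star_tail', a.tail_star_head', zero_add]

/-- The isometry shifting the copies of the range of the projection `q`, with range the
complement of the first copy of it. -/
def shift (q : H →L[ℂ] H) : H →L[ℂ] H := a.tail * a.amp q + a.amp (1 - q)

variable {q : H →L[ℂ] H}

theorem star_shift (hq : IsStarProjection q) :
    star (a.shift q) = a.amp q * star a.tail + a.amp (1 - q) := by
  simp [shift, ← map_star, hq.isSelfAdjoint.star_eq]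

theorem shift_star_shift (hq : IsStarProjection q) : star (a.shift q) * a.shift q = 1 := by
  have h1 : a.amp q * a.amp q = a.amp q := by rw [← map_mul, hq.isIdempotentElem.eq]
  have h2 : a.amp (1 - q) * a.amp (1 - q) = a.amp (1 - q) := by
    rw [← map_mul, hq.one_sub.isIdempotentElem.eq]
  have h3 : a.amp q * a.amp (1 - q) = 0 := by
    rw [← map_mul, mul_sub, mul_one, hq.isIdempotentElem.eq, sub_self, map_zero]
  have h4 : a.amp (1 - q) * a.amp q = 0 := by
    rw [← map_mul, sub_mul, one_mul, hq.isIdempotentElem.eq, sub_self, map_zero]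
  have h5 : a.amp q + a.amp (1 - q) = 1 := by
    rw [← map_add, add_sub_cancel, map_one]
  rw [a.star_shift hq, shift]
  have e1 : a.amp q * star a.tail * (a.tail * a.amp q) = a.amp q := by
    rw [mul_assoc, a.tail_star_tail', h1]
  have e2 : a.amp q * star a.tail * a.amp (1 - q) = 0 := by
    rw [mul_assoc, a.tail_mul_amp, ← mul_assoc, h3, zero_mul]
  have e3 : a.amp (1 - q) * (a.tail * a.amp q) = 0 := by
    rw [← mul_assoc, a.amp_mul_tail, mul_assoc, h4, mul_zero]
  rw [add_mul, mul_add, mul_add, e1, e2, e3, h2, add_zero, zero_add, h5]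

theorem head_add_shift (hq : IsStarProjection q) :
    a.head * q * star a.head + a.shift q * star (a.shift q) = 1 := by
  have h1 : a.amp q * a.amp q = a.amp q := by rw [← map_mul, hq.isIdempotentElem.eq]
  have h2 : a.amp (1 - q) * a.amp (1 - q) = a.amp (1 - q) := by
    rw [← map_mul, hq.one_sub.isIdempotentElem.eq]
  have h3 : a.amp q * a.amp (1 - q) = 0 := by
    rw [← map_mul, mul_sub, mul_one, hq.isIdempotentElem.eq, sub_self, map_zero]
  have h4 : a.amp (1 - q) * a.amp q = 0 := by
    rw [← map_mul, sub_mul, one_mul, hq.isIdempotentElem.eq, sub_self, map_zero]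
  have h5 : a.amp q + a.amp (1 - q) = 1 := by
    rw [← map_add, add_sub_cancel, map_one]
  rw [a.star_shift hq, shift]
  have e1 : a.tail * a.amp q * (a.amp q * star a.tail) = a.tail * a.amp q * star a.tail := by
    rw [mul_assoc, ← mul_assoc (a.amp q), h1, mul_assoc]
  have e2 : a.tail * a.amp q * a.amp (1 - q) = 0 := by
    rw [mul_assoc, h3, mul_zero]
  have e3 : a.amp (1 - q) * (a.amp q * star a.tail) = 0 := by
    rw [← mul_assoc, h4, zero_mul]
  rw [add_mul, mul_add, mul_add, e1, e2, e3, h2, add_zero, zero_add, ← add_assoc, ← a.amp_eq, h5]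

theorem head_mul_shift (hq : IsStarProjection q) : q * star a.head * a.shift q = 0 := by
  rw [shift, mul_add, mul_assoc, mul_assoc, a.head_star_tail', a.head_mul_amp, mul_zero, zero_add,
    ← mul_assoc, mul_sub, mul_one, hq.isIdempotentElem.eq, sub_self, zero_mul]

theorem shift_star_mul_head (hq : IsStarProjection q) : star (a.shift q) * a.head * q = 0 := by
  have := congrArg star (a.head_mul_shift hq)
  simpa [hq.isSelfAdjoint.star_eq, mul_assoc] using this

theorem shift_mul_amp {x : H →L[ℂ] H} (hx : q * x = x * q) :
    a.amp x * a.shift q = a.shift q * a.amp x := by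
  have h1 : a.amp x * a.amp q = a.amp q * a.amp x := by rw [← map_mul, ← hx, map_mul]
  have h2 : a.amp x * a.amp (1 - q) = a.amp (1 - q) * a.amp x := by
    rw [← map_mul, mul_sub, mul_one, ← hx, ← map_mul, sub_mul, one_mul]
  rw [shift, mul_add, add_mul, ← mul_assoc, a.amp_mul_tail, mul_assoc, h1, h2, mul_assoc]

/-- An isometry with range the sum of the ranges of a projection `q` and of an isometry `v`. -/
def absorb (q v : H →L[ℂ] H) : H →L[ℂ] H := q * star a.head + v * star (a.shift q)

theorem absorb_star_absorb (hq : IsStarProjection q) {v : H →L[ℂ] H} (hv : star v * v = 1)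
    (hqv : q * v = 0) : star (a.absorb q v) * a.absorb q v = 1 := by
  have hvq : star v * q = 0 := by simpa [hq.isSelfAdjoint.star_eq] using congrArg star hqv
  have e : star (a.absorb q v) = a.head * q + a.shift q * star v := by
    simp [absorb, hq.isSelfAdjoint.star_eq]
  rw [e, absorb, add_mul, mul_add, mul_add]
  have e1 : a.head * q * (q * star a.head) = a.head * q * star a.head := by
    rw [mul_assoc, ← mul_assoc q, hq.isIdempotentElem.eq, mul_assoc]
  have e2 : a.head * q * (v * star (a.shift q)) = 0 := by
    rw [mul_assoc, ← mul_assoc q, hqv, zero_mul, mul_zero]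
  have e3 : a.shift q * star v * (q * star a.head) = 0 := by
    rw [mul_assoc, ← mul_assoc (star v), hvq, zero_mul, mul_zero]
  have e4 : a.shift q * star v * (v * star (a.shift q)) = a.shift q * star (a.shift q) := by
    rw [mul_assoc, ← mul_assoc (star v), hv, one_mul]
  rw [e1, e2, e3, e4, add_zero, zero_add, a.head_add_shift hq]

theorem absorb_mul_star (hq : IsStarProjection q) (v : H →L[ℂ] H) :
    a.absorb q v * star (a.absorb q v) = q + v * star v := by
  have e : star (a.absorb q v) = a.head * q + a.shift q * star v := by
    simp [absorb, hq.isSelfAdjoint.star_eq]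
  rw [e, absorb, add_mul, mul_add, mul_add]
  have e1 : q * star a.head * (a.head * q) = q := by
    rw [mul_assoc, a.head_star_head', hq.isIdempotentElem.eq]
  have e2 : q * star a.head * (a.shift q * star v) = 0 := by
    rw [← mul_assoc, a.head_mul_shift hq, zero_mul]
  have e3 : v * star (a.shift q) * (a.head * q) = 0 := by
    rw [mul_assoc, ← mul_assoc (star _), a.shift_star_mul_head hq, mul_zero]
  have e4 : v * star (a.shift q) * (a.shift q * star v) = v * star v := by
    rw [mul_assoc, ← mul_assoc (star (a.shift q)), a.shift_star_shift hq, one_mul]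
  rw [e1, e2, e3, e4, add_zero, zero_add]

/-- An infinite sum of copies of `y` does not change when one more copy of its part on the range of
`q` is added. Here `x` acts as `y` on that range and as `amp y` through `v`, and `absorb` is the
isometry that regroups the summands. -/
theorem absorb_mul_amp {x y v : H →L[ℂ] H} (hq : IsStarProjection q) (hy : q * y = y * q)
    (hx : x * q = q * y) (hxv : x * v = v * a.amp y) :
    x * a.absorb q v = a.absorb q v * a.amp y := by
  have h : star (a.shift q) * a.amp y = a.amp y * star (a.shift q) := by
    have hy' : q * star y = star y * q := by
      simpa [hq.isSelfAdjoint.star_eq] using congrArg star hy.symm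
    have := congrArg star (a.shift_mul_amp hy')
    rwa [star_mul, star_mul, ← map_star, star_star] at this
  rw [absorb, mul_add, add_mul, ← mul_assoc, hx, mul_assoc q, ← a.head_mul_amp, mul_assoc,
    ← mul_assoc x, hxv, mul_assoc v, mul_assoc v, h]

end Amplification

end Absorption

/-! ### Kuiper's theorem -/

section Kuiper

variable {H : Type u} [NormedAddCommGroup H] [InnerProductSpace ℂ H] [CompleteSpace H]

theorem exists_unit_orthogonal {K : Submodule ℂ H} (hK : ¬ FiniteDimensional ℂ K) (s : Finset H) :
    ∃ v ∈ K, ‖v‖ = 1 ∧ ∀ x ∈ s, ⟪x, v⟫_ℂ = 0 := by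
  let f : K →ₗ[ℂ] (s → ℂ) := LinearMap.pi fun x => (innerSL ℂ (x : H)).toLinearMap.comp K.subtype
  have hf : ¬ Function.Injective f := fun h => hK (FiniteDimensional.of_injective f h)
  rw [← LinearMap.ker_eq_bot, Submodule.eq_bot_iff] at hf
  push Not at hf
  obtain ⟨v, hv, hv0⟩ := hf
  have hv0' : (v : H) ≠ 0 := fun h => hv0 (Subtype.ext h)
  refine ⟨((‖(v : H)‖⁻¹ : ℝ) : ℂ) • v, K.smul_mem _ v.2, ?_, fun x hx => ?_⟩
  · rw [norm_smul, Complex.norm_real, norm_inv, norm_norm, inv_mul_cancel₀ (norm_ne_zero_iff.2 hv0')]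
  · have := congrFun (LinearMap.mem_ker.1 hv) ⟨x, hx⟩
    rw [inner_smul_right, show ⟪x, (v : H)⟫_ℂ = 0 from this, mul_zero]

theorem inner_eq_zero_of_hasSum {v : ℕ → H} {c : ℕ → ℂ} {x w : H}
    (h : HasSum (fun n => c n • v n) x) (hw : ∀ n, ⟪w, v n⟫_ℂ = 0) : ⟪w, x⟫_ℂ = 0 :=
  Submodule.mem_orthogonal_singleton_iff_inner_right.1 <|
    mem_of_hasSum_smul h (Submodule.isClosed_orthogonal _) fun n =>
      Submodule.mem_orthogonal_singleton_iff_inner_right.2 (hw n)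

theorem norm_le_one_of_star_mul_self {V : H →L[ℂ] H} (hV : star V * V = 1) : ‖V‖ ≤ 1 := by
  have h := CStarRing.norm_star_mul_self (x := V)
  rw [hV] at h
  have h1 : ‖(1 : H →L[ℂ] H)‖ ≤ 1 := ContinuousLinearMap.norm_id_le
  nlinarith [norm_nonneg V]

theorem star_mul_eq_zero_iff {V W : H →L[ℂ] H} :
    star V * W = 0 ↔ ∀ x y, ⟪V x, W y⟫_ℂ = 0 := by
  constructor
  · intro h x y
    rw [← ContinuousLinearMap.adjoint_inner_right]
    have := congrArg (fun z : H →L[ℂ] H => z y) h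
    change (ContinuousLinearMap.adjoint V) (W y) = 0 at this
    rw [this, inner_zero_right]
  · intro h
    ext y
    refine ext_inner_left ℂ fun x => ?_
    change ⟪x, (ContinuousLinearMap.adjoint V) (W y)⟫_ℂ = ⟪x, 0⟫_ℂ
    rw [ContinuousLinearMap.adjoint_inner_right, h, inner_zero_right]

/-- Two isometries such that finitely many operators map the range of the first one into the
orthogonal complement of the range of the second one. -/
theorem exists_isometries_orthogonal [TopologicalSpace.SeparableSpace H]
    (hH : ¬ FiniteDimensional ℂ H) (F : Finset (H →L[ℂ] H)) :
    ∃ V Y : H →L[ℂ] H, star V * V = 1 ∧ star Y * Y = 1 ∧ ∀ u ∈ F, star Y * (u * V) = 0 := by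
  classical
  obtain ⟨b⟩ := exists_hilbertBasis_nat hH
  have hT : ¬ FiniteDimensional ℂ (⊤ : Submodule ℂ H) := fun h =>
    hH (Submodule.topEquiv.finiteDimensional)
  -- The basis vectors of both ranges are chosen in pairs. A new vector has to be orthogonal to only
  -- finitely many others: the vectors chosen so far and their images under the operators in `F` or
  -- their adjoints.
  obtain ⟨f, hf1, hf2⟩ := exists_seq_of_forall_finset_exists
    (fun p : H × H => ‖p.1‖ = 1 ∧ ‖p.2‖ = 1 ∧ ∀ u ∈ F, ⟪p.2, u p.1⟫_ℂ = 0)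
    (fun p q => ⟪p.1, q.1⟫_ℂ = 0 ∧ ⟪p.2, q.2⟫_ℂ = 0 ∧
      ∀ u ∈ F, ⟪p.2, u q.1⟫_ℂ = 0 ∧ ⟪q.2, u p.1⟫_ℂ = 0) (fun s _ => by
    obtain ⟨v, -, hv1, hv⟩ := exists_unit_orthogonal hT
      (s.image Prod.fst ∪ (s ×ˢ F).image fun q => (star q.2) q.1.2)
    obtain ⟨y, -, hy1, hy⟩ := exists_unit_orthogonal hT
      (s.image Prod.snd ∪ (s ×ˢ F).image (fun q => q.2 q.1.1) ∪ F.image fun u => u v)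
    refine ⟨(v, y), ⟨hv1, hy1, fun u hu => ?_⟩, fun p hp => ⟨?_, ?_, fun u hu => ⟨?_, ?_⟩⟩⟩
    · rw [← inner_conj_symm, hy (u v) (by grind), map_zero]
    · exact hv _ (by grind)
    · exact hy _ (by grind)
    · rw [← ContinuousLinearMap.adjoint_inner_left]
      refine hv _ (Finset.mem_union_right _ (Finset.mem_image.2 ⟨(p, u), ?_, rfl⟩))
      exact Finset.mem_product.2 ⟨hp, hu⟩
    · rw [← inner_conj_symm, hy (u p.1), map_zero]
      refine Finset.mem_union_left _ (Finset.mem_union_right _ (Finset.mem_image.2 ⟨(p, u), ?_, rfl⟩))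
      exact Finset.mem_product.2 ⟨hp, hu⟩)
  have hv : Orthonormal ℂ fun n => (f n).1 := ⟨fun n => (hf1 n).1, fun m n hmn => by
    rcases lt_or_gt_of_ne hmn with h | h
    · exact (hf2 m n h).1
    · change ⟪(f m).1, (f n).1⟫_ℂ = 0
      rw [← inner_conj_symm, (hf2 n m h).1, map_zero]⟩
  have hy : Orthonormal ℂ fun n => (f n).2 := ⟨fun n => (hf1 n).2.1, fun m n hmn => by
    rcases lt_or_gt_of_ne hmn with h | h
    · exact (hf2 m n h).2.1
    · change ⟪(f m).2, (f n).2⟫_ℂ = 0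
      rw [← inner_conj_symm, (hf2 n m h).2.1, map_zero]⟩
  have hu : ∀ u ∈ F, ∀ m n, ⟪(f m).2, u (f n).1⟫_ℂ = 0 := fun u hu m n => by
    rcases lt_trichotomy m n with h | h | h
    · exact ((hf2 m n h).2.2 u hu).1
    · subst h
      exact (hf1 m).2.2 u hu
    · exact ((hf2 n m h).2.2 u hu).2
  obtain ⟨V, hV, hV'⟩ := exists_isometry_of_orthonormal b hv
  obtain ⟨Y, hY, hY'⟩ := exists_isometry_of_orthonormal b hy
  refine ⟨V, Y, star_mul_self_eq_one hV, star_mul_self_eq_one hY, fun u hu' => ?_⟩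
  rw [star_mul_eq_zero_iff]
  intro x z
  change ⟪Y x, u (V z)⟫_ℂ = 0
  rw [← ContinuousLinearMap.adjoint_inner_left]
  refine inner_eq_zero_of_hasSum (hV' z) fun n => ?_
  rw [ContinuousLinearMap.adjoint_inner_left, ← inner_conj_symm,
    inner_eq_zero_of_hasSum (hY' x) fun m => ?_, map_zero]
  rw [← inner_conj_symm, hu u hu', map_zero]

/-- For a compact family of invertible operators there are isometries `V` and `Y` with orthogonal
ranges such that `u x` maps the range of `V` far away from the range of `Y`. -/
theorem exists_isometries_norm_lt [TopologicalSpace.SeparableSpace H]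
    (hH : ¬ FiniteDimensional ℂ H) {T : Type*} [TopologicalSpace T]
    [CompactSpace T] (u : C(T, (H →L[ℂ] H)ˣ)) :
    ∃ V Y : H →L[ℂ] H, star V * V = 1 ∧ star Y * Y = 1 ∧ star Y * V = 0 ∧
      ∀ x, ‖star Y * (u x : H →L[ℂ] H) * V * (star V * (u x)⁻¹ * Y)‖ < 1 := by
  classical
  let A := H →L[ℂ] H
  have hc : Continuous fun x => (((u x)⁻¹ : Aˣ) : A) := by fun_prop
  have hc' : Continuous fun x => (u x : A) := by fun_prop
  obtain ⟨M, hM⟩ := isCompact_univ.exists_bound_of_continuousOn hc.continuousOn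
  -- The two factors in the conclusion will be bounded by `e` and by `|M|`, with `M` a bound for the
  -- inverses; adding one gives `e * |M| < 1`, also when `M = 0`.
  set e : ℝ := (|M| + 1)⁻¹ with he
  have he0 : 0 < e := by positivity
  obtain ⟨t, -, ht⟩ := (isCompact_range hc').elim_finite_subcover_image
    (b := Set.range fun x => (u x : A))
    (c := fun a => Metric.ball a e) (fun _ _ => Metric.isOpen_ball) (fun a ha =>
      Set.mem_biUnion ha (Metric.mem_ball_self he0))
  obtain ⟨ht1, ht2⟩ := ht
  obtain ⟨V, Y, hV, hY, h⟩ := exists_isometries_orthogonal hH (insert 1 ht1.toFinset)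
  refine ⟨V, Y, hV, hY, by simpa using h 1 (Finset.mem_insert_self _ _), fun x => ?_⟩
  obtain ⟨a, ha, hxa⟩ := Set.mem_iUnion₂.1 (ht2 (Set.mem_range_self x))
  have h0 := h a (Finset.mem_insert_of_mem (ht1.mem_toFinset.2 ha))
  have hV1 := norm_le_one_of_star_mul_self hV
  have hY1 := norm_le_one_of_star_mul_self hY
  have e1 : star Y * (u x : A) * V = star Y * ((u x : A) - a) * V := by
    rw [mul_sub, sub_mul, mul_assoc _ a, h0, sub_zero]
  have n1 : ‖star Y * (u x : A) * V‖ < e := by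
    rw [e1]
    have hxa' : ‖(u x : A) - a‖ < e := by rwa [Metric.mem_ball, dist_eq_norm] at hxa
    calc _ ≤ ‖star Y‖ * ‖(u x : A) - a‖ * ‖V‖ := norm_mul₃_le
      _ ≤ 1 * ‖(u x : A) - a‖ * 1 := by rw [norm_star]; gcongr
      _ < e := by simpa using hxa'
  have n2 : ‖star V * (((u x)⁻¹ : Aˣ) : A) * Y‖ ≤ |M| := by
    calc _ ≤ ‖star V‖ * ‖(((u x)⁻¹ : Aˣ) : A)‖ * ‖Y‖ := norm_mul₃_le
      _ ≤ 1 * |M| * 1 := by rw [norm_star]; gcongr; exact (hM x trivial).trans (le_abs_self M)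
      _ = |M| := by ring
  calc _ ≤ _ := norm_mul_le _ _
    _ ≤ e * |M| := by gcongr
    _ < 1 := by
      rw [he, inv_mul_lt_one₀ (by positivity)]
      linarith

/-- A family as in `exists_isometries_norm_lt` can be rotated to a family of operators that fix
the range of `V`. -/
theorem exists_homotopic_mul_eq {T : Type*} [TopologicalSpace T] (u : C(T, (H →L[ℂ] H)ˣ))
    {V Y : H →L[ℂ] H} (hV : star V * V = 1) (hY : star Y * Y = 1) (hYV : star Y * V = 0)
    (hu : ∀ x, ‖star Y * (u x : H →L[ℂ] H) * V * (star V * (u x)⁻¹ * Y)‖ < 1) :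
    ∃ w : C(T, (H →L[ℂ] H)ˣ), u.Homotopic w ∧ ∀ x, (w x : H →L[ℂ] H) * V = V := by
  let A := H →L[ℂ] H
  have hc : Continuous fun x => (((u x)⁻¹ : Aˣ) : A) := by fun_prop
  have hc' : Continuous fun x => (u x : A) := by fun_prop
  let e₁ : T → A := fun x => u x * V
  let f₁ : T → A := fun x => star V * (u x)⁻¹
  -- `P x` is the idempotent annihilating the range of `u x * V`. The operator `d x` differs from
  -- `1` by the product in `hu`, so it is invertible and `P x * Y` becomes the second column of a
  -- dual pair. One rotation takes `u x * V` to `P x * Y`; a second one, available because `star Y *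
  -- V = 0`, takes `P x * Y` to `V`.
  let P : T → A := fun x => 1 - e₁ x * f₁ x
  let e₂ : T → A := fun x => P x * Y
  let d : T → A := fun x => star Y * (P x * Y)
  let d' : T → A := fun x => Ring.inverse (d x)
  let f₂ : T → A := fun x => d' x * (star Y * P x)
  have hfe : ∀ x, f₁ x * e₁ x = 1 := fun x => by
    simp only [e₁, f₁, mul_assoc, Units.inv_mul_cancel_left, hV]
  have hPe : ∀ x, P x * e₁ x = 0 := fun x => by
    simp only [P, sub_mul, one_mul, mul_assoc, hfe, mul_one, sub_self]
  have hfP : ∀ x, f₁ x * P x = 0 := fun x => by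
    simp only [P, mul_sub, mul_one, ← mul_assoc, hfe, one_mul, sub_self]
  have hPP : ∀ x, P x * P x = P x := fun x => by
    conv_lhs => enter [2]; simp only [P]
    rw [mul_sub, mul_one, ← mul_assoc, hPe, zero_mul, sub_zero]
  have hd : ∀ x, d x = 1 - star Y * (u x : A) * V * (star V * (u x)⁻¹ * Y) := fun x => by
    simp only [d, P, e₁, f₁, sub_mul, mul_sub, one_mul, hY, mul_assoc]
  have hdu : ∀ x, IsUnit (d x) := fun x => by
    rw [hd]
    exact isUnit_one_sub_of_norm_lt_one (hu x)
  have hd' : ∀ x, d' x * d x = 1 := fun x => Ring.inverse_mul_cancel _ (hdu x)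
  have hdc : Continuous d := by
    simp only [d, P, e₁, f₁]
    fun_prop
  have hd'c : Continuous d' := continuous_iff_continuousAt.2 fun x => by
    obtain ⟨v, hv⟩ := hdu x
    refine ContinuousAt.comp (g := Ring.inverse) ?_ hdc.continuousAt
    rw [← hv]
    exact NormedRing.inverse_continuousAt v
  have D₁ : ∀ x, IsDualPair (e₁ x) (e₂ x) (f₁ x) (f₂ x) := fun x =>
    { h₁₁ := hfe x
      h₂₂ := by
        simp only [f₂, e₂]
        rw [mul_assoc, mul_assoc, ← mul_assoc (P x), hPP]
        exact hd' x
      h₁₂ := by simp only [e₂, ← mul_assoc, hfP, zero_mul]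
      h₂₁ := by simp only [f₂, mul_assoc, hPe, mul_zero] }
  have D₂ : ∀ x, IsDualPair (e₂ x) V (d' x * star Y)
      (star V - star V * e₂ x * (d' x * star Y)) := fun x => by
    have h1 : d' x * star Y * e₂ x = 1 := by rw [mul_assoc]; exact hd' x
    have h2 : d' x * star Y * V = 0 := by rw [mul_assoc, hYV, mul_zero]
    exact
      { h₁₁ := h1
        h₂₂ := by rw [sub_mul, mul_assoc, h2, mul_zero, sub_zero, hV]
        h₁₂ := h2
        h₂₁ := by rw [sub_mul, mul_assoc, h1, mul_one, sub_self] }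
  have he₁ : Continuous e₁ := by simp only [e₁]; fun_prop
  have hf₁ : Continuous f₁ := by simp only [f₁]; fun_prop
  have he₂ : Continuous e₂ := by simp only [e₂, P]; fun_prop
  have hf₂ : Continuous f₂ := by simp only [f₂, P]; fun_prop
  obtain ⟨r₁, hr₁, h₁⟩ := exists_rotation_homotopic_one D₁ he₁ he₂ hf₁ hf₂
  obtain ⟨r₂, hr₂, h₂⟩ := exists_rotation_homotopic_one D₂ he₂ (by fun_prop) (by fun_prop)
    (by fun_prop)
  refine ⟨r₂ * (r₁ * u), ?_, fun x => ?_⟩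
  · have := homotopic_mul hr₂ (homotopic_mul hr₁ (ContinuousMap.Homotopic.refl u))
    rw [one_mul, one_mul] at this
    exact this.symm
  · have k₁ : ((r₁ x : Aˣ) : A) * ((u x : A) * V) = e₂ x := by
      rw [h₁, IsDualPair.val_rotUnit_one]
      exact (D₁ x).rot_zero_one_mul
    have k₂ : ((r₂ x : Aˣ) : A) * e₂ x = V := by
      rw [h₂, IsDualPair.val_rotUnit_one]
      exact (D₂ x).rot_zero_one_mul
    change ((r₂ x : Aˣ) : A) * (((r₁ x : Aˣ) : A) * (u x : A)) * V = V
    rw [mul_assoc, mul_assoc, k₁, k₂]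

/-- Extension of an operator on the range of an isometry by the identity. -/
def corner {w : H →L[ℂ] H} (hw : star w * w = 1) : (H →L[ℂ] H) →* (H →L[ℂ] H) where
  toFun y := (1 - w * star w) + w * y * star w
  map_one' := by simp
  map_mul' x y := by
    have r : ∀ z, star w * (w * z) = z := fun z => by rw [← mul_assoc, hw, one_mul]
    simp only [mul_add, add_mul, mul_sub, sub_mul, mul_assoc, one_mul, mul_one, r, sub_self,
      zero_add]
    abel

/-- `corner` for continuous families of invertible operators. -/
def cornerMap {w : H →L[ℂ] H} (hw : star w * w = 1) {T : Type*} [TopologicalSpace T]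
    (f : C(T, (H →L[ℂ] H)ˣ)) : C(T, (H →L[ℂ] H)ˣ) :=
  ⟨fun x => Units.map (corner hw) (f x), by
    have : Continuous (Units.map (corner hw)) := by
      apply Continuous.units_map
      change Continuous fun y : H →L[ℂ] H => (1 - w * star w) + w * y * star w
      fun_prop
    fun_prop⟩

theorem cornerMap_homotopic {w : H →L[ℂ] H} (hw : star w * w = 1) {T : Type*} [TopologicalSpace T]
    {f g : C(T, (H →L[ℂ] H)ˣ)} (h : f.Homotopic g) :
    (cornerMap hw f).Homotopic (cornerMap hw g) := by
  obtain ⟨F⟩ := h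
  exact ⟨⟨cornerMap hw F.toContinuousMap, fun x => by simp [cornerMap],
    fun x => by simp [cornerMap]⟩⟩

theorem cornerMap_one {w : H →L[ℂ] H} (hw : star w * w = 1) {T : Type*} [TopologicalSpace T] :
    cornerMap hw (1 : C(T, (H →L[ℂ] H)ˣ)) = 1 := by
  ext1 x
  exact map_one (Units.map (corner hw))

theorem cornerMap_mul {w : H →L[ℂ] H} (hw : star w * w = 1) {T : Type*} [TopologicalSpace T]
    (f g : C(T, (H →L[ℂ] H)ˣ)) : cornerMap hw (f * g) = cornerMap hw f * cornerMap hw g := by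
  ext1 x
  exact map_mul (Units.map (corner hw)) _ _


theorem IsDualPair.rot_zero_one_mul_two {A : Type*} [Ring A] [Algebra ℂ A] {e₁ e₂ f₁ f₂ : A}
    (h : IsDualPair e₁ e₂ f₁ f₂) : rot e₁ e₂ f₁ f₂ 0 1 * e₂ = -e₁ := by
  simp only [rot, zero_sub, neg_smul, one_smul, add_mul, sub_mul, neg_mul, one_mul, mul_assoc,
    h.h₂₂, h.h₁₂, mul_one, mul_zero, zero_add, zero_sub]
  abel

/-- A family of operators that is the identity on the range of an isometry, and preserves its
orthogonal complement, is homotopic to `1`. -/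
theorem homotopic_one_of_mul_eq (a : Amplification H) {T : Type*} [TopologicalSpace T]
    (g : C(T, (H →L[ℂ] H)ˣ)) {V : H →L[ℂ] H} (hV : star V * V = 1)
    (hgV : ∀ x, (g x : H →L[ℂ] H) * V = V) (hVg : ∀ x, star V * (g x : H →L[ℂ] H) = star V) :
    g.Homotopic 1 := by
  let A := H →L[ℂ] H
  have hamp : Continuous (Units.map (a.amp : A →* A)) :=
    Continuous.units_map _ (map_continuous a.amp)
  let G : C(T, Aˣ) := ⟨fun x => Units.map (a.amp : A →* A) (g x), by fun_prop⟩
  have hs : IsDualPair a.head a.tail (star a.head) (star a.tail) :=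
    ⟨a.head_star_head, a.tail_star_tail, a.head_star_tail, a.tail_star_head⟩
  obtain ⟨R, hR, hR'⟩ := exists_rotation_homotopic_one (T := T) (fun _ => hs)
    continuous_const continuous_const continuous_const continuous_const
  have hRh : ∀ x, (R x : A) * a.head = a.tail := fun x => by
    rw [hR', IsDualPair.val_rotUnit_one, hs.rot_zero_one_mul]
  have hRt : ∀ x, (R x : A) * a.tail = -a.head := fun x => by
    rw [hR', IsDualPair.val_rotUnit_one, hs.rot_zero_one_mul_two]
  have hh : (1 : A) - a.head * star a.head = a.tail * star a.tail :=
    sub_eq_of_eq_add' a.head_add_tail.symm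
  let c := cornerMap a.head_star_head G⁻¹
  -- This is the Whitehead trick: `D` is a commutator with the rotation `R`, so it contracts along
  -- with `R`, and its value is the block sum of `G⁻¹` and `G`.
  let D : C(T, Aˣ) := c * (R * (cornerMap a.head_star_head G * R⁻¹))
  have hDh : D.Homotopic 1 := by
    have hR' : (R⁻¹).Homotopic 1 := by
      obtain ⟨F⟩ := hR
      exact ⟨⟨F.toContinuousMap⁻¹, fun x => by simp, fun x => by simp⟩⟩
    have h1 := homotopic_mul (.refl c) (homotopic_mul hR
      (homotopic_mul (.refl (cornerMap a.head_star_head G)) hR'))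
    have e : c * (1 * (cornerMap a.head_star_head G * 1)) = 1 := by
      rw [one_mul, mul_one, ← cornerMap_mul, inv_mul_cancel, cornerMap_one]
    rw [e] at h1
    exact h1
  have hRstar : ∀ x, (R x : A) * (a.head * star a.head + a.tail * star a.tail) =
      a.tail * star a.head - a.head * star a.tail := fun x => by
    rw [mul_add, ← mul_assoc, ← mul_assoc, hRh, hRt]
    simp only [neg_mul]
    abel
  have hDval : ∀ x, (D x : A) = a.head * (((G x)⁻¹ : Aˣ) : A) * star a.head +
      a.tail * (G x : A) * star a.tail := fun x => by
    have e1 : (c x : A) = a.tail * star a.tail + a.head * (((G x)⁻¹ : Aˣ) : A) * star a.head := by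
      rw [← hh]
      rfl
    have e2 : ((R * (cornerMap a.head_star_head G * R⁻¹)) x : A) =
        a.head * star a.head + a.tail * (G x : A) * star a.tail := by
      change (R x : A) * (((1 - a.head * star a.head) + a.head * (G x : A) * star a.head) *
        (((R x)⁻¹ : Aˣ) : A)) = _
      rw [← mul_assoc, Units.mul_inv_eq_iff_eq_mul, hh, mul_add, ← mul_assoc, ← mul_assoc,
        ← mul_assoc, hRh, hRt]
      have k1 : star a.head * (R x : A) = -star a.tail := by
        have := hRstar x
        rw [a.head_add_tail, mul_one] at this
        rw [this, mul_sub, a.head_star_tail', a.head_star_head', zero_sub]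
      have k2 : star a.tail * (R x : A) = star a.head := by
        have := hRstar x
        rw [a.head_add_tail, mul_one] at this
        rw [this, mul_sub, a.tail_star_tail', a.tail_star_head', sub_zero]
      rw [add_mul, mul_assoc a.head (star a.head), k1, mul_assoc _ (star a.tail) (R x : A), k2]
      simp only [neg_mul, mul_neg, mul_assoc]
    change (c x : A) * ((R * (cornerMap a.head_star_head G * R⁻¹)) x : A) = _
    rw [e1, e2]
    simp only [mul_add, add_mul, mul_assoc, a.tail_star_head', a.tail_star_tail',
      a.head_star_head', a.head_star_tail', mul_zero, add_zero, zero_add]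
  have hQ : IsStarProjection (1 - V * star V) := by
    refine IsStarProjection.one_sub ⟨?_, ?_⟩
    · change V * star V * (V * star V) = V * star V
      rw [mul_assoc, ← mul_assoc (star V), hV, one_mul]
    · change star (V * star V) = V * star V
      rw [star_mul, star_star]
  set q := 1 - V * star V with hq
  have hqV : q * V = 0 := by rw [hq, sub_mul, one_mul, mul_assoc, hV, mul_one, sub_self]
  have hqg : ∀ x, q * (g x : A) = (g x : A) * q := fun x => by
    rw [hq, sub_mul, mul_sub, one_mul, mul_one, mul_assoc, hVg, ← mul_assoc, hgV]
  -- This is the swindle. In `g * cornerMap hV D` the range of `q` carries `g`, and the range of `V`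
  -- carries a copy of `D`. The block `G` of that copy lives on the range of `v` and absorbs the
  -- summand carried by `q`, so the product is conjugate to `D` by the fixed operator `Φ`. As `D` is
  -- homotopic to `1`, so is `g`.
  let v := V * a.tail
  have hv : star v * v = 1 := by
    simp only [v, star_mul, mul_assoc]
    rw [← mul_assoc (star V), hV, one_mul, a.tail_star_tail]
  have hqv : q * v = 0 := by simp only [v]; rw [← mul_assoc, hqV, zero_mul]
  let W := a.absorb q v
  have hW1 : star W * W = 1 := a.absorb_star_absorb hQ hv hqv
  have hW2 : W * star W = q + v * star v := a.absorb_mul_star hQ v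
  have hVW : star V * W = a.tail * star (a.shift q) := by
    have : star V * q = 0 := by simpa [hQ.isSelfAdjoint.star_eq] using congrArg star hqV
    simp only [W, Amplification.absorb, mul_add, v]
    rw [← mul_assoc, this, zero_mul, zero_add, ← mul_assoc, ← mul_assoc, hV, one_mul]
  have hcross : a.head * star a.head * star V * (W * star a.tail) = 0 := by
    rw [mul_assoc, ← mul_assoc (star V), hVW, mul_assoc, mul_assoc, a.head_star_tail', mul_zero]
  have hcross' : a.tail * star W * (V * a.head * star a.head) = 0 := by
    have := congrArg star hcross
    simpa [mul_assoc] using this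
  let Φ : Aˣ :=
    { val := a.head * star a.head * star V + a.tail * star W
      inv := V * a.head * star a.head + W * star a.tail
      val_inv := by
        rw [add_mul, mul_add, mul_add, hcross, hcross', zero_add, add_zero]
        have k1 : a.head * star a.head * star V * (V * a.head * star a.head) =
            a.head * star a.head := by
          simp only [mul_assoc]
          rw [← mul_assoc (star V), hV, one_mul, a.head_star_head']
        have k2 : a.tail * star W * (W * star a.tail) = a.tail * star a.tail := by
          rw [mul_assoc, ← mul_assoc (star W), hW1, one_mul]
        rw [k1, k2, a.head_add_tail]
      inv_val := by
        have k1 : V * a.head * star a.head * (a.head * star a.head * star V) =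
            V * (a.head * star a.head) * star V := by
          simp only [mul_assoc, a.head_star_head']
        have k2 : V * a.head * star a.head * (a.tail * star W) = 0 := by
          simp only [mul_assoc, a.head_star_tail', mul_zero]
        have k3 : W * star a.tail * (a.head * star a.head * star V) = 0 := by
          simp only [mul_assoc, a.tail_star_head', mul_zero]
        have k4 : W * star a.tail * (a.tail * star W) = q + V * (a.tail * star a.tail) * star V := by
          rw [mul_assoc, a.tail_star_tail', hW2]
          simp only [v, star_mul, mul_assoc]
        rw [add_mul, mul_add, mul_add, k1, k2, k3, k4, add_zero, zero_add, add_left_comm,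
          ← add_mul, ← mul_add, a.head_add_tail, mul_one, hq, sub_add_cancel] }
  have key : ∀ x, g x * cornerMap hV D x = Φ⁻¹ * D x * Φ := fun x => by
    refine eq_mul_of_mul_inv_eq (Units.ext ?_)
    have hk : ((g x * cornerMap hV D x : Aˣ) : A) = g x * q + V * (D x : A) * star V := by
      change (g x : A) * (q + V * (D x : A) * star V) = _
      rw [mul_add, ← mul_assoc, ← mul_assoc, hgV]
    have hkV : ((g x * cornerMap hV D x : Aˣ) : A) * V = V * (D x : A) := by
      rw [hk, add_mul, mul_assoc, hqV, mul_zero, zero_add, mul_assoc, hV, mul_one]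
    have hDt : (D x : A) * a.tail = a.tail * a.amp (g x : A) := by
      rw [hDval, add_mul, mul_assoc _ _ a.tail, a.head_star_tail, mul_zero, zero_add,
        mul_assoc _ _ a.tail, a.tail_star_tail, mul_one]
      rfl
    have hDt' : star a.tail * (D x : A) = a.amp (g x : A) * star a.tail := by
      rw [hDval, mul_add]
      simp only [mul_assoc, a.tail_star_head', a.tail_star_tail', zero_add]
      rfl
    have hDh : (D x : A) * (a.head * star a.head) = a.head * star a.head * (D x : A) := by
      rw [hDval]
      simp only [mul_add, add_mul, mul_assoc, a.head_star_head', a.tail_star_head',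
        a.head_star_tail', mul_zero, add_zero]
    have hqq : ((g x * cornerMap hV D x : Aˣ) : A) * q = q * (g x : A) := by
      have : star V * q = 0 := by simpa [hQ.isSelfAdjoint.star_eq] using congrArg star hqV
      rw [hk, add_mul, mul_assoc, hQ.isIdempotentElem.eq, mul_assoc _ _ q, this, mul_zero,
        add_zero, hqg]
    have hW := a.absorb_mul_amp (x := ((g x * cornerMap hV D x : Aˣ) : A)) (y := (g x : A)) (v := v)
      hQ (hqg x) hqq (by
        simp only [v]
        rw [← mul_assoc, hkV, mul_assoc, hDt, mul_assoc])
    change ((g x * cornerMap hV D x : Aˣ) : A) * (V * a.head * star a.head + W * star a.tail) =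
      (V * a.head * star a.head + W * star a.tail) * (D x : A)
    have l1 : ((g x * cornerMap hV D x : Aˣ) : A) * (V * a.head * star a.head) =
        V * a.head * star a.head * (D x : A) := by
      rw [mul_assoc V, ← mul_assoc, hkV, mul_assoc V, hDh, mul_assoc V]
    have l2 : ((g x * cornerMap hV D x : Aˣ) : A) * (W * star a.tail) =
        W * star a.tail * (D x : A) := by
      rw [← mul_assoc, hW, mul_assoc, ← hDt', ← mul_assoc]
    rw [mul_add, l1, l2, add_mul]
  have h1 : (g * cornerMap hV D).Homotopic g := by
    have := homotopic_mul (.refl g) (cornerMap_homotopic hV hDh)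
    rwa [cornerMap_one, mul_one] at this
  have h2 : (g * cornerMap hV D).Homotopic 1 := by
    have e : g * cornerMap hV D =
        ContinuousMap.const T Φ⁻¹ * D * ContinuousMap.const T Φ := by
      ext1 x
      exact key x
    have := homotopic_mul (homotopic_mul (.refl (ContinuousMap.const T Φ⁻¹)) hDh)
      (.refl (ContinuousMap.const T Φ))
    rw [← e] at this
    have e' : ContinuousMap.const T Φ⁻¹ * 1 * ContinuousMap.const T Φ = 1 := by
      ext1 x
      simp
    rwa [e'] at this
  exact h1.symm.trans h2

/-- Every compact family of invertible operators on a separable Hilbert space of infinite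
dimension is homotopic to the constant family `1`. -/
theorem homotopic_one_of_compactSpace [TopologicalSpace.SeparableSpace H]
    (hH : ¬ FiniteDimensional ℂ H) {T : Type*} [TopologicalSpace T]
    [CompactSpace T] (u : C(T, (H →L[ℂ] H)ˣ)) : u.Homotopic 1 := by
  let A := H →L[ℂ] H
  obtain ⟨a⟩ := exists_amplification hH
  obtain ⟨V, Y, hV, hY, hYV, hu⟩ := exists_isometries_norm_lt hH u
  obtain ⟨w, huw, hw⟩ := exists_homotopic_mul_eq u hV hY hYV hu
  set q := 1 - V * star V with hq
  have hqV : q * V = 0 := by rw [hq, sub_mul, one_mul, mul_assoc, hV, mul_one, sub_self]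
  -- By `hw`, `w x` is block triangular with respect to the range of `V`, with the identity in that
  -- corner. The unipotent factor removes the remaining off-diagonal block.
  obtain ⟨r, hr, hr'⟩ := exists_unipotent_homotopic_one
    (n := fun x => V * (star V * ((w x : A) * q))) (by fun_prop) (fun x => by
      simp only [mul_assoc]
      rw [← mul_assoc q, hqV, zero_mul, mul_zero, mul_zero, mul_zero])
  have hrV : ∀ x, (r x : A) * V = V := fun x => by
    rw [hr', sub_mul, one_mul]
    simp only [mul_assoc]
    rw [hqV, mul_zero, mul_zero, mul_zero, sub_zero]
  have h1 : (w * r).Homotopic w := by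
    have := homotopic_mul (.refl w) hr
    rwa [mul_one] at this
  refine (huw.trans h1.symm).trans (homotopic_one_of_mul_eq a (w * r) hV (fun x => ?_) fun x => ?_)
  · change (w x : A) * (r x : A) * V = V
    rw [mul_assoc, hrV, hw]
  · change star V * ((w x : A) * (r x : A)) = star V
    rw [hr', mul_sub, mul_one, ← mul_assoc (w x : A), hw, mul_sub, ← mul_assoc (star V) V, hV,
      one_mul, ← mul_sub, ← mul_one_sub, hq, sub_sub_cancel, ← mul_assoc (w x : A), hw,
      ← mul_assoc, hV, one_mul]

end Kuiper

/-! ### Transfer of contractibility -/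

/-- Domination suffices: the identity of `X` factors through `Z` up to homotopy, and no homotopy on
`Z` is required. -/
theorem contractibleSpace_of_homotopic {X Z : Type*} [TopologicalSpace X] [TopologicalSpace Z]
    (r : C(X, Z)) (i : C(Z, X)) (h : (i.comp r).Homotopic (ContinuousMap.id X))
    (hZ : ContractibleSpace Z) : ContractibleSpace X := by
  rw [contractible_iff_id_nullhomotopic] at hZ ⊢
  obtain ⟨z, hz⟩ := hZ
  refine ⟨i z, h.symm.trans ?_⟩
  have := (ContinuousMap.Homotopic.refl i).comp (hz.comp (ContinuousMap.Homotopic.refl r))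
  exact this

/-- Continuity into `S` is tested after applying `f`, so a contraction of `S'` can be lifted
pointwise through arbitrary preimages. Only the ends need care: the point itself at time zero and
one fixed preimage at time one. -/
theorem isContractibleIn_of_isInducing {Y Z : Type*} {t : TopologicalSpace Y} {S : Set Y}
    [TopologicalSpace Z] {S' : Set Z} (f : S → Z)
    (hf : @IsInducing S Z (TopologicalSpace.induced Subtype.val t) _ f)
    (hmem : ∀ y, f y ∈ S') (hsurj : ∀ z ∈ S', ∃ y, f y = z) (h : ContractibleSpace S') :
    IsContractibleIn t S := by
  let _ : TopologicalSpace S := TopologicalSpace.induced Subtype.val t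
  change ContractibleSpace S
  rw [contractible_iff_id_nullhomotopic] at h ⊢
  obtain ⟨z₀, ⟨F⟩⟩ := h
  choose g hg using fun z : S' => hsurj z z.2
  let f' : S → S' := fun y => ⟨f y, hmem y⟩
  have hf' : Continuous f' := hf.continuous.subtype_mk _
  classical
  let G : I × S → S := fun p =>
    if p.1 = 0 then p.2 else if p.1 = 1 then g z₀ else g (F (p.1, f' p.2))
  have hG : ∀ p, f (G p) = F (p.1, f' p.2) := fun p => by
    simp only [G]
    split_ifs with h0 h1
    · rw [h0, F.apply_zero]
      rfl
    · rw [h1, F.apply_one, hg]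
      rfl
    · rw [hg]
  refine ⟨g z₀, ⟨⟨⟨G, hf.continuous_iff.2 ?_⟩, fun y => ?_, fun y => ?_⟩⟩⟩
  · have e : f ∘ G = fun p => ((F (p.1, f' p.2) : S') : Z) := funext hG
    rw [e]
    fun_prop
  · simp [G]
  · simp [G]

/-! ### Polar decomposition of invertible operators -/

section Polar

variable {H : Type u} [NormedAddCommGroup H] [InnerProductSpace ℂ H] [CompleteSpace H]

/-- The unitary part of an invertible operator. -/
def polar (a : H →L[ℂ] H) : H →L[ℂ] H := a * Ring.inverse (CFC.abs a)

variable {a : H →L[ℂ] H}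

theorem isUnit_abs_of_star_mul_self (ha : IsUnit (star a * a)) : IsUnit (CFC.abs a) := by
  rwa [CFC.abs, CFC.isUnit_sqrt_iff _ (star_mul_self_nonneg a)]

theorem isUnit_abs (ha : IsUnit a) : IsUnit (CFC.abs a) :=
  isUnit_abs_of_star_mul_self (ha.star.mul ha)

theorem polar_mul_abs (ha : IsUnit a) : polar a * CFC.abs a = a := by
  rw [polar, mul_assoc, Ring.inverse_mul_cancel _ (isUnit_abs ha), mul_one]

/-- Surjectivity of `a` plays no role. In `exists_isometry_family` this makes an isometry of an
operator that is only bounded below. -/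
theorem star_polar_mul_polar (ha : IsUnit (star a * a)) : star (polar a) * polar a = 1 := by
  have hs := isUnit_abs_of_star_mul_self ha
  have hs1 : star (CFC.abs a) = CFC.abs a := (CFC.abs_nonneg a).isSelfAdjoint.star_eq
  rw [polar, star_mul, ← Ring.inverse_star, hs1, mul_assoc, ← mul_assoc (star a),
    ← CFC.abs_mul_abs, mul_assoc, Ring.mul_inverse_cancel _ hs, mul_one,
    Ring.inverse_mul_cancel _ hs]

theorem polar_mem_unitary (ha : IsUnit a) : polar a ∈ unitary (H →L[ℂ] H) := by
  have h1 := star_polar_mul_polar (ha.star.mul ha)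
  obtain ⟨w, hw⟩ : IsUnit (polar a) := ha.mul (isUnit_abs ha).ringInverse
  refine Unitary.mem_iff.2 ⟨h1, ?_⟩
  rw [← hw] at h1 ⊢
  rw [left_inv_eq_right_inv h1 w.mul_inv, w.mul_inv]

theorem continuous_ringInverse {T : Type*} [TopologicalSpace T] {f : T → H →L[ℂ] H}
    (hf : Continuous f) (h : ∀ x, IsUnit (f x)) : Continuous fun x => Ring.inverse (f x) :=
  continuous_iff_continuousAt.2 fun x => by
    obtain ⟨v, hv⟩ := h x
    refine ContinuousAt.comp (g := Ring.inverse) ?_ hf.continuousAt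
    rw [← hv]
    exact NormedRing.inverse_continuousAt v

theorem continuous_abs {T : Type*} [TopologicalSpace T] {f : T → H →L[ℂ] H}
    (hf : Continuous f) : Continuous fun x => CFC.abs (f x) :=
  CFC.continuousOn_sqrt.comp_continuous (by fun_prop) fun x => star_mul_self_nonneg (f x)

theorem continuous_polar {T : Type*} [TopologicalSpace T] {f : T → H →L[ℂ] H}
    (hf : Continuous f) (h : ∀ x, IsUnit (star (f x) * f x)) : Continuous fun x => polar (f x) :=
  hf.mul (continuous_ringInverse (continuous_abs hf) fun x => isUnit_abs_of_star_mul_self (h x))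

theorem polar_of_mem_unitary (ha : a ∈ unitary (H →L[ℂ] H)) : polar a = a := by
  rw [polar, CFC.abs_of_mem_unitary ha, Ring.inverse_one, mul_one]

theorem commute_ringInverse_left {M : Type*} [MonoidWithZero M] {a b : M} (h : Commute b a)
    (hb : IsUnit b) : Commute (Ring.inverse b) a := by
  obtain ⟨u, rfl⟩ := hb
  rw [Ring.inverse_unit]
  exact h.units_inv_left

theorem commute_polar_abs (h : IsUnit a) (ha : IsSelfAdjoint a) :
    Commute (polar a) (CFC.abs a) :=
  (CFC.commute_abs_self a ha.isStarNormal).symm.mul_left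
    (commute_ringInverse_left (Commute.refl _) (isUnit_abs h))

theorem isSelfAdjoint_polar (h : IsUnit a) (ha : IsSelfAdjoint a) : IsSelfAdjoint (polar a) := by
  change star (a * Ring.inverse (CFC.abs a)) = _
  rw [star_mul, ← Ring.inverse_star, (CFC.abs_nonneg a).isSelfAdjoint.star_eq, ha.star_eq]
  exact commute_ringInverse_left (CFC.commute_abs_self a ha.isStarNormal) (isUnit_abs h)

end Polar

/-! ### The general linear group and the unitary group -/

section Groups

variable {H : Type u} [NormedAddCommGroup H] [InnerProductSpace ℂ H] [CompleteSpace H]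
  [TopologicalSpace.SeparableSpace H]

/-- The invertible operators are open in a Banach space, so small balls give local convexity, and
Kuiper's argument deals with the compact families. -/
theorem contractibleSpace_units (hH : ¬ FiniteDimensional ℂ H) :
    ContractibleSpace (H →L[ℂ] H)ˣ := by
  have hemb : IsOpenEmbedding (Units.val : (H →L[ℂ] H)ˣ → _) := Units.isOpenEmbedding_val
  let e := hemb.isEmbedding.toHomeomorph
  suffices h : ContractibleSpace (Set.range (Units.val : (H →L[ℂ] H)ˣ → _)) from
    e.contractibleSpace
  let _ : NormedSpace ℝ (H →L[ℂ] H) := NormedSpace.restrictScalars ℝ ℂ _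
  refine contractibleSpace_of_compactlyContractible ⟨1, 1, rfl⟩ (fun x hx => ?_) fun T _ _ _ f => ?_
  · obtain ⟨r, hr, hrs⟩ := Metric.isOpen_iff.1 hemb.isOpen_range x hx
    exact ⟨r, hr, (convexHull_min Set.inter_subset_right (convex_ball x r)).trans hrs⟩
  · let u : C(T, (H →L[ℂ] H)ˣ) := (ContinuousMap.mk e.symm e.symm.continuous).comp f
    have h := (ContinuousMap.Homotopic.refl (ContinuousMap.mk e e.continuous)).comp
      (homotopic_one_of_compactSpace hH u)
    refine ⟨e 1, ?_⟩
    have e1 : (ContinuousMap.mk e e.continuous).comp u = f := by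
      ext1 x
      exact e.apply_symm_apply _
    rw [e1] at h
    exact h

/-- Taking the unitary part retracts the invertible operators to the unitary ones. -/
theorem contractibleSpace_unitary (hH : ¬ FiniteDimensional ℂ H) :
    ContractibleSpace (unitary (H →L[ℂ] H)) := by
  refine contractibleSpace_of_homotopic (Z := (H →L[ℂ] H)ˣ)
    ⟨Unitary.toUnits, Units.isOpenEmbedding_val.isInducing.continuous_iff.2 continuous_subtype_val⟩
    ⟨fun g => ⟨polar g, polar_mem_unitary g.isUnit⟩,
      (continuous_polar Units.continuous_val fun g => g.isUnit.star.mul g.isUnit).subtype_mk _⟩ ?_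
    (contractibleSpace_units hH)
  have e : ∀ g : unitary (H →L[ℂ] H), polar (Unitary.toUnits g : H →L[ℂ] H) = g := fun g =>
    polar_of_mem_unitary g.2
  exact ⟨⟨⟨fun q => q.2, by fun_prop⟩, fun g => Subtype.ext (e g).symm, fun g => rfl⟩⟩

end Groups

/-! ### Essentially nonnegative bounded operators -/

section EssNonneg

variable {H : Type u} [NormedAddCommGroup H] [InnerProductSpace ℂ H]

/-- The form of `c` is nonnegative on a closed subspace of finite codimension. -/
def EssNonneg (c : H →L[ℂ] H) : Prop :=
  ∃ F : Submodule ℂ H, FiniteDimensional ℂ F ∧ ∀ x ∈ Fᗮ, 0 ≤ (⟪c x, x⟫_ℂ).re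

/-- Neither `c` nor `-c` is essentially nonnegative. -/
def EssIndefinite (c : H →L[ℂ] H) : Prop := ¬ EssNonneg c ∧ ¬ EssNonneg (-c)

theorem EssIndefinite.neg {c : H →L[ℂ] H} (h : EssIndefinite c) : EssIndefinite (-c) :=
  ⟨h.2, by rw [neg_neg]; exact h.1⟩

theorem EssNonneg.add {c d : H →L[ℂ] H} (hc : EssNonneg c) (hd : EssNonneg d) :
    EssNonneg (c + d) := by
  obtain ⟨F, _, hF⟩ := hc
  obtain ⟨G, _, hG⟩ := hd
  refine ⟨F ⊔ G, inferInstance, fun x hx => ?_⟩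
  rw [add_apply, inner_add_left, Complex.add_re]
  exact add_nonneg (hF x (Submodule.orthogonal_le le_sup_left hx))
    (hG x (Submodule.orthogonal_le le_sup_right hx))

theorem not_essNonneg_of_neg (hH : ¬ FiniteDimensional ℂ H) {c : H →L[ℂ] H}
    (hc : ∀ x ≠ 0, (⟪c x, x⟫_ℂ).re < 0) : ¬ EssNonneg c := by
  rintro ⟨F, _, hF⟩
  have hF' : Fᗮ ≠ ⊥ := fun h => by
    rw [Submodule.orthogonal_eq_bot_iff] at h
    subst h
    exact hH (Submodule.topEquiv.finiteDimensional)
  obtain ⟨x, hx, hx0⟩ := Submodule.exists_mem_ne_zero_of_ne_bot hF'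
  exact absurd (hF x hx) (not_le.2 (hc x hx0))

variable [CompleteSpace H]

theorem inner_conj_apply (T c : H →L[ℂ] H) (x : H) :
    ⟪(T * c * star T) x, x⟫_ℂ = ⟪c (star T x), star T x⟫_ℂ := by
  change ⟪T (c (star T x)), x⟫_ℂ = ⟪c (star T x), ContinuousLinearMap.adjoint T x⟫_ℂ
  rw [ContinuousLinearMap.adjoint_inner_right]

theorem essNonneg_of_nonneg {c : H →L[ℂ] H} (hc : 0 ≤ c) : EssNonneg c :=
  ⟨⊥, inferInstance, fun x _ =>
    ((ContinuousLinearMap.nonneg_iff_isPositive _).1 hc).re_inner_nonneg_left x⟩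

theorem EssNonneg.conj {c : H →L[ℂ] H} (hc : EssNonneg c) (T : H →L[ℂ] H) :
    EssNonneg (T * c * star T) := by
  obtain ⟨F, _, hF⟩ := hc
  refine ⟨F.map T.toLinearMap, inferInstance, fun x hx => ?_⟩
  rw [inner_conj_apply]
  refine hF _ ((Submodule.mem_orthogonal _ _).2 fun y hy => ?_)
  change ⟪y, ContinuousLinearMap.adjoint T x⟫_ℂ = 0
  rw [ContinuousLinearMap.adjoint_inner_right]
  exact (Submodule.mem_orthogonal _ _).1 hx _ (Submodule.mem_map_of_mem hy)

/-- The preimage of `F` under the injective `T` is finite-dimensional, and `star T` maps `Fᗮ` to a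
dense subspace of its orthogonal complement. The inequality known on this subspace passes to the
closure. -/
theorem EssNonneg.of_conj {c T : H →L[ℂ] H} (hT : Function.Injective T)
    (hc : EssNonneg (T * c * star T)) : EssNonneg c := by
  obtain ⟨F, _, hF⟩ := hc
  have hfin : FiniteDimensional ℂ (F.comap T.toLinearMap) :=
    FiniteDimensional.of_injective (T.toLinearMap.restrict (p := F.comap T.toLinearMap) (q := F)
      fun x hx => hx) fun x y hxy => Subtype.ext (hT (congrArg Subtype.val hxy))
  refine ⟨F.comap T.toLinearMap, hfin, fun x hx => ?_⟩
  have hle : (Fᗮ.map (star T).toLinearMap)ᗮ ≤ F.comap T.toLinearMap := fun y hy => by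
    change T y ∈ F
    rw [← Submodule.orthogonal_orthogonal F]
    refine (Submodule.mem_orthogonal _ _).2 fun z hz => ?_
    rw [← ContinuousLinearMap.adjoint_inner_left]
    exact (Submodule.mem_orthogonal _ _).1 hy _ (Submodule.mem_map_of_mem hz)
  have hx' := Submodule.orthogonal_le hle hx
  rw [Submodule.orthogonal_orthogonal_eq_closure] at hx'
  have hcl : IsClosed {y : H | 0 ≤ (⟪c y, y⟫_ℂ).re} :=
    isClosed_le continuous_const (by fun_prop)
  refine closure_minimal (s := (Fᗮ.map (star T).toLinearMap : Set H)) ?_ hcl hx'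
  rintro _ ⟨z, hz, rfl⟩
  have := hF z hz
  rwa [inner_conj_apply] at this

theorem essNonneg_conj_iff {c T : H →L[ℂ] H} (hT : Function.Injective T) :
    EssNonneg (T * c * star T) ↔ EssNonneg c := ⟨.of_conj hT, fun h => h.conj T⟩

theorem essIndefinite_conj_iff {c T : H →L[ℂ] H} (hT : Function.Injective T) :
    EssIndefinite (T * c * star T) ↔ EssIndefinite c := by
  rw [EssIndefinite, EssIndefinite, essNonneg_conj_iff hT, ← essNonneg_conj_iff (c := -c) hT,
    mul_neg, neg_mul]

theorem injective_of_isUnit {a : H →L[ℂ] H} (ha : IsUnit a) : Function.Injective a := by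
  obtain ⟨w, rfl⟩ := ha
  refine Function.LeftInverse.injective (g := ((w⁻¹ : (H →L[ℂ] H)ˣ) : H →L[ℂ] H)) fun x => ?_
  exact congrArg (fun z : H →L[ℂ] H => z x) w.inv_mul

theorem injective_sqrt {p : H →L[ℂ] H} (hp : 0 ≤ p) (hinj : Function.Injective p) :
    Function.Injective ⇑(CFC.sqrt p) := by
  have h := CFC.sqrt_mul_sqrt_self p hp
  intro x y hxy
  apply hinj
  rw [← h]
  exact congrArg (CFC.sqrt p : H →L[ℂ] H) hxy

/-- A commuting positive factor acts as conjugation by its square root, so conditions on the sign do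
not see it if it is injective. -/
theorem mul_eq_sqrt_conj {p c : H →L[ℂ] H} (hp : 0 ≤ p) (hpc : Commute p c) :
    p * c = CFC.sqrt p * c * star (CFC.sqrt p) := by
  have h : Commute (CFC.sqrt p) c := hpc.cfcₙ_nnreal _
  rw [(CFC.sqrt_nonneg p).isSelfAdjoint.star_eq, mul_assoc, ← h.eq, ← mul_assoc,
    CFC.sqrt_mul_sqrt_self p hp]

theorem essNonneg_mul_iff {p c : H →L[ℂ] H} (hp : 0 ≤ p) (hinj : Function.Injective p)
    (hpc : Commute p c) : EssNonneg (p * c) ↔ EssNonneg c := by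
  rw [mul_eq_sqrt_conj hp hpc, essNonneg_conj_iff (injective_sqrt hp hinj)]

theorem essIndefinite_mul_iff {p c : H →L[ℂ] H} (hp : 0 ≤ p) (hinj : Function.Injective p)
    (hpc : Commute p c) : EssIndefinite (p * c) ↔ EssIndefinite c := by
  rw [mul_eq_sqrt_conj hp hpc, essIndefinite_conj_iff (injective_sqrt hp hinj)]

theorem re_inner_eq_norm_sqrt_sq {p : H →L[ℂ] H} (hp : 0 ≤ p) (x : H) :
    (⟪p x, x⟫_ℂ).re = ‖CFC.sqrt p x‖ ^ 2 := by
  have h : p = CFC.sqrt p * 1 * star (CFC.sqrt p) := by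
    rw [← mul_eq_sqrt_conj hp (.one_right p), mul_one]
  conv_lhs => rw [h]
  rw [inner_conj_apply, (CFC.sqrt_nonneg p).isSelfAdjoint.star_eq]
  exact inner_self_eq_norm_sq (𝕜 := ℂ) _

theorem exists_le_re_inner {p : H →L[ℂ] H} (hp : 0 ≤ p) (hu : IsUnit p) :
    ∃ ε > 0, ∀ x, ε * ‖x‖ ^ 2 ≤ (⟪p x, x⟫_ℂ).re := by
  obtain ⟨w, hw⟩ := (CFC.isUnit_sqrt_iff p hp).2 hu
  set M := ‖((w⁻¹ : (H →L[ℂ] H)ˣ) : H →L[ℂ] H)‖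
  refine ⟨(M ^ 2 + 1)⁻¹, by positivity, fun x => ?_⟩
  rw [re_inner_eq_norm_sqrt_sq hp, inv_mul_le_iff₀ (by positivity)]
  have h : ‖x‖ ≤ M * ‖CFC.sqrt p x‖ := by
    have : x = ((w⁻¹ : (H →L[ℂ] H)ˣ) : H →L[ℂ] H) (CFC.sqrt p x) := by
      rw [← hw]
      exact (congrArg (fun z : H →L[ℂ] H => z x) w.inv_mul).symm
    conv_lhs => rw [this]
    exact ContinuousLinearMap.le_opNorm _ _
  nlinarith [norm_nonneg x, sq_nonneg ‖CFC.sqrt p x‖]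

end EssNonneg

/-! ### Families of projections -/

section Projections

variable {H : Type u} [NormedAddCommGroup H] [InnerProductSpace ℂ H] [CompleteSpace H]

/-- The condition may depend on the index, which allows consecutive choices to be made in different
subspaces. -/
theorem exists_seq_of_forall_finset {α : Type*} (P : ℕ → Finset α → α → Prop)
    (hP : ∀ n s, ∃ y, P n s y) :
    ∃ (f : ℕ → α) (L : ℕ → Finset α), (∀ n, P n (L n) (f n)) ∧ ∀ m n, m < n → f m ∈ L n := by
  classical
  choose g hg using hP
  let L : ℕ → Finset α := fun n => Nat.rec ∅ (fun n s => insert (g n s) s) n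
  have hL : ∀ n, L (n + 1) = insert (g n (L n)) (L n) := fun n => rfl
  refine ⟨fun n => g n (L n), L, fun n => hg _ _, fun m n hmn => ?_⟩
  induction hmn with
  | refl => rw [hL]; exact Finset.mem_insert_self _ _
  | step _ ih => rw [hL]; exact Finset.mem_insert_of_mem ih

/-- Isometries into given subspaces, such that the ranges are orthogonal with respect to finitely
many forms. -/
theorem exists_isometries_mem [TopologicalSpace.SeparableSpace H] (hH : ¬ FiniteDimensional ℂ H)
    {ι : Type*} [Finite ι] {K : ι → Submodule ℂ H} (hK : ∀ i, ¬ FiniteDimensional ℂ (K i))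
    (hKc : ∀ i, IsClosed (K i : Set H)) (F : Finset (H →L[ℂ] H)) :
    ∃ V : ι → H →L[ℂ] H, (∀ i, star (V i) * V i = 1) ∧ (∀ i x, V i x ∈ K i) ∧
      ∀ i j, i ≠ j → ∀ u ∈ F, star (V i) * (u * V j) = 0 := by
  classical
  obtain ⟨b⟩ := exists_hilbertBasis_nat hH
  have hT : ¬ FiniteDimensional ℂ (⊤ : Submodule ℂ H) := fun h =>
    hH (Submodule.topEquiv.finiteDimensional)
  obtain ⟨N, ⟨e⟩⟩ := Finite.exists_equiv_fin ι
  have := Fintype.ofFinite ι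
  have := Encodable.ofEquiv _ e
  -- The encoding interleaves the sequences for all `i` in one induction; numbers that are not codes
  -- receive the whole space.
  let c : ι × ℕ → ℕ := Encodable.encode
  have hc : Function.Injective c := Encodable.encode_injective
  obtain ⟨f, L, hf, hL⟩ := exists_seq_of_forall_finset
    (fun n (s : Finset H) y => (∀ i j, c (i, j) = n → y ∈ K i) ∧ ‖y‖ = 1 ∧
      ∀ x ∈ s, ⟪x, y⟫_ℂ = 0 ∧ ∀ u ∈ F, ⟪x, u y⟫_ℂ = 0 ∧ ⟪y, u x⟫_ℂ = 0) (fun n s => by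
    obtain ⟨K', hK', hK'n⟩ : ∃ K' : Submodule ℂ H, ¬ FiniteDimensional ℂ K' ∧
        ∀ i j, c (i, j) = n → K' ≤ K i := by
      by_cases h : ∃ i j, c (i, j) = n
      · obtain ⟨i, j, h⟩ := h
        refine ⟨K i, hK i, fun i' j' h' => ?_⟩
        have hi : i = i' := congrArg Prod.fst (hc (h.trans h'.symm))
        rw [hi]
      · push Not at h
        exact ⟨⊤, hT, fun i j h' => absurd h' (h i j)⟩
    obtain ⟨y, hyK, hy1, hy⟩ := exists_unit_orthogonal hK'
      (s ∪ (s ×ˢ F).image (fun q => (star q.2) q.1) ∪ (s ×ˢ F).image (fun q => q.2 q.1))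
    refine ⟨y, fun i j h => hK'n i j h hyK, hy1, fun x hx => ⟨hy x (by grind), fun u hu => ⟨?_, ?_⟩⟩⟩
    · rw [← ContinuousLinearMap.adjoint_inner_left]
      refine hy _ (Finset.mem_union_left _ (Finset.mem_union_right _
        (Finset.mem_image.2 ⟨(x, u), Finset.mem_product.2 ⟨hx, hu⟩, rfl⟩)))
    · rw [← inner_conj_symm, hy (u x), map_zero]
      exact Finset.mem_union_right _
        (Finset.mem_image.2 ⟨(x, u), Finset.mem_product.2 ⟨hx, hu⟩, rfl⟩))
  have horth : ∀ m n, m ≠ n → ⟪f m, f n⟫_ℂ = 0 ∧ ∀ u ∈ F, ⟪f m, u (f n)⟫_ℂ = 0 := fun m n hmn => by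
    rcases lt_or_gt_of_ne hmn with h | h
    · have := (hf n).2.2 _ (hL m n h)
      exact ⟨this.1, fun u hu => (this.2 u hu).1⟩
    · have := (hf m).2.2 _ (hL n m h)
      refine ⟨?_, fun u hu => (this.2 u hu).2⟩
      rw [← inner_conj_symm, this.1, map_zero]
  have hv : ∀ i, Orthonormal ℂ fun j => f (c (i, j)) := fun i =>
    ⟨fun j => (hf _).2.1, fun j k hjk => (horth _ _ fun h => hjk (congrArg Prod.snd (hc h))).1⟩
  choose V hV hV' using fun i => exists_isometry_of_orthonormal b (hv i)
  refine ⟨V, fun i => star_mul_self_eq_one (hV i), fun i x => ?_, fun i j hij u hu => ?_⟩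
  · exact mem_of_hasSum_smul (hV' i x) (hKc i) fun k => (hf _).1 i k rfl
  · rw [star_mul_eq_zero_iff]
    intro x z
    change ⟪V i x, u (V j z)⟫_ℂ = 0
    rw [← ContinuousLinearMap.adjoint_inner_left]
    refine inner_eq_zero_of_hasSum (hV' j z) fun n => ?_
    rw [ContinuousLinearMap.adjoint_inner_left, ← inner_conj_symm,
      inner_eq_zero_of_hasSum (hV' i x) fun m => ?_, map_zero]
    rw [← inner_conj_symm, (horth _ _ fun h => hij (congrArg Prod.fst (hc h))).2 u hu, map_zero]

theorem norm_one_le : ‖(1 : H →L[ℂ] H)‖ ≤ 1 := ContinuousLinearMap.norm_id_le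

/-- A compact family of projections of infinite rank is the family of range projections of
a continuous family of isometries. -/
theorem exists_isometry_family [TopologicalSpace.SeparableSpace H] (hH : ¬ FiniteDimensional ℂ H)
    {T : Type*} [TopologicalSpace T] [CompactSpace T] [T2Space T] {b : T → H →L[ℂ] H}
    (hbc : Continuous b) (hb : ∀ x, IsStarProjection (b x))
    (hK : ∀ x, ¬ FiniteDimensional ℂ (LinearMap.ker (1 - b x : H →L[ℂ] H).toLinearMap)) :
    ∃ U : T → H →L[ℂ] H, Continuous U ∧ ∀ x, star (U x) * U x = 1 ∧ U x * star (U x) = b x := by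
  classical
  obtain ⟨t, ht⟩ := isCompact_univ.elim_finite_subcover
    (fun x => {y | ‖b y - b x‖ < 1 / 8}) (fun x => isOpen_lt (by fun_prop) continuous_const)
    (fun x _ => Set.mem_iUnion.2 ⟨x, by simp⟩)
  obtain ⟨ρ, hρ⟩ := PartitionOfUnity.exists_isSubordinate (X := T) isClosed_univ
    (fun i : t => {y | ‖b y - b i‖ < 1 / 8}) (fun i => isOpen_lt (by fun_prop) continuous_const)
    (fun x _ => by
      obtain ⟨i, hi, hx⟩ := Set.mem_iUnion₂.1 (ht (Set.mem_univ x))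
      exact Set.mem_iUnion.2 ⟨⟨i, hi⟩, hx⟩)
  have hρ' : ∀ i x, ρ i x ≠ 0 → ‖b x - b i‖ < 1 / 8 := fun i x h => hρ i (subset_tsupport _ h)
  have hρ1 : ∀ x, ∑ i, ρ i x = 1 := fun x => by
    rw [← finsum_eq_sum_of_fintype]
    exact ρ.sum_eq_one (Set.mem_univ x)
  obtain ⟨V, hV, hVK, hVo⟩ := exists_isometries_mem hH (fun i : t => hK i)
    (fun i => (1 - b i : H →L[ℂ] H).isClosed_ker)
    (insert 1 (Finset.univ.image fun i : t => 1 - b i))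
  have hbV : ∀ i : t, (1 - b i) * V i = 0 := fun i => ContinuousLinearMap.ext fun x => hVK i x
  -- The ranges of the `V i` are orthogonal, so square roots of a partition of unity combine them to
  -- an isometry. The orthogonality with respect to `1 - b i` makes the cross terms of `star (W x) *
  -- ((1 - b i) * W x)` vanish as well.
  let W : T → H →L[ℂ] H := fun x => ∑ i, ((√(ρ i x) : ℝ) : ℂ) • V i
  have hWc : Continuous W := by
    refine continuous_finsetSum _ fun i _ => ?_
    have := (ρ i).continuous
    fun_prop
  have hWW : ∀ x, ∀ u ∈ insert 1 (Finset.univ.image fun i : t => 1 - b i),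
      star (W x) * (u * W x) = ∑ i, ((ρ i x : ℝ) : ℂ) • (star (V i) * (u * V i)) := fun x u hu => by
    simp only [W, star_sum, star_smul, Finset.mul_sum, Finset.sum_mul, mul_smul_comm,
      smul_mul_assoc]
    refine Finset.sum_congr rfl fun i _ => ?_
    rw [Finset.sum_eq_single i]
    · rw [smul_smul]
      congr 1
      rw [RCLike.star_def, Complex.conj_ofReal, ← Complex.ofReal_mul,
        Real.mul_self_sqrt (ρ.nonneg i x)]
    · intro j _ hj
      rw [hVo j i hj u hu, smul_zero]
    · simp
  have hW1 : ∀ x, star (W x) * W x = 1 := fun x => by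
    have := hWW x 1 (Finset.mem_insert_self _ _)
    simp only [one_mul, hV] at this
    rw [this, ← Finset.sum_smul, ← Complex.ofReal_sum, hρ1, Complex.ofReal_one, one_smul]
  -- The range of `V i` lies in that of `b i`, so only the differences `b i - b k` and `b k - b x`
  -- contribute. They are at most `1 / 4` and `1 / 8` for the indices that are active at `x`.
  have hn : ∀ x, ‖star (W x) * ((1 - b x) * W x)‖ < 1 := fun x => by
    obtain ⟨k, hk⟩ : ∃ k, ρ k x ≠ 0 := by
      by_contra! h
      have := hρ1 x
      simp [h] at this
    have e : star (W x) * ((1 - b x) * W x) =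
        ∑ i, ((ρ i x : ℝ) : ℂ) • (star (V i) * ((b i - b k) * V i)) +
          star (W x) * (b k - b x) * W x := by
      have h1 : ∀ i : t, (b i - b k) * V i = (1 - b k) * V i := fun i => by
        have : b i - b k = (1 - b k) - (1 - b i) := by abel
        rw [this, sub_mul, hbV, sub_zero]
      simp only [h1]
      rw [← hWW x (1 - b k) (by simp), mul_assoc _ (b k - b x), ← mul_add, ← add_mul]
      congr 2
      abel
    have h1 : ‖∑ i, ((ρ i x : ℝ) : ℂ) • (star (V i) * ((b i - b k) * V i))‖ ≤ 1 / 4 := by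
      calc _ ≤ ∑ i, ρ i x * (1 / 4) := norm_sum_le_of_le _ fun i _ => ?_
        _ = 1 / 4 := by rw [← Finset.sum_mul, hρ1, one_mul]
      rw [norm_smul, Complex.norm_real, Real.norm_of_nonneg (ρ.nonneg i x)]
      by_cases hi : ρ i x = 0
      · rw [hi, zero_mul, zero_mul]
      · refine mul_le_mul_of_nonneg_left ?_ (ρ.nonneg i x)
        have hik : ‖b i - b k‖ ≤ 1 / 4 := by
          have e1 : b i - b k = (b x - b k) - (b x - b i) := by abel
          rw [e1]
          refine (norm_sub_le _ _).trans ?_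
          linarith [hρ' i x hi, hρ' k x hk]
        have hVi := norm_le_one_of_star_mul_self (hV i)
        rw [← mul_assoc]
        calc _ ≤ ‖star (V i)‖ * ‖b i - b k‖ * ‖V i‖ := norm_mul₃_le
          _ ≤ 1 * (1 / 4) * 1 := by rw [norm_star]; gcongr
          _ = 1 / 4 := by norm_num
    have h2 : ‖star (W x) * (b k - b x) * W x‖ ≤ 1 / 8 := by
      have hW := norm_le_one_of_star_mul_self (hW1 x)
      have hk' : ‖b k - b x‖ ≤ 1 / 8 := by
        rw [norm_sub_rev]
        exact (hρ' k x hk).le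
      calc _ ≤ ‖star (W x)‖ * ‖b k - b x‖ * ‖W x‖ := norm_mul₃_le
        _ ≤ 1 * (1 / 8) * 1 := by rw [norm_star]; gcongr
        _ = 1 / 8 := by norm_num
    rw [e]
    refine (norm_add_le _ _).trans_lt ?_
    linarith
  have hbb : ∀ x, star (b x * W x) * (b x * W x) = 1 - star (W x) * ((1 - b x) * W x) := fun x => by
    rw [star_mul, (hb x).isSelfAdjoint.star_eq, mul_assoc, ← mul_assoc (b x) (b x),
      (hb x).isIdempotentElem.eq, sub_mul, one_mul, mul_sub, hW1, sub_sub_cancel]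
  have hu : ∀ x, IsUnit (star (b x * W x) * (b x * W x)) := fun x => by
    rw [hbb]
    exact isUnit_one_sub_of_norm_lt_one (hn x)
  obtain ⟨a⟩ := exists_amplification hH
  -- `P x` is an isometry into the range of `b x`, but perhaps not onto it. The missing projection
  -- `b x - P x * star (P x)` is added by `absorb`, without any condition on its rank.
  let P : T → H →L[ℂ] H := fun x => polar (b x * W x)
  have hPc : Continuous P := continuous_polar (by fun_prop) hu
  have hP : ∀ x, star (P x) * P x = 1 := fun x => star_polar_mul_polar (hu x)
  have hbP : ∀ x, b x * P x = P x := fun x => by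
    simp only [P, polar]
    rw [← mul_assoc, ← mul_assoc, (hb x).isIdempotentElem.eq]
  have hPb : ∀ x, star (P x) * b x = star (P x) := fun x => by
    have := congrArg star (hbP x)
    rwa [star_mul, (hb x).isSelfAdjoint.star_eq] at this
  have hPP : ∀ x z, star (P x) * (P x * z) = z := fun x z => by rw [← mul_assoc, hP, one_mul]
  have hq : ∀ x, IsStarProjection (b x - P x * star (P x)) := fun x => by
    constructor
    · change (b x - P x * star (P x)) * (b x - P x * star (P x)) = b x - P x * star (P x)
      rw [mul_sub, sub_mul, sub_mul, (hb x).isIdempotentElem.eq, mul_assoc (P x), hPb,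
        ← mul_assoc (b x), hbP, mul_assoc (P x), hPP, sub_self, sub_zero]
    · change star (b x - P x * star (P x)) = b x - P x * star (P x)
      rw [star_sub, star_mul, star_star, (hb x).isSelfAdjoint.star_eq]
  refine ⟨fun x => a.absorb (b x - P x * star (P x)) (P x), ?_, fun x =>
    ⟨a.absorb_star_absorb (hq x) (hP x) ?_, ?_⟩⟩
  · have := map_continuous a.amp
    unfold Amplification.absorb Amplification.shift
    fun_prop
  · rw [sub_mul, hbP, mul_assoc, hP, mul_one, sub_self]
  · rw [a.absorb_mul_star (hq x), sub_add_cancel]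

end Projections

/-! ### Essentially indefinite symmetries -/

section Symmetries

variable {H : Type u} [NormedAddCommGroup H] [InnerProductSpace ℂ H] [CompleteSpace H]

variable (H) in
/-- The self-adjoint unitaries with both eigenspaces of infinite dimension. -/
def symmetries : Set (H →L[ℂ] H) := {s | IsSelfAdjoint s ∧ s * s = 1 ∧ EssIndefinite s}

variable (H) in
/-- The essentially indefinite self-adjoint invertible operators. -/
def indefiniteUnits : Set (H →L[ℂ] H) := {a | IsSelfAdjoint a ∧ IsUnit a ∧ EssIndefinite a}

theorem polar_mem_symmetries {a : H →L[ℂ] H} (ha : a ∈ indefiniteUnits H) :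
    polar a ∈ symmetries H := by
  obtain ⟨h1, h2, h3⟩ := ha
  have hs := isSelfAdjoint_polar h2 h1
  have hu := Unitary.star_mul_self_of_mem (polar_mem_unitary h2)
  rw [hs.star_eq] at hu
  refine ⟨hs, hu, ?_⟩
  rwa [← polar_mul_abs h2, (commute_polar_abs h2 h1).eq, essIndefinite_mul_iff (CFC.abs_nonneg a)
    (injective_of_isUnit (isUnit_abs h2)) (commute_polar_abs h2 h1).symm] at h3

theorem mem_unitary_of_mem_symmetries {s : H →L[ℂ] H} (hs : s ∈ symmetries H) :
    s ∈ unitary (H →L[ℂ] H) := by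
  obtain ⟨h1, h2, -⟩ := hs
  rw [Unitary.mem_iff, h1.star_eq]
  exact ⟨h2, h2⟩

theorem isUnit_of_mem_symmetries {s : H →L[ℂ] H} (hs : s ∈ symmetries H) : IsUnit s :=
  ⟨⟨s, s, hs.2.1, hs.2.1⟩, rfl⟩

theorem mul_mem_indefiniteUnits {s p : H →L[ℂ] H} (hs : s ∈ symmetries H) (hp : 0 ≤ p)
    (hu : IsUnit p) (hc : Commute s p) : s * p ∈ indefiniteUnits H := by
  refine ⟨?_, (isUnit_of_mem_symmetries hs).mul hu, ?_⟩
  · change star (s * p) = s * p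
    rw [star_mul, hs.1.star_eq, hp.isSelfAdjoint.star_eq, hc.eq]
  · rw [hc.eq, essIndefinite_mul_iff hp (injective_of_isUnit hu) hc.symm]
    exact hs.2.2

theorem neg_mem_symmetries {s : H →L[ℂ] H} (hs : s ∈ symmetries H) : -s ∈ symmetries H :=
  ⟨hs.1.neg, by rw [neg_mul_neg, hs.2.1], hs.2.2.neg⟩

/-- The projection onto the `-1` eigenspace. -/
def negProj (s : H →L[ℂ] H) : H →L[ℂ] H := (2⁻¹ : ℂ) • (1 - s)

theorem isStarProjection_negProj {s : H →L[ℂ] H} (hs : s ∈ symmetries H) :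
    IsStarProjection (negProj s) := by
  constructor
  · change (2⁻¹ : ℂ) • (1 - s) * (2⁻¹ : ℂ) • (1 - s) = (2⁻¹ : ℂ) • (1 - s)
    rw [smul_mul_smul_comm]
    simp only [mul_sub, sub_mul, one_mul, hs.2.1, mul_one]
    module
  · change star ((2⁻¹ : ℂ) • (1 - s)) = (2⁻¹ : ℂ) • (1 - s)
    rw [star_smul, star_sub, star_one, hs.1.star_eq]
    simp

theorem mul_negProj {s : H →L[ℂ] H} (hs : s ∈ symmetries H) : s * negProj s = -negProj s := by
  rw [negProj, mul_smul_comm, mul_sub, mul_one, hs.2.1, ← smul_neg, neg_sub]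

theorem negProj_neg (s : H →L[ℂ] H) : negProj (-s) = 1 - negProj s := by
  unfold negProj
  module

/-- On the orthogonal complement of the `-1` eigenspace the form of `s` is the squared norm, so a
finite-dimensional eigenspace would make `s` essentially nonnegative. -/
theorem not_finiteDimensional_ker {s : H →L[ℂ] H} (hs : s ∈ symmetries H) :
    ¬ FiniteDimensional ℂ (LinearMap.ker (1 - negProj s : H →L[ℂ] H).toLinearMap) := by
  intro h
  refine hs.2.2.1 ⟨_, h, fun x hx => ?_⟩
  have h1 : negProj s x ∈ LinearMap.ker (1 - negProj s : H →L[ℂ] H).toLinearMap := by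
    change negProj s x - negProj s (negProj s x) = 0
    have : negProj s (negProj s x) = negProj s x :=
      congrArg (fun z : H →L[ℂ] H => z x) (isStarProjection_negProj hs).isIdempotentElem.eq
    rw [this, sub_self]
  have h2 := (Submodule.mem_orthogonal _ _).1 hx _ h1
  have h3 : s x = x - (2 : ℂ) • negProj s x := by
    change s x = x - (2 : ℂ) • ((2⁻¹ : ℂ) • (x - s x))
    module
  rw [h3, inner_sub_left, inner_smul_left, h2, mul_zero, sub_zero]
  exact inner_self_nonneg (𝕜 := ℂ)

/-- On the infinite-dimensional negative eigenspace of its polar part, `a` equals `-|a|`, and `|a|`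
is bounded below. -/
theorem exists_isometry_inner_le [TopologicalSpace.SeparableSpace H]
    (hH : ¬ FiniteDimensional ℂ H) {a : H →L[ℂ] H} (ha : a ∈ indefiniteUnits H) :
    ∃ W : H →L[ℂ] H, star W * W = 1 ∧ ∃ ε > 0, ∀ x, (⟪a (W x), W x⟫_ℂ).re ≤ -(ε * ‖x‖ ^ 2) := by
  have hs := polar_mem_symmetries ha
  obtain ⟨V, hV, hVK, -⟩ := exists_isometries_mem hH (ι := Unit)
    (fun _ => not_finiteDimensional_ker hs)
    (fun _ => (1 - negProj (polar a) : H →L[ℂ] H).isClosed_ker) ∅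
  obtain ⟨ε, hε, h⟩ := exists_le_re_inner (CFC.abs_nonneg a) (isUnit_abs ha.2.1)
  refine ⟨V (), hV (), ε, hε, fun x => ?_⟩
  have h1 : negProj (polar a) (V () x) = V () x := (sub_eq_zero.1 (hVK () x)).symm
  have h2 : polar a (V () x) = -V () x := by
    conv_lhs => rw [← h1]
    have := congrArg (fun z : H →L[ℂ] H => z (V () x)) (mul_negProj hs)
    change polar a (negProj (polar a) (V () x)) = -(negProj (polar a) (V () x)) at this
    rw [this, h1]
  have h3 : a (V () x) = -(CFC.abs a (V () x)) := by
    have := congrArg (fun z : H →L[ℂ] H => z (V () x))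
      ((commute_polar_abs ha.2.1 ha.1).symm.eq.trans (polar_mul_abs ha.2.1))
    change CFC.abs a (polar a (V () x)) = a (V () x) at this
    rw [← this, h2, map_neg]
  have hn : ‖V () x‖ = ‖x‖ := by
    have := (ContinuousLinearMap.norm_map_iff_adjoint_comp_self (V ())).2 (hV ())
    exact this x
  rw [h3, inner_neg_left, Complex.neg_re, ← hn]
  exact neg_le_neg (h _)

theorem not_essNonneg_of_inner_le (hH : ¬ FiniteDimensional ℂ H) {a W : H →L[ℂ] H} {ε : ℝ}
    (hε : 0 < ε) (h : ∀ x, (⟪a (W x), W x⟫_ℂ).re ≤ -(ε * ‖x‖ ^ 2)) : ¬ EssNonneg a := fun ha => by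
  refine not_essNonneg_of_neg hH (fun x hx => ?_) (ha.conj (star W))
  rw [inner_conj_apply, star_star]
  refine (h x).trans_lt (neg_neg_of_pos ?_)
  have := norm_pos_iff.2 hx
  positivity

theorem neg_mem_indefiniteUnits {a : H →L[ℂ] H} (ha : a ∈ indefiniteUnits H) :
    -a ∈ indefiniteUnits H := ⟨ha.1.neg, ha.2.1.neg, ha.2.2.neg⟩

/-- The form of `a` on the range of `W` is negative with margin `ε`, and a perturbation of norm
below `ε / 2` uses up at most half of it. Applied to `a` and `-a`, this gives the local convexity of
`indefiniteUnits`. -/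
theorem exists_ball_not_essNonneg [TopologicalSpace.SeparableSpace H]
    (hH : ¬ FiniteDimensional ℂ H) {a : H →L[ℂ] H} (ha : a ∈ indefiniteUnits H) :
    ∃ r > 0, ∀ c, ‖c - a‖ < r → ¬ EssNonneg c := by
  obtain ⟨W, hW, ε, hε, h⟩ := exists_isometry_inner_le hH ha
  refine ⟨ε / 2, by positivity, fun c hc =>
    not_essNonneg_of_inner_le hH (W := W) (ε := ε / 2) (by positivity) fun x => ?_⟩
  have hn : ‖W x‖ = ‖x‖ := (ContinuousLinearMap.norm_map_iff_adjoint_comp_self W).2 hW x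
  have h1 : ⟪c (W x), W x⟫_ℂ = ⟪a (W x), W x⟫_ℂ + ⟪(c - a) (W x), W x⟫_ℂ := by
    rw [← inner_add_left, sub_apply, add_sub_cancel]
  have h2 : (⟪(c - a) (W x), W x⟫_ℂ).re ≤ ε / 2 * ‖x‖ ^ 2 := by
    refine (Complex.re_le_norm _).trans ((norm_inner_le_norm _ _).trans ?_)
    have := (c - a).le_opNorm (W x)
    rw [hn] at this ⊢
    nlinarith [norm_nonneg x, norm_nonneg ((c - a) (W x)),
      mul_le_mul_of_nonneg_right hc.le (sq_nonneg ‖x‖)]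
  rw [h1, Complex.add_re]
  linarith [h x]

theorem not_essNonneg_neg_one (hH : ¬ FiniteDimensional ℂ H) :
    ¬ EssNonneg (-1 : H →L[ℂ] H) :=
  not_essNonneg_of_inner_le hH (W := 1) one_pos fun x => by
    change (⟪-x, x⟫_ℂ).re ≤ _
    rw [inner_neg_left, Complex.neg_re, one_mul]
    exact neg_le_neg (inner_self_eq_norm_sq (𝕜 := ℂ) x).ge

theorem exists_symmetry [TopologicalSpace.SeparableSpace H] (hH : ¬ FiniteDimensional ℂ H)
    (a : Amplification H) : a.head * star a.head - a.tail * star a.tail ∈ symmetries H := by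
  refine ⟨?_, ?_, ?_, ?_⟩
  · change star _ = _
    simp
  · simp only [mul_sub, sub_mul, mul_assoc, a.head_star_head', a.tail_star_tail',
      a.head_star_tail', a.tail_star_head', mul_zero, sub_zero, zero_sub, sub_neg_eq_add]
    exact a.head_add_tail
  · intro h
    have := h.conj (star a.tail)
    refine not_essNonneg_neg_one hH ?_
    simpa only [star_star, mul_sub, sub_mul, mul_assoc, a.tail_star_tail', a.tail_star_head',
        a.tail_star_tail, mul_zero, zero_sub, neg_mul] using this
  · intro h
    have := h.conj (star a.head)
    refine not_essNonneg_neg_one hH ?_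
    simpa only [star_star, mul_sub, sub_mul, mul_assoc, a.head_star_head', a.head_star_tail',
        a.head_star_head, mul_zero, sub_zero, neg_sub, zero_sub, mul_neg, neg_mul] using this

theorem conj_mem_symmetries {s v : H →L[ℂ] H} (hs : s ∈ symmetries H)
    (hv : v ∈ unitary (H →L[ℂ] H)) : v * s * star v ∈ symmetries H := by
  have hv' := Unitary.star_mul_self_of_mem hv
  have hv'' := Unitary.mul_star_self_of_mem hv
  refine ⟨hs.1.conjugate v, ?_, ?_⟩
  · simp only [mul_assoc]
    rw [← mul_assoc (star v) v, hv', one_mul, ← mul_assoc s, hs.2.1, one_mul, hv'']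
  · rw [essIndefinite_conj_iff (injective_of_isUnit ⟨⟨v, star v, hv'', hv'⟩, rfl⟩)]
    exact hs.2.2

/-- Both eigenprojections depend continuously on the symmetry and have infinite rank, so they are
the range projections of continuous families of isometries `U` and `V`. Together these identify the
eigenspaces with the ranges of `a.tail` and `a.head`. -/
theorem exists_unitary_conj [TopologicalSpace.SeparableSpace H] (hH : ¬ FiniteDimensional ℂ H)
    (a : Amplification H) {T : Type*} [TopologicalSpace T] [CompactSpace T] [T2Space T]
    (f : C(T, symmetries H)) : ∃ v : C(T, unitary (H →L[ℂ] H)), ∀ x, (f x : H →L[ℂ] H) =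
      v x * (a.head * star a.head - a.tail * star a.tail) * star (v x : H →L[ℂ] H) := by
  have hf : Continuous fun x => (f x : H →L[ℂ] H) := by fun_prop
  have hb : Continuous fun x => negProj (f x : H →L[ℂ] H) := by unfold negProj; fun_prop
  obtain ⟨U, hUc, hU⟩ := exists_isometry_family hH hb
    (fun x => isStarProjection_negProj (f x).2) fun x => not_finiteDimensional_ker (f x).2
  obtain ⟨V, hVc, hV⟩ := exists_isometry_family hH (b := fun x => 1 - negProj (f x : H →L[ℂ] H))
    (by fun_prop) (fun x => (isStarProjection_negProj (f x).2).one_sub) fun x => by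
      have := not_finiteDimensional_ker (neg_mem_symmetries (f x).2)
      rwa [negProj_neg] at this
  have hbb : ∀ x, negProj (f x : H →L[ℂ] H) * (1 - negProj (f x : H →L[ℂ] H)) = 0 := fun x => by
    rw [mul_sub, mul_one, (isStarProjection_negProj (f x).2).isIdempotentElem.eq, sub_self]
  have hUV : ∀ x, star (U x) * V x = 0 := fun x => by
    have h1 : star (U x) * V x = star (U x) * (U x * star (U x)) *
        (V x * star (V x) * V x) := by
      simp only [mul_assoc]
      rw [(hV x).1, mul_one, ← mul_assoc (star (U x)) (U x), (hU x).1, one_mul]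
    rw [h1, (hU x).2, (hV x).2, mul_assoc, ← mul_assoc (negProj _), hbb, zero_mul, mul_zero]
  have hVU : ∀ x, star (V x) * U x = 0 := fun x => by
    have := congrArg star (hUV x)
    rwa [star_mul, star_star, star_zero] at this
  let v : T → H →L[ℂ] H := fun x => V x * star a.head + U x * star a.tail
  have hsv : ∀ x, star (v x) = a.head * star (V x) + a.tail * star (U x) := fun x => by simp [v]
  have hv : ∀ x, v x ∈ unitary (H →L[ℂ] H) := fun x => by
    rw [Unitary.mem_iff, hsv]
    constructor
    · have e1 : star (V x) * (V x * star a.head) = star a.head := by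
        rw [← mul_assoc, (hV x).1, one_mul]
      have e2 : star (U x) * (U x * star a.tail) = star a.tail := by
        rw [← mul_assoc, (hU x).1, one_mul]
      have e3 : star (V x) * (U x * star a.tail) = 0 := by rw [← mul_assoc, hVU, zero_mul]
      have e4 : star (U x) * (V x * star a.head) = 0 := by rw [← mul_assoc, hUV, zero_mul]
      simp only [v, mul_add, add_mul, mul_assoc, e1, e2, e3, e4, mul_zero, add_zero, zero_add]
      exact a.head_add_tail
    · simp only [v, mul_add, add_mul, mul_assoc, a.head_star_head', a.tail_star_tail',
        a.head_star_tail', a.tail_star_head', mul_zero, add_zero, zero_add, (hU x).2, (hV x).2]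
      abel
  refine ⟨⟨fun x => ⟨v x, hv x⟩, by fun_prop⟩, fun x => ?_⟩
  change (f x : H →L[ℂ] H) = v x * _ * star (v x)
  rw [hsv]
  simp only [v, mul_add, add_mul, mul_sub, sub_mul, mul_assoc, a.head_star_head',
    a.tail_star_tail', a.head_star_tail', a.tail_star_head', mul_zero, add_zero, zero_add,
    sub_zero, zero_sub, (hU x).2, (hV x).2]
  unfold negProj
  module

variable [TopologicalSpace.SeparableSpace H]

/-- The symmetries are not locally convex, so the criterion for compact families is applied to this
larger space. A compact family moves to its polar part, which factors through the contractible
unitary group. -/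
theorem contractibleSpace_indefiniteUnits (hH : ¬ FiniteDimensional ℂ H) :
    ContractibleSpace (indefiniteUnits H) := by
  obtain ⟨a⟩ := exists_amplification hH
  set s₀ := a.head * star a.head - a.tail * star a.tail with hs₀
  have hs₀' : s₀ ∈ symmetries H := exists_symmetry hH a
  have hsub : ∀ s ∈ symmetries H, s ∈ indefiniteUnits H := fun s hs => by
    simpa using mul_mem_indefiniteUnits hs zero_le_one isUnit_one (Commute.one_right s)
  let _ : NormedSpace ℝ (H →L[ℂ] H) := NormedSpace.restrictScalars ℝ ℂ _
  refine contractibleSpace_of_compactlyContractible ⟨s₀, hsub _ hs₀'⟩ (fun x hx => ?_)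
    fun T _ _ _ f => ?_
  · obtain ⟨r₁, hr₁, h₁⟩ := Metric.isOpen_iff.1 Units.isOpen x hx.2.1
    obtain ⟨r₂, hr₂, h₂⟩ := exists_ball_not_essNonneg hH hx
    obtain ⟨r₃, hr₃, h₃⟩ := exists_ball_not_essNonneg hH (neg_mem_indefiniteUnits hx)
    refine ⟨min r₁ (min r₂ r₃), by positivity, ?_⟩
    have hsa : Convex ℝ {c : H →L[ℂ] H | IsSelfAdjoint c} := fun c hc d hd s t _ _ _ =>
      (IsSelfAdjoint.smul (IsSelfAdjoint.all s) hc).add (IsSelfAdjoint.smul (.all t) hd)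
    intro c hc
    have hc1 : IsSelfAdjoint c := convexHull_min (fun d hd => hd.1.1) hsa hc
    have hc2 : c ∈ Metric.ball x _ := convexHull_min Set.inter_subset_right (convex_ball x _) hc
    rw [Metric.mem_ball, lt_min_iff, lt_min_iff] at hc2
    obtain ⟨k₁, k₂, k₃⟩ := hc2
    rw [dist_eq_norm] at k₂ k₃
    refine ⟨hc1, h₁ k₁, h₂ _ k₂, h₃ _ ?_⟩
    rwa [← neg_sub', norm_neg]
  · have hf : Continuous fun x => (f x : H →L[ℂ] H) := by fun_prop
    have hp : Continuous fun x => polar (f x : H →L[ℂ] H) :=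
      continuous_polar hf fun x => (f x).2.2.1.star.mul (f x).2.2.1
    let g : C(T, symmetries H) :=
      ⟨fun x => ⟨polar (f x), polar_mem_symmetries (f x).2⟩, by fun_prop⟩
    have ha := continuous_abs hf
    -- The absolute value slides linearly to `1`, remaining positive, invertible and in the
    -- commutant of the polar part.
    let F : I × T → H →L[ℂ] H := fun q => polar (f q.2 : H →L[ℂ] H) *
      (((1 - q.1 : ℝ) : ℂ) • CFC.abs (f q.2 : H →L[ℂ] H) + ((q.1 : ℝ) : ℂ) • 1)
    have hFc : Continuous F := by
      have h1 : Continuous fun q : I × T => polar (f q.2 : H →L[ℂ] H) := hp.comp continuous_snd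
      have h2 : Continuous fun q : I × T => CFC.abs (f q.2 : H →L[ℂ] H) := ha.comp continuous_snd
      fun_prop
    have hF : ∀ q, F q ∈ indefiniteUnits H := fun q => by
      obtain ⟨t, x⟩ := q
      have h0 : (0 : H →L[ℂ] H) ≤ ((1 - t : ℝ) : ℂ) • CFC.abs (f x : H →L[ℂ] H) :=
        smul_nonneg (by exact_mod_cast sub_nonneg.2 t.2.2) (CFC.abs_nonneg _)
      have h1 : (0 : H →L[ℂ] H) ≤ ((t : ℝ) : ℂ) • 1 :=
        smul_nonneg (by exact_mod_cast t.2.1) zero_le_one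
      refine mul_mem_indefiniteUnits (polar_mem_symmetries (f x).2) (add_nonneg h0 h1) ?_
        ((commute_polar_abs (f x).2.2.1 (f x).2.1).smul_right _ |>.add_right
          ((Commute.one_right _).smul_right _))
      rcases eq_or_lt_of_le t.2.1 with h | h
      · rw [← h]
        simpa using isUnit_abs (f x).2.2.1
      · refine CStarAlgebra.isUnit_of_le (((t : ℝ) : ℂ) • (1 : H →L[ℂ] H)) (le_add_of_nonneg_left h0) ?_
        refine IsStrictlyPositive.iff_of_unital.2 ⟨h1, ?_⟩
        have ht : ((t : ℝ) : ℂ) ≠ 0 := by exact_mod_cast h.ne'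
        exact (isUnit_one.smul (Units.mk0 _ ht))
    let i : C(symmetries H, indefiniteUnits H) :=
      ⟨fun s => ⟨s, hsub s s.2⟩, by fun_prop⟩
    have h1 : f.Homotopic (i.comp g) := ⟨⟨⟨fun q => ⟨F q, hF q⟩, by fun_prop⟩, fun x => by
      apply Subtype.ext
      change polar (f x : H →L[ℂ] H) * (((1 - (0 : I) : ℝ) : ℂ) • CFC.abs (f x : H →L[ℂ] H) +
        (((0 : I) : ℝ) : ℂ) • 1) = f x
      simp [polar_mul_abs (f x).2.2.1], fun x => by
      apply Subtype.ext
      change polar (f x : H →L[ℂ] H) * (((1 - (1 : I) : ℝ) : ℂ) • CFC.abs (f x : H →L[ℂ] H) +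
        (((1 : I) : ℝ) : ℂ) • 1) = polar (f x : H →L[ℂ] H)
      simp⟩⟩
    obtain ⟨v, hv⟩ := exists_unitary_conj hH a g
    let c : C(unitary (H →L[ℂ] H), symmetries H) :=
      ⟨fun w => ⟨w * s₀ * star (w : H →L[ℂ] H), conj_mem_symmetries hs₀' w.2⟩, by fun_prop⟩
    have hg : g = c.comp v := by
      ext1 x
      exact Subtype.ext (hv x)
    have := contractibleSpace_unitary hH
    have h2 : (i.comp g).Nullhomotopic := by
      rw [hg]
      exact (((id_nullhomotopic (unitary (H →L[ℂ] H))).comp_right c).comp_left v).comp_right i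
    obtain ⟨z, hz⟩ := h2
    exact ⟨z, h1.trans hz⟩

theorem contractibleSpace_symmetries (hH : ¬ FiniteDimensional ℂ H) :
    ContractibleSpace (symmetries H) := by
  have hsub : ∀ s ∈ symmetries H, s ∈ indefiniteUnits H := fun s hs => by
    simpa using mul_mem_indefiniteUnits hs zero_le_one isUnit_one (Commute.one_right s)
  have hp : Continuous fun x : indefiniteUnits H => polar (x : H →L[ℂ] H) :=
    continuous_polar continuous_subtype_val fun x => x.2.2.1.star.mul x.2.2.1
  refine contractibleSpace_of_homotopic (Z := indefiniteUnits H)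
    ⟨fun s => ⟨s, hsub s s.2⟩, by fun_prop⟩
    ⟨fun a => ⟨polar a, polar_mem_symmetries a.2⟩, by fun_prop⟩ ?_
    (contractibleSpace_indefiniteUnits hH)
  exact ⟨⟨⟨fun q => q.2, by fun_prop⟩, fun s => Subtype.ext
    (polar_of_mem_unitary (mem_unitary_of_mem_symmetries s.2)).symm, fun g => rfl⟩⟩

end Symmetries

/-! ### Compact operators -/

section Compact

variable {H : Type u} [NormedAddCommGroup H] [InnerProductSpace ℂ H] [CompleteSpace H]

theorem isCompactOperator_rankOne (x y : H) :
    IsCompactOperator (InnerProductSpace.rankOne ℂ x y) := by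
  have := isCompactOperator_of_locallyCompactSpace_rng (ContinuousLinearMap.toSpanSingleton ℂ x)
  exact this.comp_clm (innerSL ℂ y)

theorem hasSum_apply {ι : Type*} {f : ι → H →L[ℂ] H} {K : H →L[ℂ] H} (h : HasSum f K) (x : H) :
    HasSum (fun i => f i x) (K x) := by
  let φ : (H →L[ℂ] H) →+ H := AddMonoidHom.mk' (fun T => T x) fun _ _ => rfl
  have hφ : Continuous φ := by
    change Continuous fun T : H →L[ℂ] H => T x
    fun_prop
  exact h.map φ hφ

/-- The diagonal operator with eigenvalues `2 ^ (-(n + 1))` will do; their sum bounds its norm by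
one. -/
theorem exists_compact_nonneg [TopologicalSpace.SeparableSpace H] (hH : ¬ FiniteDimensional ℂ H) :
    ∃ K : H →L[ℂ] H, 0 ≤ K ∧ Function.Injective K ∧ IsCompactOperator K ∧ ‖K‖ ≤ 1 := by
  obtain ⟨b⟩ := exists_hilbertBasis_nat hH
  let c : ℕ → ℝ := fun n => (1 / 2) / 2 ^ n
  have hc : HasSum c 1 := hasSum_geometric_two' 1
  have hc0 : ∀ n, 0 < c n := fun n => by positivity
  let f : ℕ → H →L[ℂ] H := fun n => ((c n : ℝ) : ℂ) • InnerProductSpace.rankOne ℂ (b n) (b n)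
  have hfn : ∀ n, ‖f n‖ ≤ c n := fun n => by
    have : ‖b n‖ = 1 := b.orthonormal.1 n
    simp only [f, norm_smul, Complex.norm_real, InnerProductSpace.norm_rankOne, this, mul_one]
    exact (abs_of_pos (hc0 n)).le
  obtain ⟨K, hK⟩ : Summable f := Summable.of_norm_bounded hc.summable hfn
  have hpos : ∀ n, 0 ≤ f n := fun n => by
    refine smul_nonneg (by exact_mod_cast (hc0 n).le) ?_
    exact (InnerProductSpace.isStarProjection_rankOne_self (b.orthonormal.1 n)).nonneg
  refine ⟨K, ?_, ?_, ?_, ?_⟩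
  · exact (CStarAlgebra.isClosed_nonneg (A := H →L[ℂ] H)).mem_of_tendsto hK
      (.of_forall fun s => Finset.sum_nonneg fun n _ => hpos n)
  · rw [injective_iff_map_eq_zero]
    intro x hx
    have h1 : ∀ m, ⟪b m, x⟫_ℂ = 0 := fun m => by
      have h2 : HasSum (fun n => ⟪b m, f n x⟫_ℂ) ⟪b m, K x⟫_ℂ :=
        (innerSL ℂ (b m)).hasSum (hasSum_apply hK x)
      have h3 := h2.unique (hasSum_single m fun n hn => by
        have : ⟪b m, b n⟫_ℂ = 0 := b.orthonormal.2 hn.symm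
        change ⟪b m, ((c n : ℝ) : ℂ) • ⟪b n, x⟫_ℂ • b n⟫_ℂ = 0
        rw [inner_smul_right, inner_smul_right, this, mul_zero, mul_zero])
      have h4 : ⟪b m, b m⟫_ℂ = 1 := by
        rw [inner_self_eq_norm_sq_to_K, b.orthonormal.1 m]
        simp
      have h5 : ⟪b m, f m x⟫_ℂ = (c m : ℂ) * ⟪b m, x⟫_ℂ := by
        change ⟪b m, ((c m : ℝ) : ℂ) • ⟪b m, x⟫_ℂ • b m⟫_ℂ = _
        rw [inner_smul_right, inner_smul_right, h4, mul_one]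
      rw [hx, inner_zero_right, h5] at h3
      exact (mul_eq_zero.1 h3.symm).resolve_left (by exact_mod_cast (hc0 m).ne')
    apply b.repr.injective
    rw [map_zero]
    ext m
    rw [b.repr_apply_apply, h1]
    rfl
  · exact isClosed_setOfPred_isCompactOperator.mem_of_tendsto hK
      (.of_forall fun s => (compactOperator (RingHom.id ℂ) H H).sum_mem
        fun n _ => (isCompactOperator_rankOne _ _).smul _)
  · rw [← hK.tsum_eq]
    exact tsum_of_norm_bounded hc hfn

/-- A bounded strongly continuous family, composed with a compact operator, is norm continuous. -/
theorem continuous_mul_of_isCompactOperator {X : Type*} [TopologicalSpace X] {S : X → H →L[ℂ] H}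
    (hS : ∀ y, Continuous fun x => S x y) (hS1 : ∀ x, ‖S x‖ ≤ 1) {K : H →L[ℂ] H}
    (hK : IsCompactOperator K) : Continuous fun x => S x * K := by
  rw [continuous_iff_continuousAt]
  intro x₀
  rw [ContinuousAt, Metric.tendsto_nhds]
  intro ε hε
  have hc := hK.isCompact_closure_image_closedBall (f := (K : H →ₗ[ℂ] H)) 1
  -- A finite net suffices because `K` maps the unit ball to a relatively compact set. The three
  -- terms of the estimate contribute `ε / 6` each.
  obtain ⟨t, -, ht⟩ := hc.elim_finite_subcover_image (b := Set.univ)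
    (c := fun y => Metric.ball y (ε / 6)) (fun _ _ => Metric.isOpen_ball)
    (fun y _ => Set.mem_biUnion (Set.mem_univ y) (Metric.mem_ball_self (by positivity)))
  obtain ⟨hfin, ht⟩ := ht
  have h : ∀ᶠ x in 𝓝 x₀, ∀ y ∈ t, dist (S x y) (S x₀ y) < ε / 6 :=
    (Filter.eventually_all_finite hfin).2 fun y _ =>
      Metric.tendsto_nhds.1 (hS y).continuousAt _ (by positivity)
  filter_upwards [h] with x hx
  rw [dist_eq_norm]
  refine lt_of_le_of_lt (ContinuousLinearMap.opNorm_le_of_unit_norm (C := ε / 2)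
    (by positivity) fun z hz => ?_) (half_lt_self hε)
  have hz' : K z ∈ closure ((K : H →ₗ[ℂ] H) '' Metric.closedBall 0 1) :=
    subset_closure ⟨z, by simp [hz], rfl⟩
  obtain ⟨y, hy, hzy⟩ := Set.mem_iUnion₂.1 (ht hz')
  rw [Metric.mem_ball, dist_eq_norm] at hzy
  change ‖S x (K z) - S x₀ (K z)‖ ≤ ε / 2
  have e : S x (K z) - S x₀ (K z) = S x (K z - y) + (S x y - S x₀ y) - S x₀ (K z - y) := by
    rw [map_sub, map_sub]
    abel
  have n1 : ∀ x, ‖S x (K z - y)‖ ≤ ‖K z - y‖ := fun x => by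
    simpa using (S x).le_of_opNorm_le (hS1 x) (K z - y)
  have n2 := hx y hy
  rw [dist_eq_norm] at n2
  rw [e]
  refine (norm_sub_le _ _).trans ?_
  have := norm_add_le (S x (K z - y)) (S x y - S x₀ y)
  linarith [n1 x, n1 x₀]

end Compact

/-! ### Translations of the half-line -/

section Translation

open MeasureTheory

/-- The square integrable functions on the line. -/
abbrev LineL2 : Type := Lp ℂ 2 (volume : Measure ℝ)

/-- Translation of square integrable functions. -/
def lineTranslation (t : ℝ) : LineL2 →ₗᵢ[ℂ] LineL2 :=
  Lp.compMeasurePreservingₗᵢ ℂ (fun x => t + x) (measurePreserving_add_left volume t)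

theorem lineTranslation_ae (t : ℝ) (f : LineL2) :
    lineTranslation t f =ᵐ[volume] fun x => f (t + x) :=
  Lp.coeFn_compMeasurePreserving f (measurePreserving_add_left volume t)

theorem lineTranslation_add (s t : ℝ) (f : LineL2) :
    lineTranslation s (lineTranslation t f) = lineTranslation (s + t) f := by
  apply Lp.ext
  have h := (measurePreserving_add_left volume s).quasiMeasurePreserving.ae (lineTranslation_ae t f)
  filter_upwards [lineTranslation_ae s (lineTranslation t f), lineTranslation_ae (s + t) f, h]
    with x h1 h2 h3
  rw [h1, h2, h3]
  congr 1
  ring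

theorem lineTranslation_zero (f : LineL2) : lineTranslation 0 f = f := by
  apply Lp.ext
  filter_upwards [lineTranslation_ae 0 f] with x h
  rw [h, zero_add]

theorem continuous_lineTranslation (f : LineL2) : Continuous fun t => lineTranslation t f := by
  have : Fact ((2 : ENNReal) ≠ ⊤) := ⟨by norm_num⟩
  have h : Continuous fun t : ℝ => DomAddAct.mk t +ᵥ f := by fun_prop
  exact h

theorem inner_lineTranslation (t : ℝ) (f g : LineL2) :
    ⟪lineTranslation t f, g⟫_ℂ = ⟪f, lineTranslation (-t) g⟫_ℂ := by
  rw [← (lineTranslation (-t)).inner_map_map, lineTranslation_add, neg_add_cancel,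
    lineTranslation_zero]

/-- The functions supported in the half-line. -/
def halfLine : Submodule ℂ LineL2 :=
  LinearMap.ker (LpToLpRestrictCLM ℝ ℂ ℂ volume 2 (Set.Iio 0)).toLinearMap

theorem isClosed_halfLine : IsClosed (halfLine : Set LineL2) :=
  (LpToLpRestrictCLM ℝ ℂ ℂ volume 2 (Set.Iio 0)).isClosed_ker

instance : CompleteSpace halfLine := isClosed_halfLine.completeSpace_coe

theorem mem_halfLine {f : LineL2} : f ∈ halfLine ↔ ∀ᵐ x : ℝ, x < 0 → f x = 0 := by
  have h := LpToLpRestrictCLM_coeFn ℂ (μ := volume) (p := 2) (Set.Iio (0 : ℝ)) f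
  change LpToLpRestrictCLM ℝ ℂ ℂ volume 2 (Set.Iio 0) f = 0 ↔ _
  rw [Lp.eq_zero_iff_ae_eq_zero]
  change _ ↔ ∀ᵐ x : ℝ, x ∈ Set.Iio (0 : ℝ) → f x = 0
  rw [← ae_restrict_iff' measurableSet_Iio]
  constructor
  · intro h'
    filter_upwards [h, h'] with x h1 h2
    rw [← h1, h2]
    rfl
  · intro h'
    filter_upwards [h, h'] with x h1 h2
    rw [h1, h2]
    rfl

theorem inner_eq_zero_of_mem_halfLine {f g : LineL2} (hf : f ∈ halfLine)
    (hg : ∀ᵐ x : ℝ, 0 ≤ x → g x = 0) : ⟪f, g⟫_ℂ = 0 := by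
  rw [L2.inner_def]
  refine integral_eq_zero_of_ae ?_
  filter_upwards [mem_halfLine.1 hf, hg] with x h1 h2
  rcases lt_or_ge x 0 with h | h
  · simp [h1 h]
  · simp [h2 h]

theorem lineTranslation_mem_halfLine {t : ℝ} (ht : t ≤ 0) {f : LineL2} (hf : f ∈ halfLine) :
    lineTranslation t f ∈ halfLine := by
  rw [mem_halfLine] at hf ⊢
  have h := (measurePreserving_add_left volume t).quasiMeasurePreserving.ae hf
  filter_upwards [lineTranslation_ae t f, h] with x h1 h2 hx
  rw [h1, h2 (by linarith)]

/-- Translation by `t`, compressed to the half-line. -/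
def halfTranslation (t : ℝ) : halfLine →L[ℂ] halfLine :=
  (ContinuousLinearMap.adjoint halfLine.subtypeL).comp
    ((lineTranslation (-t)).toContinuousLinearMap.comp halfLine.subtypeL)

theorem star_halfTranslation (t : ℝ) : star (halfTranslation t) = halfTranslation (-t) := by
  ext1 x
  refine ext_inner_right ℂ fun y => ?_
  rw [ContinuousLinearMap.star_eq_adjoint, ContinuousLinearMap.adjoint_inner_left]
  change ⟪x, ContinuousLinearMap.adjoint halfLine.subtypeL (lineTranslation (-t) y)⟫_ℂ =
    ⟪ContinuousLinearMap.adjoint halfLine.subtypeL (lineTranslation (-(-t)) x), y⟫_ℂ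
  rw [ContinuousLinearMap.adjoint_inner_right, ContinuousLinearMap.adjoint_inner_left]
  exact (inner_lineTranslation _ _ _).symm ▸ by rw [neg_neg]; rfl

theorem continuous_halfTranslation (x : halfLine) : Continuous fun t => halfTranslation t x :=
  (ContinuousLinearMap.adjoint halfLine.subtypeL).continuous.comp
    ((continuous_lineTranslation x).comp continuous_neg)

theorem adjoint_subtypeL_apply (x : halfLine) :
    ContinuousLinearMap.adjoint halfLine.subtypeL (x : LineL2) = x := by
  refine ext_inner_right ℂ fun y => ?_
  rw [ContinuousLinearMap.adjoint_inner_left]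
  rfl

theorem coe_halfTranslation {t : ℝ} (ht : 0 ≤ t) (x : halfLine) :
    (halfTranslation t x : LineL2) = lineTranslation (-t) x := by
  have := adjoint_subtypeL_apply ⟨_, lineTranslation_mem_halfLine (neg_nonpos.2 ht) x.2⟩
  exact congrArg Subtype.val this

theorem norm_halfTranslation {t : ℝ} (ht : 0 ≤ t) (x : halfLine) :
    ‖halfTranslation t x‖ = ‖x‖ := by
  change ‖(halfTranslation t x : LineL2)‖ = ‖(x : LineL2)‖
  rw [coe_halfTranslation ht, LinearIsometry.norm_map]

theorem halfTranslation_zero : halfTranslation 0 = 1 := by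
  ext1 x
  apply Subtype.ext
  rw [coe_halfTranslation le_rfl, neg_zero, lineTranslation_zero]
  rfl

theorem tendsto_star_halfTranslation (x : halfLine) :
    Filter.Tendsto (fun t => star (halfTranslation t) x) Filter.atTop (𝓝 0) := by
  rw [Metric.tendsto_atTop]
  intro ε hε
  obtain ⟨g, hgs, hgn, -, hg⟩ := (Lp.memLp (x : LineL2)).exists_hasCompactSupport_eLpNorm_sub_le
    (by norm_num) (ε := ENNReal.ofReal (ε / 2)) (by simpa using hε)
  obtain ⟨R, hR⟩ := hgs.isCompact.bddAbove
  have hd : ‖(x : LineL2) - hg.toLp g‖ ≤ ε / 2 := by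
    rw [← Lp.toLp_coeFn (x : LineL2) (Lp.memLp _), ← MemLp.toLp_sub, Lp.norm_toLp]
    exact ENNReal.toReal_le_of_le_ofReal (by positivity) hgn
  refine ⟨R + 1, fun t ht => ?_⟩
  -- Once `t` exceeds the support of `g`, the translate vanishes on the half-line, so the
  -- compression annihilates it.
  have e1 : ContinuousLinearMap.adjoint halfLine.subtypeL (lineTranslation t (hg.toLp g)) = 0 := by
    refine ext_inner_left ℂ fun y => ?_
    rw [ContinuousLinearMap.adjoint_inner_right, inner_zero_right]
    refine inner_eq_zero_of_mem_halfLine y.2 ?_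
    have h := (measurePreserving_add_left volume t).quasiMeasurePreserving.ae hg.coeFn_toLp
    filter_upwards [lineTranslation_ae t (hg.toLp g), h] with z h1 h2 hz
    rw [h1, h2]
    by_contra h3
    have := hR (subset_tsupport g h3)
    linarith
  have e2 : star (halfTranslation t) x =
      ContinuousLinearMap.adjoint halfLine.subtypeL
        (lineTranslation t ((x : LineL2) - hg.toLp g)) := by
    rw [star_halfTranslation, map_sub, map_sub, e1, sub_zero]
    change ContinuousLinearMap.adjoint halfLine.subtypeL (lineTranslation (-(-t)) x) = _
    rw [neg_neg]
  rw [dist_zero_right, e2]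
  have hn : ‖ContinuousLinearMap.adjoint halfLine.subtypeL‖ ≤ 1 := by
    rw [LinearIsometryEquiv.norm_map]
    exact halfLine.norm_subtypeL_le
  calc _ ≤ 1 * ‖lineTranslation t ((x : LineL2) - hg.toLp g)‖ :=
        ContinuousLinearMap.le_of_opNorm_le _ hn _
    _ ≤ ε / 2 := by rwa [one_mul, LinearIsometry.norm_map]
    _ < ε := half_lt_self hε

/-- In finite dimension the isometric translations would be unitary, so their adjoints would
preserve norms instead of tending strongly to zero. -/
theorem not_finiteDimensional_halfLine : ¬ FiniteDimensional ℂ halfLine := by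
  intro h
  have hs : ∀ t, 0 ≤ t → ∀ x : halfLine, ‖star (halfTranslation t) x‖ = ‖x‖ := fun t ht x => by
    have hinj : Function.Injective (halfTranslation t).toLinearMap := by
      rw [injective_iff_map_eq_zero]
      intro y hy
      rw [← norm_eq_zero, ← norm_halfTranslation ht y]
      exact norm_eq_zero.2 hy
    obtain ⟨y, rfl⟩ := (LinearMap.injective_iff_surjective.1 hinj) x
    have := star_mul_self_eq_one (norm_halfTranslation ht)
    have h' : star (halfTranslation t) (halfTranslation t y) = y :=
      congrArg (fun z : halfLine →L[ℂ] halfLine => z y) this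
    change ‖star (halfTranslation t) (halfTranslation t y)‖ = ‖halfTranslation t y‖
    rw [h', norm_halfTranslation ht]
  have h0 : ∀ x : halfLine, x = 0 := fun x => by
    have h1 := (tendsto_star_halfTranslation x).norm
    have h2 : Filter.Tendsto (fun t : ℝ => ‖star (halfTranslation t) x‖) Filter.atTop (𝓝 ‖x‖) :=
      tendsto_const_nhds.congr' ((Filter.eventually_ge_atTop 0).mono fun t ht => (hs t ht x).symm)
    have := tendsto_nhds_unique h1 h2
    rw [norm_zero] at this
    exact norm_eq_zero.1 this.symm
  let f : LineL2 := indicatorConstLp 2 (measurableSet_Icc (a := (0 : ℝ)) (b := 1)) (by simp) 1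
  have hf : f ∈ halfLine := mem_halfLine.2 <| by
    filter_upwards [indicatorConstLp_coeFn (p := 2) (μ := volume)
      (hs := measurableSet_Icc (a := (0 : ℝ)) (b := 1)) (hμs := by simp) (c := (1 : ℂ))] with x hx hx0
    rw [hx, Set.indicator_of_notMem]
    exact fun h => absurd h.1 (not_le.2 hx0)
  have hf0 : f = 0 := congrArg Subtype.val (h0 ⟨f, hf⟩)
  have hn : ‖f‖ = 1 := by
    simp only [f]
    rw [norm_indicatorConstLp (by norm_num) (by norm_num)]
    simp
  rw [hf0, norm_zero] at hn
  exact zero_ne_one hn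

end Translation

/-! ### Contraction of spaces of injective operators -/

section Contraction

variable {H : Type u} [NormedAddCommGroup H] [InnerProductSpace ℂ H] [CompleteSpace H]

/-- These are the translations of the half-line, carried over to `H`. The last property says that
their ranges escape to infinity. -/
theorem exists_isometry_semigroup [TopologicalSpace.SeparableSpace H]
    (hH : ¬ FiniteDimensional ℂ H) :
    ∃ v : ℝ → H →L[ℂ] H, v 0 = 1 ∧ (∀ t, 0 ≤ t → star (v t) * v t = 1) ∧
      (∀ x, Continuous fun t => v t x) ∧ (∀ x, Continuous fun t => star (v t) x) ∧
      ∀ x, Filter.Tendsto (fun t => star (v t) x) Filter.atTop (𝓝 0) := by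
  have : Fact ((2 : ENNReal) ≠ ⊤) := ⟨by norm_num⟩
  have : TopologicalSpace.SeparableSpace halfLine :=
    (TopologicalSpace.IsSeparable.of_separableSpace (halfLine : Set LineL2)).separableSpace
  obtain ⟨θ⟩ := nonempty_linearIsometryEquiv hH not_finiteDimensional_halfLine
  let v : ℝ → H →L[ℂ] H := fun t => (θ.symm.toContinuousLinearEquiv.toContinuousLinearMap.comp
    (halfTranslation t)).comp θ.toContinuousLinearEquiv.toContinuousLinearMap
  have hv : ∀ t x, v t x = θ.symm (halfTranslation t (θ x)) := fun t x => rfl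
  have hv' : ∀ t x, star (v t) x = θ.symm (star (halfTranslation t) (θ x)) := fun t x => by
    refine ext_inner_right ℂ fun y => ?_
    rw [ContinuousLinearMap.star_eq_adjoint, ContinuousLinearMap.adjoint_inner_left, hv,
      ← θ.inner_map_map, θ.apply_symm_apply, ← ContinuousLinearMap.adjoint_inner_left,
      ← θ.inner_map_map (θ.symm _), θ.apply_symm_apply]
    rfl
  refine ⟨v, ?_, fun t ht => star_mul_self_eq_one fun x => ?_, fun x => ?_, fun x => ?_,
    fun x => ?_⟩
  · ext x
    rw [hv, halfTranslation_zero]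
    exact θ.symm_apply_apply x
  · rw [hv, θ.symm.norm_map, norm_halfTranslation ht, θ.norm_map]
  · simp only [hv]
    exact θ.symm.continuous.comp (continuous_halfTranslation _)
  · simp only [hv', star_halfTranslation]
    exact θ.symm.continuous.comp ((continuous_halfTranslation _).comp continuous_neg)
  · simp only [hv']
    have := (θ.symm.continuous.tendsto 0).comp (tendsto_star_halfTranslation (θ x))
    rwa [map_zero] at this

/-- The representation of bounded operators on the sum of two copies of the space. -/
def Amplification.diag (a : Amplification H) : (H →L[ℂ] H) →⋆ₐ[ℂ] (H →L[ℂ] H) where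
  toFun y := a.head * y * star a.head + a.tail * y * star a.tail
  map_one' := by rw [mul_one, mul_one, a.head_add_tail]
  map_mul' x y := by
    simp only [mul_add, add_mul, mul_assoc, a.head_star_head', a.tail_star_tail',
      a.head_star_tail', a.tail_star_head', mul_zero, add_zero, zero_add]
  map_zero' := by simp
  map_add' x y := by
    simp only [mul_add, add_mul]
    abel
  commutes' r := by
    simp only [Algebra.algebraMap_eq_smul_one, mul_smul_comm, smul_mul_assoc, mul_one]
    rw [← smul_add, a.head_add_tail]
  map_star' x := by simp [mul_assoc]

theorem Amplification.diag_apply (a : Amplification H) (y : H →L[ℂ] H) :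
    a.diag y = a.head * y * star a.head + a.tail * y * star a.tail := rfl

theorem Amplification.commute_diag (a : Amplification H) (y : H →L[ℂ] H) :
    Commute (a.diag y) (a.head * star a.head - a.tail * star a.tail) := by
  change _ * _ = _ * _
  simp only [a.diag_apply, mul_add, add_mul, mul_sub, sub_mul, mul_assoc, a.head_star_head',
    a.tail_star_tail', a.head_star_tail', a.tail_star_head', mul_zero, add_zero, zero_add,
    zero_sub, sub_zero]
  abel

theorem Amplification.injective_diag (a : Amplification H) {y : H →L[ℂ] H}
    (hy : Function.Injective y) : Function.Injective (a.diag y) := by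
  rw [injective_iff_map_eq_zero] at hy ⊢
  intro x hx
  have h1 : star a.head * a.diag y = y * star a.head := by
    simp only [a.diag_apply, mul_add, mul_assoc, a.head_star_head', a.head_star_tail', add_zero]
  have h2 : star a.tail * a.diag y = y * star a.tail := by
    simp only [a.diag_apply, mul_add, mul_assoc, a.tail_star_tail', a.tail_star_head', zero_add]
  have k1 : star a.head x = 0 := hy _ <| by
    have := congrArg (fun z : H →L[ℂ] H => z x) h1
    change star a.head (a.diag y x) = y (star a.head x) at this
    rw [← this, hx, map_zero]
  have k2 : star a.tail x = 0 := hy _ <| by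
    have := congrArg (fun z : H →L[ℂ] H => z x) h2
    change star a.tail (a.diag y x) = y (star a.tail x) at this
    rw [← this, hx, map_zero]
  have := congrArg (fun z : H →L[ℂ] H => z x) a.head_add_tail
  change a.head (star a.head x) + a.tail (star a.tail x) = x at this
  rw [← this, k1, k2, map_zero, map_zero, add_zero]

variable (H) in
/-- A positive compact operator, a strongly continuous family of isometries that pushes the space
to infinity, and a symmetry commuting with everything. -/
structure ContractionData where
  /-- the compact operator -/
  K : H →L[ℂ] H
  /-- the isometries -/
  v : ℝ → H →L[ℂ] H
  /-- the symmetry -/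
  J : H →L[ℂ] H
  nonneg : 0 ≤ K
  injective : Function.Injective K
  isCompactOperator : IsCompactOperator K
  norm_le : ‖K‖ ≤ 1
  v_zero : v 0 = 1
  star_v_mul_v : ∀ t, 0 ≤ t → star (v t) * v t = 1
  continuous_v : ∀ x, Continuous fun t => v t x
  continuous_star_v : ∀ x, Continuous fun t => star (v t) x
  tendsto_star_v : ∀ x, Filter.Tendsto (fun t => star (v t) x) Filter.atTop (𝓝 0)
  J_mem : J ∈ symmetries H
  commute_K : Commute K J
  commute_v : ∀ t, Commute (v t) J

theorem isCompactOperator_mul_left {K : H →L[ℂ] H} (h : IsCompactOperator K) (T : H →L[ℂ] H) :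
    IsCompactOperator ⇑(T * K) := h.clm_comp T

theorem isCompactOperator_mul_right {K : H →L[ℂ] H} (h : IsCompactOperator K) (T : H →L[ℂ] H) :
    IsCompactOperator ⇑(K * T) := h.comp_clm T

theorem exists_contractionData [TopologicalSpace.SeparableSpace H]
    (hH : ¬ FiniteDimensional ℂ H) : Nonempty (ContractionData H) := by
  obtain ⟨a⟩ := exists_amplification hH
  obtain ⟨K, hK0, hKi, hKc, hK1⟩ := exists_compact_nonneg hH
  obtain ⟨v, hv0, hv1, hvc, hvs, hvt⟩ := exists_isometry_semigroup hH
  have hd : ∀ y x, a.diag y x = a.head (y (star a.head x)) + a.tail (y (star a.tail x)) :=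
    fun y x => rfl
  -- Taking two copies of `K` and of the isometries provides a symmetry that commutes with all of
  -- them, namely the one that is `1` on the first copy and `-1` on the second.
  exact ⟨{
    K := a.diag K
    v := fun t => a.diag (v t)
    J := a.head * star a.head - a.tail * star a.tail
    nonneg := map_nonneg a.diag hK0
    injective := a.injective_diag hKi
    isCompactOperator := by
      rw [a.diag_apply]
      exact (isCompactOperator_mul_right (isCompactOperator_mul_left hKc a.head) _).add
        (isCompactOperator_mul_right (isCompactOperator_mul_left hKc a.tail) _)
    norm_le := (NonUnitalStarAlgHom.norm_apply_le a.diag K).trans hK1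
    v_zero := by rw [hv0, map_one]
    star_v_mul_v := fun t ht => by rw [← map_star, ← map_mul, hv1 t ht, map_one]
    continuous_v := fun x => by
      simp only [hd]
      exact (a.head.continuous.comp (hvc _)).add (a.tail.continuous.comp (hvc _))
    continuous_star_v := fun x => by
      simp only [← map_star, hd]
      exact (a.head.continuous.comp (hvs _)).add (a.tail.continuous.comp (hvs _))
    tendsto_star_v := fun x => by
      simp only [← map_star, hd]
      have := (((a.head.continuous.tendsto 0).comp (hvt (star a.head x))).add
        ((a.tail.continuous.tendsto 0).comp (hvt (star a.tail x))))
      simpa using this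
    J_mem := exists_symmetry hH a
    commute_K := a.commute_diag K
    commute_v := fun t => a.commute_diag (v t) }⟩

/-! ### The norm continuous path from `K B K` to `K S K`. -/

namespace ContractionData

variable (D : ContractionData H)

theorem star_K : star D.K = D.K := D.nonneg.isSelfAdjoint.star_eq

/-- The isometries, with parameter in the unit interval. -/
def isom (r : I) : H →L[ℂ] H := D.v (r / (1 - r))

theorem div_nonneg (r : I) : 0 ≤ (r : ℝ) / (1 - r) :=
  _root_.div_nonneg r.2.1 (sub_nonneg.2 r.2.2)

theorem star_isom_mul_isom (r : I) : star (D.isom r) * D.isom r = 1 :=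
  D.star_v_mul_v _ (div_nonneg r)

/-- The range projections of the isometries. -/
def rangeProj (r : I) : H →L[ℂ] H := if r = 1 then 0 else D.isom r * star (D.isom r)

theorem norm_rangeProj_le (r : I) : ‖D.rangeProj r‖ ≤ 1 := by
  unfold rangeProj
  split_ifs
  · simp
  · have := norm_le_one_of_star_mul_self (D.star_isom_mul_isom r)
    refine (norm_mul_le _ _).trans ?_
    rw [norm_star]
    exact mul_le_one₀ this (norm_nonneg _) this

theorem star_rangeProj (r : I) : star (D.rangeProj r) = D.rangeProj r := by
  unfold rangeProj
  split_ifs <;> simp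

theorem continuousAt_div {r : I} (hr : r ≠ 1) : ContinuousAt (fun r : I => (r : ℝ) / (1 - r)) r := by
  have h : (1 : ℝ) - r ≠ 0 := fun h => hr (Subtype.ext (sub_eq_zero.1 h).symm)
  have : ContinuousAt (fun r : I => (r : ℝ)) r := continuous_subtype_val.continuousAt
  exact this.div (by fun_prop) h

/-- At `r = 1` the parameter `r / (1 - r)` tends to infinity and the adjoints of the isometries tend
strongly to zero. Strong continuity is enough, since only products with the compact `K` are used. -/
theorem continuous_rangeProj (x : H) : Continuous fun r => D.rangeProj r x := by
  rw [continuous_iff_continuousAt]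
  intro r
  by_cases hr : r = 1
  · subst hr
    have h0 : D.rangeProj 1 x = 0 := by simp [rangeProj]
    have hb : ∀ r : I, r ≠ 1 → ‖D.rangeProj r x‖ ≤ ‖star (D.isom r) x‖ := fun r hr => by
      rw [rangeProj, if_neg hr]
      have := norm_le_one_of_star_mul_self (D.star_isom_mul_isom r)
      simpa using (D.isom r).le_of_opNorm_le this (star (D.isom r) x)
    rw [ContinuousAt, h0, tendsto_zero_iff_norm_tendsto_zero, ← nhdsNE_sup_pure,
      Filter.tendsto_sup]
    constructor
    · have ht : Filter.Tendsto (fun r : I => (r : ℝ) / (1 - r)) (𝓝[≠] 1) Filter.atTop := by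
        have h1 : Filter.Tendsto (fun r : I => (r : ℝ)) (𝓝[≠] 1) (𝓝 1) :=
          (continuous_subtype_val.tendsto (1 : I)).mono_left nhdsWithin_le_nhds
        have h2 : Filter.Tendsto (fun r : I => (1 : ℝ) - r) (𝓝[≠] 1) (𝓝[>] 0) := by
          rw [tendsto_nhdsWithin_iff]
          refine ⟨by simpa using h1.const_sub 1, ?_⟩
          filter_upwards [self_mem_nhdsWithin] with r hr
          exact sub_pos.2 (lt_of_le_of_ne r.2.2 fun h => hr (Subtype.ext h))
        simp only [div_eq_mul_inv]
        exact h1.pos_mul_atTop one_pos (tendsto_inv_nhdsGT_zero.comp h2)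
      refine squeeze_zero' (.of_forall fun _ => norm_nonneg _)
        (eventually_nhdsWithin_of_forall hb) ?_
      have := ((D.tendsto_star_v x).comp ht).norm
      rwa [norm_zero] at this
    · rw [Filter.tendsto_pure_left]
      intro s hs
      rw [h0, norm_zero]
      exact mem_of_mem_nhds hs
  · have hne : ∀ᶠ s in 𝓝 r, s ≠ 1 := isOpen_ne.mem_nhds hr
    have e : (fun s => D.rangeProj s x) =ᶠ[𝓝 r] fun s => D.isom s (star (D.isom s) x) := by
      filter_upwards [hne] with s hs
      rw [rangeProj, if_neg hs]
      rfl
    refine ContinuousAt.congr ?_ e.symm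
    have h1 : ContinuousAt (fun s => star (D.isom s) x) r :=
      (D.continuous_star_v x).continuousAt.comp (continuousAt_div hr)
    have h2 : ContinuousAt (fun s => D.isom s (star (D.isom r) x)) r :=
      (D.continuous_v (star (D.isom r) x)).continuousAt.comp (continuousAt_div hr)
    have h3 : Filter.Tendsto (fun s => D.isom s (star (D.isom s) x - star (D.isom r) x))
        (𝓝 r) (𝓝 0) := by
      refine squeeze_zero_norm (a := fun s => ‖star (D.isom s) x - star (D.isom r) x‖)
        (fun s => ?_) ?_
      · have := norm_le_one_of_star_mul_self (D.star_isom_mul_isom s)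
        simpa using (D.isom s).le_of_opNorm_le this (star (D.isom s) x - star (D.isom r) x)
      · have := (h1.sub_const (star (D.isom r) x)).norm
        simpa using this
    have h4 := h3.add h2
    rw [zero_add] at h4
    refine h4.congr fun s => ?_
    rw [← map_add, sub_add_cancel]

/-- The part of the contraction on the range of the isometry. -/
def inner (r : I) : H →L[ℂ] H := ((1 - r : ℝ) : ℂ) • (D.isom r * D.K)

/-- The part of the contraction on the orthogonal complement of the range of the isometry. -/
def outer (r : I) : H →L[ℂ] H := (1 - D.rangeProj r) * D.K

theorem continuous_outer : Continuous D.outer := by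
  have := continuous_mul_of_isCompactOperator D.continuous_rangeProj D.norm_rangeProj_le
    D.isCompactOperator
  unfold outer
  simp only [sub_mul]
  fun_prop

/-- Away from `r = 1`, compactness of `K` upgrades the strong continuity of the isometries. At `r =
1`, where `D.isom` has only the default value coming from division by zero, the factor `1 - r` takes
over. -/
theorem continuous_inner : Continuous D.inner := by
  have hv := continuous_mul_of_isCompactOperator (X := {t : ℝ // 0 ≤ t}) (S := fun t => D.v t)
    (fun y => (D.continuous_v y).comp continuous_subtype_val)
    (fun t => norm_le_one_of_star_mul_self (D.star_v_mul_v t t.2)) D.isCompactOperator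
  rw [continuous_iff_continuousAt]
  intro r
  by_cases hr : r = 1
  · subst hr
    have h0 : D.inner 1 = 0 := by simp [inner]
    rw [ContinuousAt, h0]
    refine squeeze_zero_norm (a := fun s : I => (1 - s : ℝ)) (fun s => ?_) ?_
    · have h1 := norm_le_one_of_star_mul_self (D.star_isom_mul_isom s)
      have h2 : (0 : ℝ) ≤ 1 - s := sub_nonneg.2 s.2.2
      rw [inner, norm_smul, Complex.norm_real, Real.norm_of_nonneg h2]
      have : ‖D.isom s * D.K‖ ≤ 1 :=
        (norm_mul_le _ _).trans (mul_le_one₀ h1 (norm_nonneg _) D.norm_le)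
      nlinarith
    · have : Continuous fun s : I => (1 - s : ℝ) := by fun_prop
      simpa using this.tendsto 1
  · have h1 : ContinuousAt (fun s : I => (⟨(s : ℝ) / (1 - s), div_nonneg s⟩ : {t : ℝ // 0 ≤ t})) r :=
      (continuousAt_div hr).codRestrict fun s => div_nonneg s
    have h2 : ContinuousAt (fun s : I => D.isom s * D.K) r :=
      ContinuousAt.comp (g := fun t : {t : ℝ // 0 ≤ t} => D.v t * D.K) hv.continuousAt h1
    have h3 : ContinuousAt (fun s : I => ((1 - s : ℝ) : ℂ)) r := by fun_prop
    exact h3.smul h2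

theorem inner_zero : D.inner 0 = D.K := by simp [inner, isom, D.v_zero]

theorem inner_one : D.inner 1 = 0 := by simp [inner]

theorem outer_zero : D.outer 0 = 0 := by simp [outer, rangeProj, isom, D.v_zero]

theorem outer_one : D.outer 1 = D.K := by simp [outer, rangeProj]

theorem star_isom_mul_outer {r : I} (hr : r ≠ 1) : star (D.isom r) * D.outer r = 0 := by
  rw [outer, rangeProj, if_neg hr, ← mul_assoc, mul_sub, mul_one, ← mul_assoc,
    D.star_isom_mul_isom, one_mul, sub_self, zero_mul]

theorem star_isom_mul_inner (r : I) : star (D.isom r) * D.inner r = ((1 - r : ℝ) : ℂ) • D.K := by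
  rw [inner, mul_smul_comm, ← mul_assoc, D.star_isom_mul_isom, one_mul]

theorem injective_star_isom_mul_inner {r : I} (hr : r ≠ 1) :
    Function.Injective (star (D.isom r) * D.inner r) := by
  have h : ((1 - r : ℝ) : ℂ) ≠ 0 := by
    norm_cast
    exact fun h => hr (Subtype.ext (sub_eq_zero.1 h).symm)
  rw [D.star_isom_mul_inner]
  exact fun x y hxy => D.injective (smul_right_injective H h hxy)

theorem commute_outer_star {S : H →L[ℂ] H} (hS : IsSelfAdjoint S) (hK : Commute D.K S)
    (hv : ∀ t, Commute (D.v t) S) (r : I) : Commute (D.outer r) S := by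
  have h : Commute (D.rangeProj r) S := by
    unfold rangeProj isom
    split_ifs
    · exact Commute.zero_left _
    · have : Commute (star (D.v (r / (1 - r)))) S := by
        have := (hv (r / (1 - r))).star_star
        rwa [hS.star_eq] at this
      exact (hv _).mul_left this
  exact ((Commute.one_left _).sub_left h).mul_left hK

/-- The contraction of the operator `B`. -/
def contraction (S : H →L[ℂ] H) (r : I) (B : H →L[ℂ] H) : H →L[ℂ] H :=
  D.inner r * B * star (D.inner r) + D.outer r * S * star (D.outer r)

theorem eq_zero_of_star_mul {p : H →L[ℂ] H} {x : H} (h : (p * star p) x = 0) : star p x = 0 := by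
  have h1 : ⟪star p x, star p x⟫_ℂ = 0 := by
    rw [← ContinuousLinearMap.adjoint_inner_right]
    change ⟪x, (star (star p)) (star p x)⟫_ℂ = 0
    rw [star_star]
    change ⟪x, (p * star p) x⟫_ℂ = 0
    rw [h, inner_zero_right]
  exact inner_self_eq_zero.1 h1

theorem eq_zero_of_outer {S : H →L[ℂ] H} (hS : Function.Injective S) (hSs : IsSelfAdjoint S)
    (hK : Commute D.K S) (hv : ∀ t, Commute (D.v t) S) {r : I} {x : H}
    (hx : (D.outer r * S * star (D.outer r)) x = 0) : x = D.rangeProj r x := by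
  rw [(D.commute_outer_star hSs hK hv r).eq, mul_assoc] at hx
  have h1 : (D.outer r * star (D.outer r)) x = 0 := hS (hx.trans (map_zero S).symm)
  have h2 := eq_zero_of_star_mul h1
  rw [outer, star_mul, D.star_K, star_sub, star_one, D.star_rangeProj] at h2
  have h3 : (1 - D.rangeProj r) x = 0 := D.injective (h2.trans (map_zero D.K).symm)
  exact sub_eq_zero.1 h3

/-- The operator `star (D.isom r)` annihilates the outer term, so injectivity of `K` and `B` shows
that `x` is orthogonal to the range of `D.isom r`. Then the inner term vanishes at `x`, and by
`eq_zero_of_outer` the outer term forces `x` into that same range. -/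
theorem injective_contraction {S B : H →L[ℂ] H} (hS : Function.Injective S)
    (hSs : IsSelfAdjoint S) (hK : Commute D.K S) (hv : ∀ t, Commute (D.v t) S)
    (hB : Function.Injective B) (r : I) : Function.Injective (D.contraction S r B) := by
  rw [injective_iff_map_eq_zero]
  intro x hx
  by_cases hr : r = 1
  · subst hr
    have h : (D.outer 1 * S * star (D.outer 1)) x = 0 := by
      rw [contraction, D.inner_one] at hx
      simpa using hx
    rw [D.eq_zero_of_outer hS hSs hK hv h]
    simp [rangeProj]
  · have e : star (D.isom r) * D.contraction S r B =
        star (D.isom r) * D.inner r * B * star (D.inner r) := by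
      rw [contraction, mul_add, mul_assoc (D.outer r), ← mul_assoc _ (D.outer r),
        D.star_isom_mul_outer hr, zero_mul, add_zero]
      simp only [mul_assoc]
    have h1 : (star (D.isom r) * D.inner r) (B (star (D.inner r) x)) = 0 := by
      have := congrArg (fun z : H →L[ℂ] H => z x) e
      change star (D.isom r) (D.contraction S r B x) = _ at this
      rw [hx, map_zero] at this
      exact this.symm
    have h2 : star (D.inner r) x = 0 :=
      hB ((D.injective_star_isom_mul_inner hr (h1.trans (map_zero _).symm)).trans (map_zero B).symm)
    have h3 : star (D.isom r) x = 0 := by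
      have hr' : (star ((1 - r : ℝ) : ℂ)) ≠ 0 := by
        rw [star_ne_zero]
        norm_cast
        exact fun h => hr (Subtype.ext (sub_eq_zero.1 h).symm)
      rw [inner, star_smul, star_mul, D.star_K] at h2
      exact D.injective (((smul_eq_zero.1 h2).resolve_left hr').trans (map_zero D.K).symm)
    have h4 : (D.outer r * S * star (D.outer r)) x = 0 := by
      have : (D.inner r) (B (star (D.inner r) x)) + (D.outer r * S * star (D.outer r)) x = 0 := hx
      rwa [h2, map_zero, map_zero, zero_add] at this
    rw [D.eq_zero_of_outer hS hSs hK hv h4, rangeProj, if_neg hr]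
    change D.isom r (star (D.isom r) x) = 0
    rw [h3, map_zero]

theorem star_contraction {S : H →L[ℂ] H} (hS : IsSelfAdjoint S) (r : I) (B : H →L[ℂ] H) :
    star (D.contraction S r B) = D.contraction S r (star B) := by
  simp [contraction, hS.star_eq, mul_assoc]

theorem isCompactOperator_contraction (S : H →L[ℂ] H) (r : I) (B : H →L[ℂ] H) :
    IsCompactOperator (D.contraction S r B) := by
  have h1 : IsCompactOperator (D.inner r) :=
    (isCompactOperator_mul_left D.isCompactOperator _).smul _
  have h2 : IsCompactOperator (D.outer r) := isCompactOperator_mul_left D.isCompactOperator _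
  exact (isCompactOperator_mul_right (isCompactOperator_mul_right h1 B) _).add
    (isCompactOperator_mul_right (isCompactOperator_mul_right h2 S) _)

theorem norm_contraction_le (S : H →L[ℂ] H) (r : I) (B : H →L[ℂ] H) :
    ‖D.contraction S r B‖ ≤ ‖B‖ + ‖S‖ := by
  have h1 : ‖D.inner r‖ ≤ 1 := by
    have h1 := norm_le_one_of_star_mul_self (D.star_isom_mul_isom r)
    have h2 : (0 : ℝ) ≤ 1 - r := sub_nonneg.2 r.2.2
    rw [inner, norm_smul, Complex.norm_real, Real.norm_of_nonneg h2]
    refine mul_le_one₀ (by linarith [r.2.1]) (norm_nonneg _)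
      ((norm_mul_le _ _).trans (mul_le_one₀ h1 (norm_nonneg _) D.norm_le))
  have h2 : ‖D.outer r‖ ≤ 1 := by
    refine (norm_mul_le _ _).trans (mul_le_one₀ ?_ (norm_nonneg _) D.norm_le)
    unfold rangeProj
    split_ifs
    · rw [sub_zero]
      exact norm_one_le
    · refine IsStarProjection.norm_le _ (IsStarProjection.one_sub ⟨?_, ?_⟩)
      · change D.isom r * star (D.isom r) * (D.isom r * star (D.isom r)) = _
        rw [mul_assoc, ← mul_assoc (star _), D.star_isom_mul_isom, one_mul]
      · change star (D.isom r * star (D.isom r)) = _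
        rw [star_mul, star_star]
  refine (norm_add_le _ _).trans (add_le_add ?_ ?_)
  · calc _ ≤ ‖D.inner r‖ * ‖B‖ * ‖star (D.inner r)‖ := norm_mul₃_le
      _ ≤ 1 * ‖B‖ * 1 := by rw [norm_star]; gcongr
      _ = ‖B‖ := by ring
  · calc _ ≤ ‖D.outer r‖ * ‖S‖ * ‖star (D.outer r)‖ := norm_mul₃_le
      _ ≤ 1 * ‖S‖ * 1 := by rw [norm_star]; gcongr
      _ = ‖S‖ := by ring

/-- The interpolation between the identity and the compact operator. -/
def interp (t : I) : H →L[ℂ] H := ((1 - t : ℝ) : ℂ) • 1 + ((t : ℝ) : ℂ) • D.K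

theorem interp_zero : D.interp 0 = 1 := by simp [interp]

theorem interp_one : D.interp 1 = D.K := by simp [interp]

theorem star_interp (t : I) : star (D.interp t) = D.interp t := by
  simp [interp, D.star_K]

theorem norm_interp_le (t : I) : ‖D.interp t‖ ≤ 1 := by
  have h1 : (0 : ℝ) ≤ 1 - t := sub_nonneg.2 t.2.2
  refine (norm_add_le _ _).trans ?_
  rw [norm_smul, norm_smul, Complex.norm_real, Complex.norm_real, Real.norm_of_nonneg h1,
    Real.norm_of_nonneg t.2.1]
  nlinarith [norm_one_le (H := H), D.norm_le, t.2.1]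

theorem continuous_interp : Continuous D.interp := by
  unfold interp
  fun_prop

theorem injective_interp (t : I) : Function.Injective (D.interp t) := by
  rcases eq_or_ne t 1 with rfl | ht
  · rw [D.interp_one]
    exact D.injective
  rw [injective_iff_map_eq_zero]
  intro x hx
  have h1 : (0 : ℝ) < 1 - t := sub_pos.2 (lt_of_le_of_ne t.2.2 fun h => ht (Subtype.ext h))
  have h2 : 0 ≤ (⟪D.K x, x⟫_ℂ).re :=
    ((ContinuousLinearMap.nonneg_iff_isPositive _).1 D.nonneg).re_inner_nonneg_left x
  have h3 : (⟪D.interp t x, x⟫_ℂ).re = (1 - t) * ‖x‖ ^ 2 + t * (⟪D.K x, x⟫_ℂ).re := by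
    change (⟪((1 - t : ℝ) : ℂ) • x + ((t : ℝ) : ℂ) • D.K x, x⟫_ℂ).re = _
    rw [inner_add_left, inner_smul_left, inner_smul_left, Complex.add_re, Complex.conj_ofReal,
      Complex.conj_ofReal, Complex.re_ofReal_mul, Complex.re_ofReal_mul,
      inner_self_eq_norm_sq_to_K]
    norm_cast
  rw [hx, inner_zero_left, Complex.zero_re] at h3
  have h4 : ‖x‖ ^ 2 ≤ 0 := by
    by_contra h
    nlinarith [mul_nonneg t.2.1 h2, mul_pos h1 (not_le.1 h)]
  exact norm_eq_zero.1 (pow_eq_zero_iff two_ne_zero |>.1 (le_antisymm h4 (sq_nonneg _)))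

end ContractionData

/-- A class of operators that is stable under the contraction towards the operator `S`. -/
structure IsContractionClass (P : (H →L[ℂ] H) → Prop) (S : H →L[ℂ] H) : Prop where
  isSelfAdjoint : IsSelfAdjoint S
  injective : Function.Injective S
  norm_le : ‖S‖ ≤ 1
  base : P S
  sum : ∀ B κ p w : H →L[ℂ] H, w * p = 0 → Function.Injective ⇑(w * κ) → P B →
    P (κ * B * star κ + p * S * star p)

/-! ### Contractibility of the classes stable under the contraction. -/

namespace IsContractionClass

variable {P : (H →L[ℂ] H) → Prop} {S : H →L[ℂ] H}

theorem conj (h : IsContractionClass P S) {B T : H →L[ℂ] H} (hB : P B)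
    (hT : Function.Injective T) : P (T * B * star T) := by
  have := h.sum B T 0 1 (mul_zero _) (by rwa [one_mul]) hB
  simpa using this

theorem smul_conj (h : IsContractionClass P S) {B T : H →L[ℂ] H} (hB : P B)
    (hT : Function.Injective T) {s : ℝ} (hs : 0 < s) : P ((s : ℂ) • (T * B * star T)) := by
  have hs' : ((√s : ℝ) : ℂ) ≠ 0 := by exact_mod_cast (Real.sqrt_pos.2 hs).ne'
  have := h.conj (T := ((√s : ℝ) : ℂ) • T) hB fun x y hxy =>
    hT (smul_right_injective H hs' hxy)
  simpa [smul_smul, Real.mul_self_sqrt hs.le] using this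

theorem smul (h : IsContractionClass P S) {B : H →L[ℂ] H} (hB : P B) {s : ℝ} (hs : 0 < s) :
    P ((s : ℂ) • B) := by
  simpa using h.smul_conj (T := 1) hB Function.injective_id hs

/-- The witness `w` is `star (D.isom r)`, which kills the outer part and is injective after the
inner part. At `r = 1` no such witness is at hand, but only `K S K` is left. -/
theorem contraction (h : IsContractionClass P S) (D : ContractionData H) {B : H →L[ℂ] H}
    (hB : P B) {δ : ℝ} (hδ : 0 < δ) (r : I) : P (D.contraction ((δ : ℂ) • S) r B) := by
  by_cases hr : r = 1
  · subst hr
    have := h.conj (h.smul h.base hδ) D.injective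
    simpa [ContractionData.contraction, D.inner_one, D.outer_one] using this
  · have := h.sum B (D.inner r) (((√δ : ℝ) : ℂ) • D.outer r) (star (D.isom r))
      (by rw [mul_smul_comm, D.star_isom_mul_outer hr, smul_zero])
      (D.injective_star_isom_mul_inner hr) hB
    simpa [ContractionData.contraction, smul_smul, Real.mul_self_sqrt hδ.le] using this

/-- The homotopy `F` shrinks `B` to a multiple of `K B K`, from where `G` starts. `G` confines `B`
to a range that escapes to infinity and puts `S` on its complement, so at the end `B` has
disappeared. -/
theorem contractibleSpace (h : IsContractionClass P S) (D : ContractionData H)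
    (hK : Commute D.K S) (hv : ∀ t, Commute (D.v t) S) {l : ℝ} (hl : 0 ≤ l) (k : Prop) :
    ContractibleSpace {B : H →L[ℂ] H | Function.Injective B ∧ Function.Injective ⇑(star B) ∧
      l * ‖B‖ < 1 ∧ P B ∧ (k → IsCompactOperator B)} := by
  set Y : Set (H →L[ℂ] H) := {B : H →L[ℂ] H | Function.Injective B ∧
    Function.Injective ⇑(star B) ∧ l * ‖B‖ < 1 ∧ P B ∧ (k → IsCompactOperator B)} with hY
  have hl1 : 0 < l + 1 := by linarith
  -- With this scaling and with `δ` below, norms along `G` are at most `c B * ‖B‖ + δ ≤ (l + 1)⁻¹`,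
  -- and `l * (l + 1)⁻¹ < 1`.
  let c : (H →L[ℂ] H) → ℝ := fun B => (2 * (l + 1) * (‖B‖ + 1))⁻¹
  have hden : ∀ B : H →L[ℂ] H, 0 < 2 * (l + 1) * (‖B‖ + 1) := fun B => by positivity
  have hc0 : ∀ B, 0 < c B := fun B => inv_pos.2 (hden B)
  have hc1 : ∀ B, c B ≤ 1 := fun B => inv_le_one_of_one_le₀ (by nlinarith [norm_nonneg B])
  have hcB : ∀ B, c B * ‖B‖ ≤ (2 * (l + 1))⁻¹ := fun B => by
    simp only [c]
    rw [mul_inv, mul_assoc]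
    refine mul_le_of_le_one_right (by positivity) ?_
    rw [inv_mul_le_one₀ (by positivity)]
    linarith
  have hcc : Continuous c := by
    have : Continuous fun B : H →L[ℂ] H => 2 * (l + 1) * (‖B‖ + 1) := by fun_prop
    exact this.inv₀ fun B => (hden B).ne'
  let δ : ℝ := (2 * (l + 1))⁻¹
  have hδ : 0 < δ := by positivity
  have hinj : ∀ {T : H →L[ℂ] H} {s : ℝ}, 0 < s → Function.Injective T →
      Function.Injective ⇑((s : ℂ) • T) := fun {T s} hs hT x y hxy =>
    hT (smul_right_injective H (show (s : ℂ) ≠ 0 by exact_mod_cast hs.ne') hxy)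
  let s : I × Y → ℝ := fun p => (1 - p.1) + p.1 * c p.2
  have hs0 : ∀ p, 0 < s p := fun p => by
    have h1 : (0 : ℝ) ≤ 1 - p.1 := sub_nonneg.2 p.1.2.2
    have h2 : (0 : ℝ) ≤ p.1 := p.1.2.1
    have h3 := hc0 p.2
    rcases h2.eq_or_lt with h | h
    · simp only [s, ← h]
      norm_num
    · exact add_pos_of_nonneg_of_pos h1 (mul_pos h h3)
  have hs1 : ∀ p, s p ≤ 1 := fun p => by
    have h2 : (0 : ℝ) ≤ p.1 := p.1.2.1
    simp only [s]
    nlinarith [hc1 p.2]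
  let F : I × Y → Y := fun p => ⟨(s p : ℂ) • (D.interp p.1 * p.2 * star (D.interp p.1)), by
    obtain ⟨B, hB1, hB2, hB3, hB4, hB5⟩ := p.2
    have hi := D.injective_interp p.1
    have hi' : Function.Injective ⇑(star (D.interp p.1)) := by rwa [D.star_interp]
    refine ⟨hinj (hs0 p) (hi.comp (hB1.comp hi')), ?_, ?_, h.smul_conj hB4 hi (hs0 p), fun hk => ?_⟩
    · have : star ((s p : ℂ) • (D.interp p.1 * B * star (D.interp p.1))) =
          (s p : ℂ) • (D.interp p.1 * star B * star (D.interp p.1)) := by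
        simp [mul_assoc]
      rw [this]
      exact hinj (hs0 p) (hi.comp (hB2.comp hi'))
    · refine lt_of_le_of_lt (mul_le_mul_of_nonneg_left ?_ hl) hB3
      rw [norm_smul, Complex.norm_real, Real.norm_of_nonneg (hs0 p).le]
      have h1 : ‖D.interp p.1 * B * star (D.interp p.1)‖ ≤ ‖B‖ := by
        calc _ ≤ ‖D.interp p.1‖ * ‖B‖ * ‖star (D.interp p.1)‖ := norm_mul₃_le
          _ ≤ 1 * ‖B‖ * 1 := by
            rw [norm_star]
            gcongr <;> exact D.norm_interp_le _
          _ = ‖B‖ := by ring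
      exact (mul_le_of_le_one_left (norm_nonneg _) (hs1 p)).trans h1
    · exact (isCompactOperator_mul_right (isCompactOperator_mul_left (hB5 hk) _) _).smul _⟩
  have hmem : ∀ B : H →L[ℂ] H, Function.Injective B → Function.Injective ⇑(star B) → P B →
      ∀ r, D.contraction ((δ : ℂ) • S) r ((c B : ℂ) • B) ∈ Y := by
    intro B hB1 hB2 hB4 r
    have hsa : IsSelfAdjoint ((δ : ℂ) • S) := by
      rw [IsSelfAdjoint, star_smul, h.isSelfAdjoint.star_eq]
      simp
    have hK' : Commute D.K ((δ : ℂ) • S) := hK.smul_right _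
    have hv' : ∀ t, Commute (D.v t) ((δ : ℂ) • S) := fun t => (hv t).smul_right _
    refine ⟨D.injective_contraction (hinj hδ h.injective) hsa hK' hv' (hinj (hc0 B) hB1) _, ?_, ?_,
      h.contraction D (h.smul hB4 (hc0 B)) hδ _, fun _ => D.isCompactOperator_contraction _ _ _⟩
    · rw [D.star_contraction hsa, star_smul]
      refine D.injective_contraction (hinj hδ h.injective) hsa hK' hv' ?_ _
      simpa using hinj (hc0 B) hB2
    · have h1 := D.norm_contraction_le ((δ : ℂ) • S) r ((c B : ℂ) • B)
      rw [norm_smul, norm_smul, Complex.norm_real, Complex.norm_real,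
        Real.norm_of_nonneg (hc0 B).le, Real.norm_of_nonneg hδ.le] at h1
      have h2 : δ * ‖S‖ ≤ δ := mul_le_of_le_one_right hδ.le h.norm_le
      have h3 : δ + δ = (l + 1)⁻¹ := by
        simp only [δ]
        field_simp
        norm_num
      calc l * _ ≤ l * (l + 1)⁻¹ := by
            refine mul_le_mul_of_nonneg_left ?_ hl
            linarith [hcB B]
        _ < 1 := by
          rw [← div_eq_mul_inv, div_lt_one hl1]
          linarith
  let G : I × Y → Y := fun p => ⟨_, hmem p.2 p.2.2.1 p.2.2.2.1 p.2.2.2.2.2.1 p.1⟩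
  have hF : Continuous F := by
    have := D.continuous_interp
    refine Continuous.subtype_mk ?_ _
    simp only [s]
    fun_prop
  have hG : Continuous G := by
    have := D.continuous_inner
    have := D.continuous_outer
    refine Continuous.subtype_mk ?_ _
    unfold ContractionData.contraction
    fun_prop
  have hSs : Function.Injective ⇑(star S) := by
    rw [h.isSelfAdjoint.star_eq]
    exact h.injective
  let B₀ : Y := ⟨_, hmem S h.injective hSs h.base 1⟩
  have hF0 : ∀ B, F (0, B) = B := fun B => Subtype.ext <| by
    simp [F, s, D.interp_zero]
  have hFG : ∀ B, F (1, B) = G (0, B) := fun B => Subtype.ext <| by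
    simp [F, G, s, D.interp_one, ContractionData.contraction, D.inner_zero, D.outer_zero]
  have hG1 : ∀ B, G (1, B) = B₀ := fun B => Subtype.ext <| by
    simp [B₀, G, ContractionData.contraction, D.inner_one]
  rw [contractible_iff_id_nullhomotopic]
  refine ⟨B₀, ContinuousMap.Homotopic.trans
    (g := ⟨fun B => F (1, B), hF.comp (by fun_prop)⟩) ⟨⟨⟨F, hF⟩, hF0, fun B => rfl⟩⟩
    ⟨⟨⟨G, hG⟩, fun B => (hFG B).symm, hG1⟩⟩⟩

end IsContractionClass

theorem isContractionClass_true : IsContractionClass (H := H) (fun _ => True) 1 where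
  isSelfAdjoint := .one _
  injective := Function.injective_id
  norm_le := norm_one_le
  base := trivial
  sum _ _ _ _ _ _ _ := trivial

theorem IsSelfAdjoint.conj_add {B S : H →L[ℂ] H} (hB : IsSelfAdjoint B) (hS : IsSelfAdjoint S)
    (κ p : H →L[ℂ] H) : IsSelfAdjoint (κ * B * star κ + p * S * star p) :=
  (hB.conjugate κ).add (hS.conjugate p)

theorem isContractionClass_isSelfAdjoint :
    IsContractionClass (H := H) (fun B => IsSelfAdjoint B) 1 where
  isSelfAdjoint := .one _
  injective := Function.injective_id
  norm_le := norm_one_le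
  base := .one _
  sum _ κ p _ _ _ hB := IsSelfAdjoint.conj_add hB (.one _) κ p

theorem isContractionClass_essNonneg :
    IsContractionClass (H := H) (fun B => IsSelfAdjoint B ∧ EssNonneg B) 1 where
  isSelfAdjoint := .one _
  injective := Function.injective_id
  norm_le := norm_one_le
  base := ⟨.one _, essNonneg_of_nonneg zero_le_one⟩
  sum _ κ p _ _ _ hB := ⟨IsSelfAdjoint.conj_add hB.1 (.one _) κ p,
    (hB.2.conj κ).add ((essNonneg_of_nonneg zero_le_one).conj p)⟩

theorem isContractionClass_essNonneg_neg :
    IsContractionClass (H := H) (fun B => IsSelfAdjoint B ∧ EssNonneg (-B)) (-1) where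
  isSelfAdjoint := (IsSelfAdjoint.one _).neg
  injective := neg_injective
  norm_le := by
    rw [norm_neg]
    exact norm_one_le
  base := ⟨(IsSelfAdjoint.one _).neg, by
    rw [neg_neg]
    exact essNonneg_of_nonneg zero_le_one⟩
  sum B κ p _ _ _ hB := by
    refine ⟨IsSelfAdjoint.conj_add hB.1 (IsSelfAdjoint.one _).neg κ p, ?_⟩
    have := (hB.2.conj κ).add ((essNonneg_of_nonneg (H := H) zero_le_one).conj p)
    convert this using 1
    simp
    abel

/-- Conjugation by `w` removes the second summand, and the injective factor `w * κ` can then be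
dropped. Read contrapositively, this keeps essentially indefinite operators indefinite along the
contraction. -/
theorem EssNonneg.of_conj_add {B S κ p w : H →L[ℂ] H} (hw : w * p = 0)
    (hκ : Function.Injective ⇑(w * κ)) (h : EssNonneg (κ * B * star κ + p * S * star p)) :
    EssNonneg B := by
  refine EssNonneg.of_conj hκ ?_
  convert h.conj w using 1
  rw [mul_add, ← mul_assoc w (p * S), ← mul_assoc w p, hw]
  simp [mul_assoc]

theorem isContractionClass_essIndefinite {J : H →L[ℂ] H} (hJ : J ∈ symmetries H) :
    IsContractionClass (H := H) (fun B => IsSelfAdjoint B ∧ EssIndefinite B) J where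
  isSelfAdjoint := hJ.1
  injective := injective_of_isUnit (isUnit_of_mem_symmetries hJ)
  norm_le := norm_le_one_of_star_mul_self (by rw [hJ.1.star_eq, hJ.2.1])
  base := ⟨hJ.1, hJ.2.2⟩
  sum B κ p w hw hκ hB := by
    refine ⟨IsSelfAdjoint.conj_add hB.1 hJ.1 κ p, fun h => hB.2.1 (h.of_conj_add hw hκ),
      fun h => hB.2.2 (EssNonneg.of_conj_add (S := -J) (p := p) hw hκ ?_)⟩
    convert h using 1
    simp
    abel

end Contraction

/-! ### Contraction of spaces of bounded transforms -/

section Contractive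

variable {H : Type u} [NormedAddCommGroup H] [InnerProductSpace ℂ H] [CompleteSpace H]

variable (H) in
/-- The contractions `a` with `1 - a* a` injective that are invertible with a lower bound exceeding
`m`, optionally with compact defect, optionally self-adjoint and essentially indefinite. -/
def contractiveUnits (m : ℝ) (k sa : Prop) : Set (H →L[ℂ] H) :=
  {a | ‖a‖ ≤ 1 ∧ Function.Injective ⇑(1 - star a * a) ∧ IsUnit a ∧
    (∃ c, m < c ∧ ∀ y, c * ‖y‖ ≤ ‖a y‖) ∧
    (k → IsCompactOperator ⇑(1 - star a * a) ∧ IsCompactOperator ⇑(1 - a * star a)) ∧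
    (sa → IsSelfAdjoint a ∧ EssIndefinite a)}

/-- The admissible absolute values of elements of `contractiveUnits`. -/
structure IsContractiveAbs (m : ℝ) (k : Prop) (q : H →L[ℂ] H) : Prop where
  nonneg : 0 ≤ q
  le_one : q ≤ 1
  injective : ∀ x, ⟪(1 - q) x, x⟫_ℂ = 0 → x = 0
  lower : ∃ c : ℝ, m < c ∧ c • (1 : H →L[ℂ] H) ≤ q
  compact : k → IsCompactOperator ⇑(1 - q)

theorem inner_nonneg {p : H →L[ℂ] H} (hp : 0 ≤ p) (x : H) : 0 ≤ (⟪p x, x⟫_ℂ).re :=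
  ((ContinuousLinearMap.nonneg_iff_isPositive _).1 hp).re_inner_nonneg_left x

theorem apply_eq_zero_of_inner {p : H →L[ℂ] H} (hp : 0 ≤ p) {x : H} (h : (⟪p x, x⟫_ℂ).re = 0) :
    p x = 0 := by
  rw [re_inner_eq_norm_sqrt_sq hp] at h
  have h1 : CFC.sqrt p x = 0 := norm_eq_zero.1 (pow_eq_zero_iff two_ne_zero |>.1 h)
  rw [← CFC.sqrt_mul_sqrt_self p hp]
  change CFC.sqrt p (CFC.sqrt p x) = 0
  rw [h1, map_zero]

theorem re_inner_real_smul_left (r : ℝ) (x y : H) : (⟪r • x, y⟫_ℂ).re = r * (⟪x, y⟫_ℂ).re := by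
  rw [RCLike.real_smul_eq_coe_smul (K := ℂ), inner_smul_left]
  simp

variable {m : ℝ} {k sa : Prop}

/-- This convexity is the reason for separating absolute values from unitary parts: only the latter
carry homotopical information. -/
theorem IsContractiveAbs.convex {p q : H →L[ℂ] H} (hp : IsContractiveAbs m k p)
    (hq : IsContractiveAbs m k q) (t : I) :
    IsContractiveAbs m k ((1 - t : ℝ) • p + (t : ℝ) • q) := by
  have h0 : (0 : ℝ) ≤ 1 - t := sub_nonneg.2 t.2.2
  have h1 : (0 : ℝ) ≤ t := t.2.1
  have e : (1 : H →L[ℂ] H) - ((1 - t : ℝ) • p + (t : ℝ) • q) =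
      (1 - t : ℝ) • (1 - p) + (t : ℝ) • (1 - q) := by module
  refine ⟨add_nonneg (smul_nonneg h0 hp.nonneg) (smul_nonneg h1 hq.nonneg), ?_, fun x hx => ?_, ?_,
    fun hk => ?_⟩
  · rw [← sub_nonneg, e]
    exact add_nonneg (smul_nonneg h0 (sub_nonneg.2 hp.le_one))
      (smul_nonneg h1 (sub_nonneg.2 hq.le_one))
  · have hp' := sub_nonneg.2 hp.le_one
    have hq' := sub_nonneg.2 hq.le_one
    have h2 := inner_nonneg hp' x
    have h3 := inner_nonneg hq' x
    have h4 : (1 - t : ℝ) * (⟪(1 - p) x, x⟫_ℂ).re + t * (⟪(1 - q) x, x⟫_ℂ).re = 0 := by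
      rw [e] at hx
      have := congrArg Complex.re hx
      change (⟪(1 - t : ℝ) • (1 - p) x + (t : ℝ) • (1 - q) x, x⟫_ℂ).re = 0 at this
      rw [inner_add_left, Complex.add_re, re_inner_real_smul_left, re_inner_real_smul_left] at this
      exact this
    rcases h1.eq_or_lt with h | h
    · refine hp.injective x ?_
      rw [apply_eq_zero_of_inner hp', inner_zero_left]
      rw [← h] at h4
      simpa using h4
    · refine hq.injective x ?_
      rw [apply_eq_zero_of_inner hq', inner_zero_left]
      have := mul_nonneg h0 h2
      nlinarith
  · obtain ⟨c, hc, hcp⟩ := hp.lower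
    obtain ⟨d, hd, hdq⟩ := hq.lower
    refine ⟨(1 - t) * c + t * d, ?_, ?_⟩
    · rcases h1.eq_or_lt with h | h
      · rw [← h]
        simpa using hc
      · nlinarith
    · rw [add_smul, mul_smul, mul_smul]
      exact add_le_add (smul_le_smul_of_nonneg_left hcp h0) (smul_le_smul_of_nonneg_left hdq h1)
  · rw [e]
    exact ((hp.compact hk).smul (1 - t : ℝ)).add ((hq.compact hk).smul (t : ℝ))

theorem lower_norm {q : H →L[ℂ] H} {c : ℝ} (hq : c • (1 : H →L[ℂ] H) ≤ q) (y : H) :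
    c * ‖y‖ ≤ ‖q y‖ := by
  have h := inner_nonneg (sub_nonneg.2 hq) y
  have e : (⟪(q - c • (1 : H →L[ℂ] H)) y, y⟫_ℂ).re = (⟪q y, y⟫_ℂ).re - c * ‖y‖ ^ 2 := by
    change (⟪q y - c • y, y⟫_ℂ).re = _
    rw [inner_sub_left, Complex.sub_re, re_inner_real_smul_left]
    congr 2
    exact inner_self_eq_norm_sq (𝕜 := ℂ) y
  have h2 : (⟪q y, y⟫_ℂ).re ≤ ‖q y‖ * ‖y‖ := re_inner_le_norm (𝕜 := ℂ) _ _
  rcases (norm_nonneg y).eq_or_lt with h0 | h0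
  · rw [← h0, mul_zero]
    exact norm_nonneg _
  · nlinarith

theorem isUnit_of_lower {q : H →L[ℂ] H} {c : ℝ} (hc : 0 < c) (hq : c • (1 : H →L[ℂ] H) ≤ q) :
    IsUnit q :=
  CStarAlgebra.isUnit_of_le _ hq <| IsUnit.isStrictlyPositive
    ⟨⟨c • 1, c⁻¹ • 1, by rw [smul_mul_smul_comm, mul_inv_cancel₀ hc.ne', mul_one, one_smul],
      by rw [smul_mul_smul_comm, inv_mul_cancel₀ hc.ne', mul_one, one_smul]⟩, rfl⟩
    (smul_nonneg hc.le zero_le_one)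

/-- Since `1 - star (u * q) * (u * q) = (1 + q) * (1 - q)` with `1 + q` invertible, the conditions
on the defect are conditions on `1 - q`. -/
theorem IsContractiveAbs.mul_mem (hm : 0 ≤ m) {u q : H →L[ℂ] H} (hq : IsContractiveAbs m k q)
    (hu : u ∈ unitary (H →L[ℂ] H)) (hs : sa → u ∈ symmetries H ∧ Commute u q) :
    u * q ∈ contractiveUnits H m k sa := by
  obtain ⟨c, hc, hcq⟩ := hq.lower
  have hqu := isUnit_of_lower (hm.trans_lt hc) hcq
  have huu : IsUnit u := ⟨⟨u, star u, Unitary.mul_star_self_of_mem hu,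
    Unitary.star_mul_self_of_mem hu⟩, rfl⟩
  have hqs := hq.nonneg.isSelfAdjoint.star_eq
  have hn : ∀ y, ‖u y‖ = ‖y‖ :=
    ContinuousLinearMap.norm_map_of_mem_unitary hu
  have e1 : 1 - star (u * q) * (u * q) = (1 + q) * (1 - q) := by
    rw [star_mul, hqs, mul_assoc, ← mul_assoc (star u), Unitary.star_mul_self_of_mem hu]
    noncomm_ring
  have e2 : 1 - u * q * star (u * q) = u * ((1 + q) * (1 - q)) * star u := by
    have : u * (1 : H →L[ℂ] H) * star u = 1 := by rw [mul_one, Unitary.mul_star_self_of_mem hu]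
    rw [star_mul, hqs, show (1 + q) * (1 - q) = 1 - q * q by noncomm_ring, mul_sub, sub_mul, this]
    simp only [mul_assoc]
  have hpos : IsUnit (1 + q) := isUnit_of_lower one_pos (by
    rw [one_smul]
    exact le_add_of_nonneg_right hq.nonneg)
  refine ⟨?_, ?_, huu.mul hqu, ⟨c, hc, fun y => ?_⟩, fun hk => ?_, fun h => ?_⟩
  · refine (norm_mul_le _ _).trans (mul_le_one₀ ?_ (norm_nonneg _) ?_)
    · exact norm_le_one_of_star_mul_self (Unitary.star_mul_self_of_mem hu)
    · exact (CStarAlgebra.norm_le_one_iff_of_nonneg q hq.nonneg).2 hq.le_one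
  · rw [e1]
    refine (injective_of_isUnit hpos).comp ((injective_iff_map_eq_zero _).2 fun x hx => ?_)
    exact hq.injective x (by
      rw [show (1 - q) x = 0 from hx, inner_zero_left])
  · change _ ≤ ‖u (q y)‖
    rw [hn]
    exact lower_norm hcq y
  · rw [e1, e2]
    have := isCompactOperator_mul_left (hq.compact hk) (1 + q)
    exact ⟨this, isCompactOperator_mul_right (isCompactOperator_mul_left this u) _⟩
  · obtain ⟨h1, h2⟩ := hs h
    have := mul_mem_indefiniteUnits h1 hq.nonneg hqu h2
    exact ⟨this.1, this.2.2⟩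

/-- The lower bound says `c ^ 2 ≤ star a * a`, and the square root is operator monotone. -/
theorem smul_one_le_abs {a : H →L[ℂ] H} {c : ℝ} (hc : 0 ≤ c) (h : ∀ y, c * ‖y‖ ≤ ‖a y‖) :
    c • (1 : H →L[ℂ] H) ≤ CFC.abs a := by
  have h6 : (c ^ 2) • (1 : H →L[ℂ] H) ≤ star a * a := by
    rw [ContinuousLinearMap.le_def, ContinuousLinearMap.isPositive_def']
    refine ⟨(IsSelfAdjoint.star_mul_self a).sub ((IsSelfAdjoint.all (c ^ 2)).smul (.one _)),
      fun x => ?_⟩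
    have e : (⟪(star a * a - (c ^ 2) • (1 : H →L[ℂ] H)) x, x⟫_ℂ).re =
        ‖a x‖ ^ 2 - c ^ 2 * ‖x‖ ^ 2 := by
      have e0 : ⟪(star a * a) x, x⟫_ℂ = ⟪a x, a x⟫_ℂ :=
        ContinuousLinearMap.adjoint_inner_left a x (a x)
      have e1 : (⟪a x, a x⟫_ℂ).re = ‖a x‖ ^ 2 := inner_self_eq_norm_sq (𝕜 := ℂ) _
      have e2 : (⟪x, x⟫_ℂ).re = ‖x‖ ^ 2 := inner_self_eq_norm_sq (𝕜 := ℂ) _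
      rw [sub_apply, inner_sub_left, Complex.sub_re, e0, e1]
      change _ - (⟪(c ^ 2) • x, x⟫_ℂ).re = _
      rw [re_inner_real_smul_left, e2]
    have h7 := pow_le_pow_left₀ (mul_nonneg hc (norm_nonneg x)) (h x) 2
    rw [mul_pow] at h7
    exact (sub_nonneg.2 h7).trans_eq e.symm
  have h7 := CFC.sqrt_le_sqrt _ _ h6
  have e : CFC.sqrt ((c ^ 2) • (1 : H →L[ℂ] H)) = c • (1 : H →L[ℂ] H) :=
    CFC.sqrt_unique (by rw [smul_mul_smul_comm, mul_one, sq]) (smul_nonneg hc zero_le_one)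
  rw [e] at h7
  exact h7

theorem isContractiveAbs_abs (hm : 0 ≤ m) {a : H →L[ℂ] H} (ha : a ∈ contractiveUnits H m k sa) :
    IsContractiveAbs m k (CFC.abs a) := by
  obtain ⟨h1, h2, h3, ⟨c, hc, h4⟩, h5, -⟩ := ha
  have hp := CFC.abs_nonneg a
  have hle : CFC.abs a ≤ 1 := by
    rw [← CStarAlgebra.norm_le_one_iff_of_nonneg (CFC.abs a) hp, CFC.norm_abs]
    exact h1
  have e : 1 - star a * a = (1 + CFC.abs a) * (1 - CFC.abs a) := by
    rw [← CFC.abs_mul_abs]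
    noncomm_ring
  have hpos : IsUnit (1 + CFC.abs a) := isUnit_of_lower one_pos (by
    rw [one_smul]
    exact le_add_of_nonneg_right hp)
  refine ⟨hp, hle, fun x hx => ?_, ⟨c, hc, ?_⟩, fun hk => ?_⟩
  · have : (1 - CFC.abs a) x = 0 :=
      apply_eq_zero_of_inner (sub_nonneg.2 hle) (by rw [hx, Complex.zero_re])
    refine (injective_iff_map_eq_zero _).1 h2 x ?_
    rw [e]
    change (1 + CFC.abs a) ((1 - CFC.abs a) x) = 0
    rw [this, map_zero]
  · exact smul_one_le_abs (hm.trans hc.le) h4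
  · have h6 := (h5 hk).1
    rw [e] at h6
    obtain ⟨w, hw⟩ := hpos
    have h7 := isCompactOperator_mul_left h6 (w⁻¹ : (H →L[ℂ] H)ˣ)
    rwa [← mul_assoc, ← hw, w.inv_mul, one_mul] at h7

/-- The average of `K` and its conjugate by the unitary operator `u`. -/
def average (K u : H →L[ℂ] H) : H →L[ℂ] H := (2⁻¹ : ℝ) • (K + star u * K * u)

/-- Up to homotopy, `a` depends only on `polar a`: the absolute value moves linearly to an
admissible one, `q (polar a)`. So the space is dominated by the unitary group or by the symmetries.
-/
theorem contractibleSpace_contractiveUnits [TopologicalSpace.SeparableSpace H]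
    (hH : ¬ FiniteDimensional ℂ H) (hm : 0 ≤ m) (hm1 : m < 1) (k sa : Prop) :
    ContractibleSpace (contractiveUnits H m k sa) := by
  obtain ⟨K, hK0, hKi, hKc, hK1⟩ := exists_compact_nonneg hH
  let W : Set (H →L[ℂ] H) := {u | u ∈ unitary (H →L[ℂ] H) ∧ (sa → u ∈ symmetries H)}
  have hW : ContractibleSpace W := by
    by_cases h : sa
    · have : W = symmetries H := by
        ext u
        exact ⟨fun hu => hu.2 h, fun hu => ⟨mem_unitary_of_mem_symmetries hu, fun _ => hu⟩⟩
      rw [this]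
      exact contractibleSpace_symmetries hH
    · have : W = (unitary (H →L[ℂ] H) : Set (H →L[ℂ] H)) := by
        ext u
        exact ⟨fun hu => hu.1, fun hu => ⟨hu, fun h' => absurd h' h⟩⟩
      rw [this]
      exact contractibleSpace_unitary hH
  -- This gives `q u ≥ 1 - δ = (1 + m) / 2 > m`. The compact injective `K` makes `1 - q u` compact
  -- and injective, and averaging makes `q u` commute with `u` when `u` is a symmetry.
  let δ : ℝ := (1 - m) / 2
  have hδ : 0 < δ := by simp only [δ]; linarith
  let q : (H →L[ℂ] H) → (H →L[ℂ] H) := fun u => 1 - δ • average K u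
  have hqc : Continuous q := by
    simp only [q, average]
    fun_prop
  have hK1' : K ≤ 1 := (CStarAlgebra.norm_le_one_iff_of_nonneg K hK0).1 hK1
  have hq : ∀ u ∈ unitary (H →L[ℂ] H), IsContractiveAbs m k (q u) := fun u hu => by
    have h0 : 0 ≤ star u * K * u := star_left_conjugate_nonneg hK0 u
    have h1 : 0 ≤ average K u := smul_nonneg (by norm_num) (add_nonneg hK0 h0)
    have h2 : average K u ≤ 1 := by
      have h3 : star u * K * u ≤ 1 := by
        have := star_left_conjugate_le_conjugate hK1' u
        rwa [mul_one, Unitary.star_mul_self_of_mem hu] at this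
      have : (2⁻¹ : ℝ) • (K + star u * K * u) ≤ (2⁻¹ : ℝ) • (1 + 1) :=
        smul_le_smul_of_nonneg_left (add_le_add hK1' h3) (by norm_num)
      refine this.trans_eq ?_
      module
    have h4 : (1 - δ) • (1 : H →L[ℂ] H) ≤ q u := by
      rw [sub_smul, one_smul]
      exact sub_le_sub_left (smul_le_smul_of_nonneg_left h2 hδ.le) _
    have e : 1 - q u = δ • average K u := sub_sub_cancel _ _
    refine ⟨le_trans (smul_nonneg ?_ zero_le_one) h4, ?_, fun x hx => ?_, ⟨1 - δ, ?_, h4⟩,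
      fun _ => ?_⟩
    · simp only [δ]; linarith
    · rw [← sub_nonneg, e]
      exact smul_nonneg hδ.le h1
    · have h5 : δ * (2⁻¹ * ((⟪K x, x⟫_ℂ).re + (⟪(star u * K * u) x, x⟫_ℂ).re)) = 0 := by
        rw [e] at hx
        have := congrArg Complex.re hx
        change (⟪δ • (2⁻¹ : ℝ) • (K x + (star u * K * u) x), x⟫_ℂ).re = 0 at this
        rwa [re_inner_real_smul_left, re_inner_real_smul_left, inner_add_left, Complex.add_re] at this
      have h6 := inner_nonneg hK0 x
      have h7 := inner_nonneg h0 x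
      have h8 : (⟪K x, x⟫_ℂ).re = 0 := by
        have := (mul_eq_zero.1 h5).resolve_left hδ.ne'
        linarith
      exact (injective_iff_map_eq_zero _).1 hKi x (apply_eq_zero_of_inner hK0 h8)
    · simp only [δ]; linarith
    · rw [e]
      exact ((hKc.add (isCompactOperator_mul_right (isCompactOperator_mul_left hKc _) u)).smul
        (2⁻¹ : ℝ)).smul δ
  have hcomm : ∀ u ∈ symmetries H, Commute u (q u) := fun u hu => by
    have : Commute u (K + star u * K * u) := by
      rw [hu.1.star_eq]
      change _ * _ = _ * _
      simp only [mul_add, add_mul, mul_assoc, hu.2.1, mul_one]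
      rw [← mul_assoc u u, hu.2.1, one_mul, add_comm]
    exact (Commute.one_right u).sub_right ((this.smul_right _).smul_right _)
  have hpol : ∀ a ∈ contractiveUnits H m k sa, polar a ∈ W := fun a ha =>
    ⟨polar_mem_unitary ha.2.2.1, fun h => polar_mem_symmetries
      ⟨(ha.2.2.2.2.2 h).1, ha.2.2.1, (ha.2.2.2.2.2 h).2⟩⟩
  let F : I × contractiveUnits H m k sa → contractiveUnits H m k sa := fun p =>
    ⟨polar p.2 * ((1 - p.1 : ℝ) • q (polar p.2) + (p.1 : ℝ) • CFC.abs (p.2 : H →L[ℂ] H)), by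
      obtain ⟨a, ha⟩ := p.2
      refine ((hq _ (hpol a ha).1).convex (isContractiveAbs_abs hm ha) p.1).mul_mem hm (hpol a ha).1
        fun h => ⟨(hpol a ha).2 h, ?_⟩
      exact ((hcomm _ ((hpol a ha).2 h)).smul_right _).add_right
        ((commute_polar_abs ha.2.2.1 (ha.2.2.2.2.2 h).1).smul_right _)⟩
  have hpc : Continuous fun a : contractiveUnits H m k sa => polar (a : H →L[ℂ] H) :=
    continuous_polar continuous_subtype_val fun a => a.2.2.2.1.star.mul a.2.2.2.1
  have hF : Continuous F := by
    have h1 : Continuous fun a : contractiveUnits H m k sa => CFC.abs (a : H →L[ℂ] H) :=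
      continuous_abs continuous_subtype_val
    have h3 : Continuous fun p : I × contractiveUnits H m k sa => polar (p.2 : H →L[ℂ] H) :=
      hpc.comp continuous_snd
    have h4 : Continuous fun p : I × contractiveUnits H m k sa => q (polar (p.2 : H →L[ℂ] H)) :=
      hqc.comp h3
    have h5 : Continuous fun p : I × contractiveUnits H m k sa => CFC.abs (p.2 : H →L[ℂ] H) :=
      h1.comp continuous_snd
    have h6 : Continuous fun p : I × contractiveUnits H m k sa => (p.1 : ℝ) := by fun_prop
    have h7 : Continuous fun p : I × contractiveUnits H m k sa => (1 - p.1 : ℝ) := by fun_prop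
    exact (h3.mul ((h7.smul h4).add (h6.smul h5))).subtype_mk _
  let r : C(contractiveUnits H m k sa, W) := ⟨fun a => ⟨polar a, hpol a a.2⟩, hpc.subtype_mk _⟩
  let i : C(W, contractiveUnits H m k sa) := ⟨fun u => ⟨u * q u, (hq u u.2.1).mul_mem hm u.2.1
    fun h => ⟨u.2.2 h, hcomm _ (u.2.2 h)⟩⟩, by
      refine Continuous.subtype_mk ?_ _
      fun_prop⟩
  refine contractibleSpace_of_homotopic r i ⟨⟨⟨F, hF⟩, fun a => Subtype.ext ?_,
    fun a => Subtype.ext ?_⟩⟩ hW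
  · simp [F, r, i]
  · simp [F, polar_mul_abs a.2.2.2.1]

end Contractive

/-! ### Operators with parametrized graph -/

section Parametrization

variable {E : Type u} [NormedAddCommGroup E] [InnerProductSpace ℂ E]

/-- The graph of `A` is the range of `y ↦ (c y, d y)`. -/
def IsParam (A : E →ₗ.[ℂ] E) (c d : E →L[ℂ] E) : Prop :=
  ∀ x z, (x, z) ∈ A.graph ↔ ∃ y, c y = x ∧ d y = z

variable {A : E →ₗ.[ℂ] E} {c d B : E →L[ℂ] E}

theorem apply_mem_graph (x : A.domain) : ((x : E), A x) ∈ A.graph :=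
  (A.mem_graph_iff).2 ⟨x, rfl, rfl⟩

theorem IsParam.exists_eq (h : IsParam A c d) (x : A.domain) : ∃ y, c y = x ∧ d y = A x :=
  (h _ _).1 (apply_mem_graph x)

theorem IsParam.mem_graph (h : IsParam A c d) (y : E) : (c y, d y) ∈ A.graph :=
  (h _ _).2 ⟨y, rfl, rfl⟩

theorem IsParam.mem_domain (h : IsParam A c d) (y : E) : c y ∈ A.domain :=
  LinearPMap.mem_domain_iff.2 ⟨_, h.mem_graph y⟩

theorem IsParam.apply (h : IsParam A c d) (y : E) (hy : c y ∈ A.domain) : A ⟨c y, hy⟩ = d y :=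
  A.mem_graph_snd_inj (apply_mem_graph ⟨c y, hy⟩) (h.mem_graph y) rfl

theorem IsParam.congr_of_graph {A' : E →ₗ.[ℂ] E} (h : IsParam A c d) (h' : IsParam A' c d) :
    A = A' :=
  LinearPMap.eq_of_eq_graph <| by
    ext ⟨x, z⟩
    rw [h x z, h' x z]

theorem IsParam.sub_smul (h : IsParam A c d) (z : ℂ) :
    IsParam ((-(z • LinearMap.id) : E →ₗ[ℂ] E) +ᵥ A) c (d - z • c) := by
  intro x w
  rw [LinearPMap.mem_graph_iff]
  constructor
  · rintro ⟨y, hy, hw⟩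
    obtain ⟨v, hv, hv'⟩ := h.exists_eq (⟨y, y.2⟩ : A.domain)
    refine ⟨v, hv.trans hy, ?_⟩
    rw [LinearPMap.vadd_apply] at hw
    change -(z • (y : E)) + A ⟨y, y.2⟩ = w at hw
    change d v - z • c v = w
    rw [← hw, hv', hv]
    abel
  · rintro ⟨y, rfl, rfl⟩
    refine ⟨⟨c y, h.mem_domain y⟩, rfl, ?_⟩
    rw [LinearPMap.vadd_apply]
    change -(z • c y) + A ⟨c y, h.mem_domain y⟩ = d y - z • c y
    rw [h.apply]
    abel

theorem exists_param_of_isInvertible (h : IsInvertible A) :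
    ∃ B : E →L[ℂ] E, IsParam A B 1 ∧ Function.Injective B := by
  obtain ⟨⟨-, hs⟩, B, hB⟩ := h
  have key : ∀ y, ∃ x : A.domain, A x = y ∧ B y = x := fun y => by
    obtain ⟨x, hx⟩ := hs y
    exact ⟨x, hx, by rw [← hx]; exact hB x⟩
  refine ⟨B, fun x z => ⟨fun hxz => ?_, ?_⟩, ?_⟩
  · obtain ⟨w, rfl, rfl⟩ := (A.mem_graph_iff).1 hxz
    exact ⟨A w, hB w, rfl⟩
  · rintro ⟨y, rfl, rfl⟩
    obtain ⟨w, hw, hw'⟩ := key y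
    refine (A.mem_graph_iff).2 ⟨w, hw'.symm, hw⟩
  · rw [injective_iff_map_eq_zero]
    intro y hy
    obtain ⟨w, hw, hw'⟩ := key y
    rw [← hw, show w = 0 from Subtype.ext (hw'.symm.trans hy), A.map_zero]

theorem IsParam.isInvertible_iff [CompleteSpace E] (h : IsParam A c d) (hc : Function.Injective c) :
    IsInvertible A ↔ IsUnit d := by
  have hz : ∀ {y}, c y = 0 → y = 0 := fun {y} hy => hc (hy.trans (map_zero c).symm)
  rw [ContinuousLinearMap.isUnit_iff_bijective]
  constructor
  · rintro ⟨⟨hi, hs⟩, -⟩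
    refine ⟨(injective_iff_map_eq_zero d).2 fun y hy => hz ?_, fun w => ?_⟩
    · have := @hi ⟨c y, h.mem_domain y⟩ 0 (by
        change A _ = A 0
        rw [h.apply, hy, A.map_zero])
      exact congrArg Subtype.val this
    · obtain ⟨x, rfl⟩ := hs w
      obtain ⟨y, -, hy⟩ := h.exists_eq x
      exact ⟨y, hy⟩
  · intro hd
    obtain ⟨⟨w, v, hwv, hvw⟩, hw⟩ := ContinuousLinearMap.isUnit_iff_bijective.2 hd
    have hw : w = d := hw
    subst hw
    have hvw' : ∀ y, v (w y) = y := fun y => congrArg (fun f : E →L[ℂ] E => f y) hvw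
    have hl : ∀ x : A.domain, (c * v) (A x) = x := fun x => by
      obtain ⟨y, hy, hy'⟩ := h.exists_eq x
      rw [← hy', ← hy]
      exact congrArg c (hvw' y)
    refine ⟨⟨fun x y hxy => Subtype.ext ?_, fun z => ?_⟩, c * v, hl⟩
    · rw [← hl x, ← hl y]
      exact congrArg _ hxy
    · obtain ⟨y, rfl⟩ := hd.2 z
      exact ⟨⟨c y, h.mem_domain y⟩, h.apply y _⟩

theorem IsParam.isInvertible [CompleteSpace E] (h : IsParam A B 1) (hB : Function.Injective B) :
    IsInvertible A := (h.isInvertible_iff hB).2 isUnit_one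

/-- The spectrum of `B⁻¹` avoids `[-l, l]` if and only if `l ‖B‖ < 1`. -/
theorem IsParam.spec_inter_eq_empty_iff [CompleteSpace E] (h : IsParam A B 1)
    (hB : Function.Injective B) (hs : IsSelfAdjoint B) {l : ℝ} :
    Spec A ∩ symmInterval l = ∅ ↔ l * ‖B‖ < 1 := by
  have key : Spec A ∩ symmInterval l = ∅ ↔
      ∀ t ∈ Set.Icc (-l) l, IsUnit (1 - (t : ℂ) • B) := by
    rw [Set.eq_empty_iff_forall_notMem]
    constructor
    · intro H t ht
      by_contra hu
      exact H t ⟨fun hi => hu (((h.sub_smul t).isInvertible_iff hB).1 hi), t, ht, rfl⟩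
    · rintro H z ⟨hz, t, ht, rfl⟩
      exact hz (((h.sub_smul t).isInvertible_iff hB).2 (H t ht))
  rw [key]
  constructor
  · intro H
    by_contra! hlt
    have hn : 0 < ‖B‖ := by
      rcases (norm_nonneg B).eq_or_lt with h0 | h0
      · rw [← h0, mul_zero] at hlt
        linarith
      · exact h0
    have hnt : Nontrivial (E →L[ℂ] E) := ⟨B, 0, fun h => hn.ne' (by rw [h, norm_zero])⟩
    -- For self-adjoint `B` the norm or its negative is a spectral value; its reciprocal is then a
    -- point of the spectrum of `A` in the interval.
    obtain ⟨s, hs1, hs2⟩ : ∃ s : ℝ, |s| = ‖B‖ ∧ s ∈ spectrum ℝ B := by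
      rcases CStarAlgebra.norm_or_neg_norm_mem_spectrum hs with h1 | h1
      · exact ⟨_, abs_of_pos hn, h1⟩
      · exact ⟨_, by rw [abs_neg, abs_of_pos hn], h1⟩
    have hs0 : s ≠ 0 := by
      rintro rfl
      rw [abs_zero] at hs1
      exact hn.ne hs1
    refine (spectrum.mem_iff.1 hs2) ?_
    have hu := H s⁻¹ (by
      refine abs_le.1 ?_
      rwa [abs_inv, hs1, inv_le_iff_one_le_mul₀ hn])
    have e : algebraMap ℝ (E →L[ℂ] E) s - B =
        ((s : ℂ) • (1 : E →L[ℂ] E)) * (1 - ((s⁻¹ : ℝ) : ℂ) • B) := by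
      have : (s : ℂ) * ((s⁻¹ : ℝ) : ℂ) = 1 := by
        rw [← Complex.ofReal_mul, mul_inv_cancel₀ hs0, Complex.ofReal_one]
      rw [mul_sub, mul_one, smul_mul_smul_comm, this, one_smul, one_mul,
        Algebra.algebraMap_eq_smul_one]
      rfl
    rw [e]
    have hsc : (s : ℂ) ≠ 0 := by exact_mod_cast hs0
    exact IsUnit.mul ⟨⟨(s : ℂ) • 1, (s : ℂ)⁻¹ • 1,
      by rw [smul_mul_smul_comm, mul_inv_cancel₀ hsc, mul_one, one_smul],
      by rw [smul_mul_smul_comm, inv_mul_cancel₀ hsc, mul_one, one_smul]⟩, rfl⟩ hu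
  · intro hlt t ht
    refine isUnit_one_sub_of_norm_lt_one (lt_of_le_of_lt ?_ hlt)
    rw [norm_smul, Complex.norm_real, Real.norm_eq_abs]
    exact mul_le_mul_of_nonneg_right (abs_le.2 ht) (norm_nonneg B)

variable [CompleteSpace E]

theorem IsParam.mem_adjoint_graph_iff (h : IsParam A c d) (hA : Dense (A.domain : Set E)) (x z : E) :
    (x, z) ∈ (A†).graph ↔ star c z = star d x := by
  rw [LinearPMap.adjoint_graph_eq_graph_adjoint hA, Submodule.mem_adjoint_iff]
  have e : ∀ y, ⟪d y, x⟫_ℂ - ⟪c y, z⟫_ℂ = ⟪y, star d x - star c z⟫_ℂ := fun y => by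
    rw [inner_sub_right, ContinuousLinearMap.star_eq_adjoint, ContinuousLinearMap.star_eq_adjoint,
      ContinuousLinearMap.adjoint_inner_right, ContinuousLinearMap.adjoint_inner_right]
  constructor
  · intro H
    have := H _ _ (h.mem_graph (star d x - star c z))
    rw [e, inner_self_eq_zero, sub_eq_zero] at this
    exact this.symm
  · intro H a b hab
    obtain ⟨y, rfl, rfl⟩ := (h a b).1 hab
    rw [e, H, sub_self, inner_zero_right]

theorem IsParam.adjoint (h : IsParam A B 1) (hA : Dense (A.domain : Set E)) :
    IsParam (A†) (star B) 1 := by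
  intro x z
  rw [h.mem_adjoint_graph_iff hA, star_one]
  constructor
  · intro H
    exact ⟨z, H, rfl⟩
  · rintro ⟨y, rfl, rfl⟩
    rfl

theorem IsParam.injective_star (h : IsParam A c d) (hA : Dense (A.domain : Set E)) :
    Function.Injective ⇑(star c) := by
  rw [injective_iff_map_eq_zero]
  intro x hx
  refine hA.eq_zero_of_inner_right ℂ fun v hv => ?_
  obtain ⟨y, hy, -⟩ := h.exists_eq ⟨v, hv⟩
  change c y = v at hy
  rw [← hy, ← ContinuousLinearMap.adjoint_inner_right, ← ContinuousLinearMap.star_eq_adjoint, hx,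
    inner_zero_right]

/-- Injectivity of `c` makes the range of `(c, d)` a graph, and that of `star c` makes the domain
dense. The left inverse built from `N` makes the range closed. -/
theorem exists_isParam (hc : Function.Injective c) (hc' : Function.Injective ⇑(star c))
    {N : E →L[ℂ] E} (hN : N * (star c * c + star d * d) = 1) :
    ∃ A : Reg E, IsParam A.1 c d := by
  let g : Submodule ℂ (E × E) := LinearMap.range (c.prod d : E →L[ℂ] E × E).toLinearMap
  have hg : g.toLinearPMap.graph = g := Submodule.toLinearPMap_graph_eq g (by
    rintro _ ⟨y, rfl⟩ hy
    have : y = 0 := hc (Eq.trans hy (map_zero c).symm)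
    change d y = 0
    rw [this, map_zero])
  have hp : IsParam g.toLinearPMap c d := fun x z => by
    rw [hg]
    constructor
    · rintro ⟨y, hy⟩
      exact ⟨y, congrArg Prod.fst hy, congrArg Prod.snd hy⟩
    · rintro ⟨y, rfl, rfl⟩
      exact ⟨y, rfl⟩
  refine ⟨⟨g.toLinearPMap, ?_, ?_⟩, hp⟩
  · rw [LinearPMap.IsClosed, hg]
    let r : E × E → E := fun p => N (star c p.1 + star d p.2)
    have hr : Continuous r := by fun_prop
    have : (g : Set (E × E)) = {p | c (r p) = p.1 ∧ d (r p) = p.2} := by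
      ext p
      constructor
      · rintro ⟨y, rfl⟩
        have : r ((c.prod d) y) = y := congrArg (fun f : E →L[ℂ] E => f y) hN
        exact ⟨congrArg c this, congrArg d this⟩
      · rintro ⟨h1, h2⟩
        exact ⟨r p, Prod.ext h1 h2⟩
    rw [this]
    exact (isClosed_eq (by fun_prop) (by fun_prop)).inter (isClosed_eq (by fun_prop) (by fun_prop))
  · rw [Submodule.dense_iff_topologicalClosure_eq_top, Submodule.topologicalClosure_eq_top_iff,
      Submodule.eq_bot_iff]
    intro x hx
    refine hc' (Eq.trans ?_ (map_zero (star c)).symm)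
    refine ext_inner_left ℂ fun y => ?_
    rw [ContinuousLinearMap.star_eq_adjoint, ContinuousLinearMap.adjoint_inner_right,
      inner_zero_right]
    exact hx _ (hp.mem_domain y)

/-! ### Projections onto parametrized graphs -/

/-- With `T = (c, d)` this is the formula `T (T* T)⁻¹ T*` for the orthogonal projection onto the
range of `T`. -/
theorem IsParam.graphProj_apply {A : Reg E} (h : IsParam A.1 c d) {N : E →L[ℂ] E}
    (hN : (star c * c + star d * d) * N = 1) (v : WithLp 2 (E × E)) :
    graphProj A v = WithLp.toLp 2 (c (N (star c v.fst + star d v.snd)),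
      d (N (star c v.fst + star d v.snd))) := by
  refine Submodule.eq_starProjection_of_mem_of_inner_eq_zero ?_ ?_
  · rw [mem_graphSubmodule]
    exact ⟨h.mem_domain _, h.apply _ _⟩
  · intro w hw
    obtain ⟨hw1, hw2⟩ := (mem_graphSubmodule _ _).1 hw
    obtain ⟨y, hy, hy'⟩ := h.exists_eq ⟨w.fst, hw1⟩
    rw [hw2] at hy'
    change c y = w.fst at hy
    set s := star c v.fst + star d v.snd with hs
    rw [WithLp.prod_inner_apply]
    change ⟪v.fst - c (N s), w.fst⟫_ℂ + ⟪v.snd - d (N s), w.snd⟫_ℂ = 0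
    rw [← hy, ← hy', ← ContinuousLinearMap.adjoint_inner_left,
      ← ContinuousLinearMap.adjoint_inner_left, ← inner_add_left]
    change ⟪star c (v.fst - c (N s)) + star d (v.snd - d (N s)), y⟫_ℂ = 0
    have e : star c (c (N s)) + star d (d (N s)) = s :=
      congrArg (fun f : E →L[ℂ] E => f s) hN
    rw [map_sub, map_sub, show star c v.fst - star c (c (N s)) +
      (star d v.snd - star d (d (N s))) = s - (star c (c (N s)) + star d (d (N s))) by
        rw [hs]; abel, e, sub_self, inner_zero_left]

theorem IsParam.resolvent_eq {A : Reg E} (h : IsParam A.1 c d) {N : E →L[ℂ] E}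
    (hN : (star c * c + star d * d) * N = 1) : resolvent A = c * N * star c := by
  ext x
  change (graphProj A (inl₂ x)).fst = _
  rw [h.graphProj_apply hN]
  change c (N (star c x + star d 0)) = c (N (star c x))
  rw [map_zero, add_zero]

theorem IsParam.coresolvent_eq {A : Reg E} (h : IsParam A.1 c d) {N : E →L[ℂ] E}
    (hN : (star c * c + star d * d) * N = 1) : coresolvent A = 1 - d * N * star d := by
  ext x
  change x - (graphProj A (inr₂ x)).snd = x - d (N (star d x))
  rw [h.graphProj_apply hN]
  change x - d (N (star c 0 + star d x)) = _
  rw [map_zero, zero_add]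

end Parametrization

/-! ### Classes of operators in terms of a parametrization of the graph -/

section Classes

variable {H : Type u} [NormedAddCommGroup H] [InnerProductSpace ℂ H] [CompleteSpace H]
  {B c d : H →L[ℂ] H}

theorem IsParam.injective {A : H →ₗ.[ℂ] H} (h : IsParam A B 1) : Function.Injective B :=
  (injective_iff_map_eq_zero B).2 fun y hy =>
    A.mem_graph_snd_inj (h.mem_graph y) A.graph.zero_mem hy

theorem norm_sq_le_norm_star_mul_self (B : H →L[ℂ] H) (x : H) :
    ‖B x‖ ^ 2 ≤ ‖(star B * B) x‖ * ‖x‖ := by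
  have h1 : ⟪(star B * B) x, x⟫_ℂ = ⟪B x, B x⟫_ℂ := ContinuousLinearMap.adjoint_inner_left B x (B x)
  have h2 : (⟪B x, B x⟫_ℂ).re = ‖B x‖ ^ 2 := inner_self_eq_norm_sq (𝕜 := ℂ) _
  rw [← h2, ← h1]
  exact re_inner_le_norm (𝕜 := ℂ) _ _

/-- By `‖B x‖ ^ 2 ≤ ‖(star B * B) x‖ * ‖x‖`, and as differences in the unit ball have norm at most
`2`, an `ε ^ 2 / 2` net for `star B * B` yields an `ε` net for `B`. -/
theorem isCompactOperator_of_star_mul_self (h : IsCompactOperator ⇑(star B * B)) :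
    IsCompactOperator ⇑B := by
  have h1 := h.isCompact_closure_image_closedBall (f := (star B * B).toLinearMap) 1
  refine (isCompactOperator_iff_isCompact_closure_image_closedBall (B : H →ₗ[ℂ] H) one_pos).2 ?_
  refine (TotallyBounded.closure ?_).isCompact_of_isClosed isClosed_closure
  rw [Metric.totallyBounded_iff]
  intro ε hε
  have h2 := h1.totallyBounded.subset subset_closure
  obtain ⟨t, hts, htf, htc⟩ := Metric.finite_approx_of_totallyBounded h2 (ε ^ 2 / 2) (by positivity)
  have hts' : ∀ y ∈ t, ∃ w, w ∈ Metric.closedBall (0 : H) 1 ∧ (star B * B).toLinearMap w = y :=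
    fun y hy => hts hy
  choose! g hg hg' using hts'
  refine ⟨(fun y => B (g y)) '' t, htf.image _, ?_⟩
  rintro _ ⟨x, hx, rfl⟩
  obtain ⟨y, hy, hxy⟩ := Set.mem_iUnion₂.1 (htc ⟨x, hx, rfl⟩)
  refine Set.mem_iUnion₂.2 ⟨_, ⟨y, hy, rfl⟩, ?_⟩
  have hx' : ‖x‖ ≤ 1 := by simpa using hx
  have hy' : ‖g y‖ ≤ 1 := by simpa using hg y hy
  have e : (star B * B) (x - g y) = (star B * B) x - y := by
    rw [map_sub]
    congr 1
    exact hg' y hy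
  have h3 := norm_sq_le_norm_star_mul_self B (x - g y)
  rw [e] at h3
  have h4 : ‖(star B * B) x - y‖ < ε ^ 2 / 2 := by
    rw [← dist_eq_norm]
    exact hxy
  have h5 : ‖x - g y‖ ≤ 2 := (norm_sub_le _ _).trans (by linarith)
  change dist (B x) (B (g y)) < ε
  rw [dist_eq_norm, ← map_sub]
  refine lt_of_pow_lt_pow_left₀ 2 hε.le ?_
  nlinarith [norm_nonneg ((star B * B) x - y), norm_nonneg (x - g y)]

theorem exists_inverse_one_add (B : H →L[ℂ] H) : ∃ N : H →L[ℂ] H,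
    (star B * B + star (1 : H →L[ℂ] H) * 1) * N = 1 ∧
      N * (star B * B + star (1 : H →L[ℂ] H) * 1) = 1 := by
  obtain ⟨⟨w, N, h1, h2⟩, hw⟩ : IsUnit (star B * B + star (1 : H →L[ℂ] H) * 1) :=
    isUnit_of_lower one_pos (by
      rw [one_smul, star_one, one_mul]
      exact le_add_of_nonneg_left (star_mul_self_nonneg B))
  have hw : w = _ := hw
  subst hw
  exact ⟨N, h1, h2⟩

/-- With `N` the inverse of `star B * B + 1`, the two resolvents are `B * N * star B` and `star B *
B * N`. -/
theorem IsParam.mem_regK_iff {A : Reg H} (h : IsParam A.1 B 1) :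
    A ∈ RegK H ↔ IsCompactOperator ⇑B := by
  obtain ⟨N, hN, hN'⟩ := exists_inverse_one_add B
  have e : 1 - 1 * N * star 1 = star B * (B * N) := by
    rw [star_one, one_mul, mul_one] at *
    rw [← hN]
    noncomm_ring
  change IsCompactOperator _ ∧ IsCompactOperator _ ↔ _
  rw [h.resolvent_eq hN, h.coresolvent_eq hN, e]
  constructor
  · rintro ⟨-, h2⟩
    refine isCompactOperator_of_star_mul_self ?_
    have := isCompactOperator_mul_right h2 (star B * B + star (1 : H →L[ℂ] H) * 1)
    rwa [mul_assoc, mul_assoc, hN', mul_one] at this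
  · intro hB
    exact ⟨isCompactOperator_mul_right (isCompactOperator_mul_right hB N) _,
      isCompactOperator_mul_left (isCompactOperator_mul_right hB N) _⟩

theorem IsParam.mem_regSA_iff {A : Reg H} (h : IsParam A.1 B 1) :
    A ∈ RegSA H ↔ IsSelfAdjoint B := by
  change A.1† = A.1 ↔ star B = B
  have h' := h.adjoint A.2.2
  constructor
  · intro hA
    rw [hA] at h'
    ext y
    obtain ⟨z, hz, rfl⟩ := (h _ _).1 (h'.mem_graph y)
    exact hz.symm
  · intro hB
    rw [hB] at h'
    exact h'.congr_of_graph h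

/-! ### Essentially positive operators -/

/-- Essential positivity of the operator with graph `{(c y, d y)}`. -/
def IsEssPositivePair (c d : H →L[ℂ] H) : Prop :=
  ∃ V : Submodule ℂ H, IsClosed (V : Set H) ∧ FiniteDimensional ℂ (H ⧸ V) ∧
    ∀ y, c y ∈ V → d y ∈ V ∧ 0 ≤ (⟪d y, c y⟫_ℂ).re

theorem IsParam.isEssPositive_iff {A : H →ₗ.[ℂ] H} (h : IsParam A c d) :
    IsEssPositive A ↔ IsEssPositivePair c d := by
  refine exists_congr fun V => and_congr_right fun _ => and_congr_right fun _ => ?_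
  constructor
  · intro H y hy
    have := H ⟨c y, h.mem_domain y⟩ hy
    rwa [h.apply] at this
  · intro H x hx
    obtain ⟨y, hy, hy'⟩ := h.exists_eq x
    rw [← hy] at hx ⊢
    rw [← hy']
    exact H y hx

theorem IsParam.isEssNegative_iff {A : H →ₗ.[ℂ] H} (h : IsParam A c d) :
    IsEssNegative A ↔ IsEssPositivePair c (-d) := by
  refine exists_congr fun V => and_congr_right fun _ => and_congr_right fun _ => ?_
  have e : ∀ y, (-d) y ∈ V ∧ 0 ≤ (⟪(-d) y, c y⟫_ℂ).re ↔ d y ∈ V ∧ (⟪d y, c y⟫_ℂ).re ≤ 0 :=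
    fun y => by
      change -(d y) ∈ V ∧ 0 ≤ (⟪-(d y), c y⟫_ℂ).re ↔ _
      rw [neg_mem_iff, inner_neg_left, Complex.neg_re, neg_nonneg]
  simp only [e]
  constructor
  · intro H y hy
    have := H ⟨c y, h.mem_domain y⟩ hy
    rwa [h.apply] at this
  · intro H x hx
    obtain ⟨y, hy, hy'⟩ := h.exists_eq x
    rw [← hy] at hx ⊢
    rw [← hy']
    exact H y hx

theorem inner_mul_eq (hc : IsSelfAdjoint c) (h : Commute c d) (y : H) :
    ⟪(d * c) y, y⟫_ℂ = ⟪d y, c y⟫_ℂ := by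
  rw [← h.eq]
  change ⟪c (d y), y⟫_ℂ = _
  rw [← ContinuousLinearMap.adjoint_inner_right, hc.adjoint_eq]

/-- On the range of the negative part, `e` is minus that part. A vector of this range orthogonal to
`F` has a form both nonnegative and nonpositive, hence is zero; so the range embeds into `F`. -/
theorem EssNonneg.finiteDimensional_range_negPart {e : H →L[ℂ] H} (he : IsSelfAdjoint e)
    (h : EssNonneg e) : FiniteDimensional ℂ (LinearMap.range (e⁻ : H →L[ℂ] H).toLinearMap) := by
  obtain ⟨F, hF, hpos⟩ := h
  have h0 : 0 ≤ e⁻ := CFC.negPart_nonneg e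
  let f : LinearMap.range (e⁻ : H →L[ℂ] H).toLinearMap →ₗ[ℂ] F :=
    (F.orthogonalProjectionOnto.toLinearMap).comp (Submodule.subtype _)
  refine FiniteDimensional.of_injective f ((injective_iff_map_eq_zero f).2 ?_)
  rintro ⟨_, z, rfl⟩ hy
  have hy' : (e⁻ : H →L[ℂ] H) z ∈ Fᗮ := by
    rw [← Submodule.orthogonalProjectionOnto_eq_zero_iff]
    exact hy
  have h1 := hpos _ hy'
  have h2 : e * e⁻ = -(e⁻ * e⁻) := by
    have h2 := congrArg (fun f => f * e⁻) (CFC.posPart_sub_negPart e he)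
    simp only [sub_mul, CFC.posPart_mul_negPart, zero_sub] at h2
    exact h2.symm
  have h3 : e ((e⁻ : H →L[ℂ] H) z) = -(e⁻ : H →L[ℂ] H) ((e⁻ : H →L[ℂ] H) z) :=
    congrArg (fun f : H →L[ℂ] H => f z) h2
  rw [h3, inner_neg_left, Complex.neg_re] at h1
  have h4 : (e⁻ : H →L[ℂ] H) ((e⁻ : H →L[ℂ] H) z) = 0 :=
    apply_eq_zero_of_inner h0 (le_antisymm (neg_nonneg.1 h1) (inner_nonneg h0 _))
  apply Subtype.ext
  change (e⁻ : H →L[ℂ] H) z = 0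
  rw [← inner_self_eq_zero (𝕜 := ℂ), ← ContinuousLinearMap.adjoint_inner_right,
    h0.isSelfAdjoint.adjoint_eq, h4, inner_zero_right]

/-- The form of `d * c` at `y` is that of the operator at `c y`. Conversely, the invariant subspace
is the kernel of the negative part of `d * c`, which commutes with `c` and `d` and has finite rank.
-/
theorem isEssPositivePair_iff (hc : IsSelfAdjoint c) (hi : Function.Injective c)
    (hd : IsSelfAdjoint d) (h : Commute c d) : IsEssPositivePair c d ↔ EssNonneg (d * c) := by
  constructor
  · rintro ⟨V, hV, hfin, hpos⟩
    have : CompleteSpace V := hV.completeSpace_coe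
    have hVfin : FiniteDimensional ℂ Vᗮ :=
      (Submodule.quotientEquivOfIsCompl V Vᗮ V.isCompl_orthogonal).finiteDimensional
    refine ⟨Vᗮ.map c.toLinearMap, inferInstance, fun y hy => ?_⟩
    rw [inner_mul_eq hc h]
    refine (hpos y ?_).2
    rw [← V.orthogonal_orthogonal, Submodule.mem_orthogonal]
    intro w hw
    rw [← ContinuousLinearMap.adjoint_inner_left, hc.adjoint_eq]
    exact (Submodule.mem_orthogonal _ _).1 hy _ ⟨w, hw, rfl⟩
  · intro hn
    have he : IsSelfAdjoint (d * c) := by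
      change star (d * c) = d * c
      rw [star_mul, hc.star_eq, hd.star_eq, h.eq]
    have hinner := inner_mul_eq hc h
    have h1 : Commute (d * c) c := h.symm.mul_left (Commute.refl c)
    have h2 : Commute (d * c) d := (Commute.refl d).mul_left h
    generalize d * c = e at hn he hinner h1 h2
    have hfin := hn.finiteDimensional_range_negPart he
    have hce : Commute (e⁻) c := by
      rw [CFC.negPart_def]
      exact h1.cfcₙ_real _
    have hde : Commute (e⁻) d := by
      rw [CFC.negPart_def]
      exact h2.cfcₙ_real _
    refine ⟨LinearMap.ker (e⁻ : H →L[ℂ] H).toLinearMap,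
      ContinuousLinearMap.isClosed_ker (e⁻ : H →L[ℂ] H),
      (LinearMap.quotKerEquivRange _).symm.finiteDimensional, fun y hy => ?_⟩
    have hy0 : c ((e⁻ : H →L[ℂ] H) y) = 0 :=
      Eq.trans (congrArg (fun f : H →L[ℂ] H => f y) hce.eq.symm) hy
    have hy1 : (e⁻ : H →L[ℂ] H) y = 0 := hi (hy0.trans (map_zero c).symm)
    refine ⟨?_, ?_⟩
    · have : (e⁻ : H →L[ℂ] H) (d y) = d ((e⁻ : H →L[ℂ] H) y) :=
        congrArg (fun f : H →L[ℂ] H => f y) hde.eq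
      rw [hy1, map_zero] at this
      exact this
    · have : (e⁺ : H →L[ℂ] H) y - (e⁻ : H →L[ℂ] H) y = e y :=
        congrArg (fun f : H →L[ℂ] H => f y) (CFC.posPart_sub_negPart e he)
      rw [← hinner, ← this, hy1, sub_zero]
      have h3 : 0 ≤ e⁺ := CFC.posPart_nonneg e
      exact inner_nonneg h3 y

/-! ### The operator `hat A` -/

/-- The operator `(x, y) ↦ (B y, B* x)`. -/
def hatOp (B : H →L[ℂ] H) : WithLp 2 (H × H) →L[ℂ] WithLp 2 (H × H) :=
  inl₂.comp (B.comp snd₂) + inr₂.comp ((star B).comp fst₂)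

theorem hatOp_apply (B : H →L[ℂ] H) (p : WithLp 2 (H × H)) :
    hatOp B p = WithLp.toLp 2 (B p.snd, star B p.fst) := by
  change WithLp.toLp 2 (B p.snd + 0, 0 + star B p.fst) = _
  rw [add_zero, zero_add]

theorem isSelfAdjoint_hatOp (B : H →L[ℂ] H) : IsSelfAdjoint (hatOp B) := by
  rw [ContinuousLinearMap.isSelfAdjoint_iff_isSymmetric]
  intro p q
  change ⟪hatOp B p, q⟫_ℂ = ⟪p, hatOp B q⟫_ℂ
  rw [hatOp_apply, hatOp_apply, WithLp.prod_inner_apply, WithLp.prod_inner_apply]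
  change ⟪B p.snd, q.fst⟫_ℂ + ⟪star B p.fst, q.snd⟫_ℂ =
    ⟪p.fst, B q.snd⟫_ℂ + ⟪p.snd, star B q.fst⟫_ℂ
  rw [ContinuousLinearMap.star_eq_adjoint, ContinuousLinearMap.adjoint_inner_left,
    ContinuousLinearMap.adjoint_inner_right, add_comm]

theorem norm_hatOp (B : H →L[ℂ] H) : ‖hatOp B‖ = ‖B‖ := by
  refine le_antisymm (ContinuousLinearMap.opNorm_le_bound _ (norm_nonneg B) fun p => ?_)
    (ContinuousLinearMap.opNorm_le_bound _ (norm_nonneg _) fun x => ?_)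
  · rw [hatOp_apply]
    refine le_of_sq_le_sq ?_ (by positivity)
    rw [mul_pow, WithLp.prod_norm_sq_eq_of_L2, WithLp.prod_norm_sq_eq_of_L2]
    have h1 := pow_le_pow_left₀ (norm_nonneg _) (B.le_opNorm p.snd) 2
    have h2 := pow_le_pow_left₀ (norm_nonneg _) ((star B).le_opNorm p.fst) 2
    rw [norm_star] at h2
    change ‖B p.snd‖ ^ 2 + ‖star B p.fst‖ ^ 2 ≤ ‖B‖ ^ 2 * (‖p.fst‖ ^ 2 + ‖p.snd‖ ^ 2)
    linarith
  · have h := (hatOp B).le_opNorm (WithLp.toLp 2 (0, x))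
    have e1 : ‖(WithLp.toLp 2 ((0 : H), x))‖ ^ 2 = ‖x‖ ^ 2 := by
      rw [WithLp.prod_norm_sq_eq_of_L2]
      simp
    have e2 : ‖hatOp B (WithLp.toLp 2 (0, x))‖ ^ 2 = ‖B x‖ ^ 2 := by
      rw [hatOp_apply, WithLp.prod_norm_sq_eq_of_L2]
      simp
    rw [pow_left_inj₀ (norm_nonneg _) (norm_nonneg _) two_ne_zero] at e1 e2
    rwa [e1, e2] at h

theorem IsParam.hat {A : H →ₗ.[ℂ] H} (h : IsParam A B 1) (hA : Dense (A.domain : Set H)) :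
    IsParam (hat A) (hatOp B) 1 := by
  have h' := h.adjoint hA
  intro x z
  rw [LinearPMap.mem_graph_iff]
  constructor
  · rintro ⟨p, hp, hz⟩
    change (p : WithLp 2 (H × H)) = x at hp
    change RegOp.hat A p = z at hz
    refine ⟨z, ?_, rfl⟩
    obtain ⟨y1, hy1, hy1'⟩ := h.exists_eq ⟨p.1.fst, p.2.1⟩
    obtain ⟨y2, hy2, hy2'⟩ := h'.exists_eq ⟨p.1.snd, p.2.2⟩
    change y1 = _ at hy1'
    change y2 = _ at hy2'
    rw [hatOp_apply, ← hp, ← hz]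
    change WithLp.toLp 2 (B (A ⟨p.1.fst, p.2.1⟩), star B (A† ⟨p.1.snd, p.2.2⟩)) = p.1
    rw [← hy1', ← hy2', hy1, hy2]
    rfl
  · rintro ⟨y, rfl, rfl⟩
    refine ⟨⟨hatOp B y, ?_⟩, rfl, ?_⟩
    · rw [hatOp_apply]
      exact ⟨h.mem_domain y.snd, h'.mem_domain y.fst⟩
    · have e1 : ∀ k, A ⟨(hatOp B y).fst, k⟩ = y.snd := by
        rw [hatOp_apply]
        exact fun k => h.apply y.snd k
      have e2 : ∀ k, A† ⟨(hatOp B y).snd, k⟩ = y.fst := by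
        rw [hatOp_apply]
        exact fun k => h'.apply y.fst k
      change WithLp.toLp 2 (A† ⟨(hatOp B y).snd, _⟩, A ⟨(hatOp B y).fst, _⟩) = y
      exact congrArg (WithLp.toLp 2) (Prod.ext (e2 _) (e1 _))

theorem isInvertible_of_hat {A : H →ₗ.[ℂ] H} (h : IsInvertible (hat A)) : IsInvertible A := by
  obtain ⟨⟨hi, hs⟩, C, hC⟩ := h
  have hz : ∀ x : A.domain, (WithLp.toLp 2 ((x : H), (0 : H))) ∈ (hat A).domain :=
    fun x => ⟨x.2, (A†).domain.zero_mem⟩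
  have hv : ∀ x : A.domain, hat A ⟨_, hz x⟩ = inr₂ (A x) := fun x => by
    change WithLp.toLp 2 ((A†) 0, A ⟨x, x.2⟩) = WithLp.toLp 2 (0, A x)
    rw [(A†).map_zero]
  have hl : ∀ x : A.domain, (fst₂.comp (C.comp inr₂)) (A x) = x := fun x => by
    change (C (inr₂ (A x))).fst = x
    rw [← hv]
    exact congrArg (fun q : WithLp 2 (H × H) => q.fst) (hC ⟨_, hz x⟩)
  refine ⟨⟨fun x y hxy => Subtype.ext ?_, fun w => ?_⟩, _, hl⟩
  · rw [← hl x, ← hl y]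
    exact congrArg _ hxy
  · obtain ⟨p, hp⟩ := hs (inr₂ w)
    exact ⟨⟨p.1.fst, p.2.1⟩, congrArg (fun q : WithLp 2 (H × H) => q.snd) hp⟩

theorem mem_regInv_iff {A : Reg H} : A ∈ RegInv H ↔ ∃ B, IsParam A.1 B 1 := by
  constructor
  · intro h
    obtain ⟨B, hB, -⟩ := exists_param_of_isInvertible h
    exact ⟨B, hB⟩
  · rintro ⟨B, hB⟩
    exact hB.isInvertible hB.injective

theorem isInvertible_of_spec {E : Type*} [NormedAddCommGroup E] [InnerProductSpace ℂ E]
    {A : E →ₗ.[ℂ] E} {l : ℝ} (hl : 0 ≤ l) (h : Spec A ∩ symmInterval l = ∅) : IsInvertible A := by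
  by_contra hA
  refine (Set.eq_empty_iff_forall_notMem.1 h) 0 ⟨fun h0 => hA ?_, 0, ⟨neg_nonpos.2 hl, hl⟩, rfl⟩
  rwa [zero_smul, neg_zero, zero_vadd] at h0

theorem mem_specAvoids_iff {A : Reg H} (hA : A ∈ RegSA H) {l : ℝ} (hl : 0 ≤ l) :
    A ∈ SpecAvoids H l ↔ ∃ B, IsParam A.1 B 1 ∧ l * ‖B‖ < 1 := by
  constructor
  · intro h
    obtain ⟨B, hB⟩ := mem_regInv_iff.1 (isInvertible_of_spec hl h)
    exact ⟨B, hB, (hB.spec_inter_eq_empty_iff hB.injective (hB.mem_regSA_iff.1 hA)).1 h⟩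
  · rintro ⟨B, hB, h⟩
    exact (hB.spec_inter_eq_empty_iff hB.injective (hB.mem_regSA_iff.1 hA)).2 h

/-- The norm criterion is applied to `hatOp B`, which is self-adjoint for every `B` and has the same
norm. -/
theorem mem_hatSpecAvoids_iff {A : Reg H} {l : ℝ} (hl : 0 ≤ l) :
    A ∈ HatSpecAvoids H l ↔ ∃ B, IsParam A.1 B 1 ∧ l * ‖B‖ < 1 := by
  have key : ∀ B, IsParam A.1 B 1 → (A ∈ HatSpecAvoids H l ↔ l * ‖B‖ < 1) := fun B hB => by
    have h := hB.hat A.2.2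
    rw [← norm_hatOp B]
    exact h.spec_inter_eq_empty_iff h.injective (isSelfAdjoint_hatOp B)
  constructor
  · intro h
    obtain ⟨B, hB⟩ := mem_regInv_iff.1 (isInvertible_of_hat (isInvertible_of_spec hl h))
    exact ⟨B, hB, (key B hB).1 h⟩
  · rintro ⟨B, hB, h⟩
    exact (key B hB).2 h

end Classes

/-! ### Contractibility in the graph topology -/

section Graph

variable {H : Type u} [NormedAddCommGroup H] [InnerProductSpace ℂ H] [CompleteSpace H]

/-- The operators in `X`, optionally with compact resolvent, with a bounded inverse `B` such that
`l ‖B‖ < 1`. -/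
def invertibleIn (X : Set (Reg H)) (k : Prop) (l : ℝ) : Set (Reg H) :=
  {A | (A ∈ X ∧ (k → A ∈ RegK H)) ∧ ∃ B, IsParam A.1 B 1 ∧ l * ‖B‖ < 1}

/-- The operator on `H ⊕ H` with the blocks of the projection onto the graph of `B⁻¹`. -/
def projOfInverse (B : H →L[ℂ] H) : WithLp 2 (H × H) →L[ℂ] WithLp 2 (H × H) :=
  (inl₂.comp B + inr₂).comp
    ((Ring.inverse (star B * B + 1)).comp ((star B).comp fst₂ + snd₂))

theorem isUnit_star_mul_self_add_one (B : H →L[ℂ] H) : IsUnit (star B * B + 1) :=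
  isUnit_of_lower one_pos (by
    rw [one_smul]
    exact le_add_of_nonneg_left (star_mul_self_nonneg B))

theorem continuous_projOfInverse : Continuous (projOfInverse (H := H)) := by
  have h : Continuous fun B : H →L[ℂ] H => Ring.inverse (star B * B + 1) :=
    continuous_ringInverse (by fun_prop) isUnit_star_mul_self_add_one
  unfold projOfInverse
  fun_prop

theorem IsParam.mul_ringInverse (B : H →L[ℂ] H) :
    (star B * B + star (1 : H →L[ℂ] H) * 1) * Ring.inverse (star B * B + 1) = 1 := by
  rw [star_one, one_mul]
  exact Ring.mul_inverse_cancel _ (isUnit_star_mul_self_add_one B)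

theorem IsParam.graphProj_eq {A : Reg H} {B : H →L[ℂ] H} (h : IsParam A.1 B 1) :
    graphProj A = projOfInverse B := by
  ext v
  rw [h.graphProj_apply (mul_ringInverse B), star_one]
  set N := Ring.inverse (star B * B + 1)
  change _ = WithLp.toLp 2 (B (N (star B v.fst + v.snd)) + 0, 0 + N (star B v.fst + v.snd))
  rw [add_zero, zero_add]
  rfl

/-- The right column of the graph projection is `(B * N, N)` with `N` invertible, so `B` is a
quotient of two corners. -/
theorem IsParam.eq_corner {A : Reg H} {B : H →L[ℂ] H} (h : IsParam A.1 B 1) :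
    IsUnit (snd₂.comp ((graphProj A).comp inr₂)) ∧
      B = (fst₂.comp ((graphProj A).comp inr₂)) *
        Ring.inverse (snd₂.comp ((graphProj A).comp inr₂)) := by
  set N := Ring.inverse (star B * B + 1) with hN
  have hu : IsUnit N := (isUnit_star_mul_self_add_one B).ringInverse
  have e : ∀ x, star B (0 : H) + star (1 : H →L[ℂ] H) x = x := fun x => by
    rw [map_zero, zero_add, star_one]
    rfl
  have e1 : snd₂.comp ((graphProj A).comp inr₂) = N := by
    ext x
    change (graphProj A (inr₂ x)).snd = _
    rw [h.graphProj_apply (mul_ringInverse B)]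
    exact congrArg N (e x)
  have e2 : fst₂.comp ((graphProj A).comp inr₂) = B * N := by
    ext x
    change (graphProj A (inr₂ x)).fst = _
    rw [h.graphProj_apply (mul_ringInverse B)]
    exact congrArg (B * N) (e x)
  rw [e1, e2, mul_assoc, Ring.mul_inverse_cancel _ hu, mul_one]
  exact ⟨hu, rfl⟩

/-- Taking inverses is inducing: `eq_corner` recovers `B` continuously from the graph projection and
`projOfInverse` does the reverse. Its image consists of all operators of the class that are
injective, have dense range and satisfy the bound, together with compactness when `k` holds. -/
theorem isContractibleIn_graphTopology {P : (H →L[ℂ] H) → Prop} {S : H →L[ℂ] H}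
    (h : IsContractionClass P S) (D : ContractionData H) (hK : Commute D.K S)
    (hv : ∀ t, Commute (D.v t) S) {X : Set (Reg H)}
    (hX : ∀ (A : Reg H) B, IsParam A.1 B 1 → (A ∈ X ↔ P B)) {l : ℝ} (hl : 0 ≤ l) (k : Prop) :
    IsContractibleIn (graphTopology H) (invertibleIn X k l) := by
  choose f hf hf' using fun A : invertibleIn X k l => A.2.2
  refine isContractibleIn_of_isInducing (S' := {B : H →L[ℂ] H | Function.Injective B ∧
    Function.Injective ⇑(star B) ∧ l * ‖B‖ < 1 ∧ P B ∧ (k → IsCompactOperator B)}) f ?_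
    (fun A => ⟨(hf A).injective, (hf A).injective_star A.1.2.2, hf' A, (hX _ _ (hf A)).1 A.2.1.1,
      fun hk => (hf A).mem_regK_iff.1 (A.2.1.2 hk)⟩) ?_ (h.contractibleSpace D hK hv hl k)
  · let τ : TopologicalSpace (invertibleIn X k l) :=
      TopologicalSpace.induced Subtype.val (graphTopology H)
    let g : invertibleIn X k l → WithLp 2 (H × H) →L[ℂ] WithLp 2 (H × H) := fun A => graphProj A.1
    have hτ : τ = TopologicalSpace.induced g inferInstance := induced_compose
    have hg : Continuous g := continuous_iff_le_induced.2 hτ.le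
    have hfc : Continuous f := by
      have e : f = fun A => (fst₂.comp ((g A).comp inr₂)) *
          Ring.inverse (snd₂.comp ((g A).comp inr₂)) := funext fun A => (hf A).eq_corner.2
      rw [e]
      exact Continuous.mul (by fun_prop)
        (continuous_ringInverse (by fun_prop) fun A => (hf A).eq_corner.1)
    refine ⟨le_antisymm (continuous_iff_le_induced.1 hfc) ?_⟩
    refine le_of_le_of_eq ?_ hτ.symm
    let _ : TopologicalSpace (invertibleIn X k l) := TopologicalSpace.induced f inferInstance
    refine continuous_iff_le_induced.1 ?_
    have e : g = fun A => projOfInverse (f A) := funext fun A => (hf A).graphProj_eq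
    rw [e]
    exact continuous_projOfInverse.comp continuous_induced_dom
  · rintro B ⟨h1, h2, h3, h4, h5⟩
    obtain ⟨N, -, hN⟩ := exists_inverse_one_add B
    obtain ⟨A, hA⟩ := exists_isParam h1 h2 hN
    let A' : invertibleIn X k l :=
      ⟨A, ⟨(hX A B hA).2 h4, fun hk => hA.mem_regK_iff.2 (h5 hk)⟩, B, hA, h3⟩
    refine ⟨A', ?_⟩
    ext y
    obtain ⟨w, hw, rfl⟩ := (hf A' _ _).1 (hA.mem_graph y)
    exact hw

theorem IsParam.mem_regPos_iff {A : Reg H} {B : H →L[ℂ] H} (h : IsParam A.1 B 1) :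
    A ∈ RegPos H ↔ IsSelfAdjoint B ∧ EssNonneg B := by
  refine Iff.trans (and_congr_left fun _ => h.mem_regSA_iff) (and_congr_right fun hB => ?_)
  rw [h.isEssPositive_iff, isEssPositivePair_iff hB h.injective (.one _) (Commute.one_right B),
    one_mul]

theorem IsParam.isEssNegative_iff_essNonneg {A : Reg H} {B : H →L[ℂ] H} (h : IsParam A.1 B 1)
    (hB : IsSelfAdjoint B) : IsEssNegative A.1 ↔ EssNonneg (-B) := by
  rw [h.isEssNegative_iff, isEssPositivePair_iff hB h.injective (IsSelfAdjoint.one _).neg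
    (Commute.one_right B).neg_right, neg_mul, one_mul]

theorem IsParam.mem_regNeg_iff {A : Reg H} {B : H →L[ℂ] H} (h : IsParam A.1 B 1) :
    A ∈ RegNeg H ↔ IsSelfAdjoint B ∧ EssNonneg (-B) :=
  Iff.trans (and_congr_left fun _ => h.mem_regSA_iff)
    (and_congr_right fun hB => h.isEssNegative_iff_essNonneg hB)

theorem IsParam.mem_regStar_iff {A : Reg H} {B : H →L[ℂ] H} (h : IsParam A.1 B 1) :
    A ∈ RegStar H ↔ IsSelfAdjoint B ∧ EssIndefinite B := by
  refine Iff.trans (and_congr_left fun _ => h.mem_regSA_iff) (and_congr_right fun hB => ?_)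
  rw [h.isEssPositive_iff, isEssPositivePair_iff hB h.injective (.one _) (Commute.one_right B),
    one_mul, h.isEssNegative_iff_essNonneg hB]
  rfl

end Graph

/-! ### Contractibility in the Riesz topology -/

section Riesz

variable {H : Type u} [NormedAddCommGroup H] [InnerProductSpace ℂ H] [CompleteSpace H]

theorem isSelfAdjoint_resolventSqrt (A : Reg H) : IsSelfAdjoint (resolventSqrt A) :=
  (CFC.sqrt_nonneg (resolvent A)).isSelfAdjoint

theorem boundedTransform_apply (A : Reg H) (x : H) (h : resolventSqrt A x ∈ A.1.domain) :
    boundedTransform A x = A.1 ⟨resolventSqrt A x, h⟩ := rfl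

/-- On the dense range of `resolventSqrt A` this is `inner_resolvent`; both sides are continuous. -/
theorem inner_boundedTransform (A : Reg H) (x y : H) :
    ⟪resolventSqrt A x, resolventSqrt A y⟫_ℂ + ⟪boundedTransform A x, boundedTransform A y⟫_ℂ =
      ⟪x, y⟫_ℂ := by
  refine (denseRange_resolventSqrt A).induction_on₂ (p := fun x y =>
    ⟪resolventSqrt A x, resolventSqrt A y⟫_ℂ + ⟪boundedTransform A x, boundedTransform A y⟫_ℂ =
      ⟪x, y⟫_ℂ) (isClosed_eq (by fun_prop) (by fun_prop)) (fun x y => ?_) x y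
  obtain ⟨hx, -, -⟩ := resolvent_spec A x
  obtain ⟨hy, -, -⟩ := resolvent_spec A y
  have e : ∀ z (hz : resolvent A z ∈ A.1.domain),
      boundedTransform A (resolventSqrt A z) = A.1 ⟨resolvent A z, hz⟩ := fun z hz => by
    rw [boundedTransform_apply A _ (by rwa [resolventSqrt_sq])]
    congr 1
    exact Subtype.ext (resolventSqrt_sq A z)
  rw [e x hx, e y hy, resolventSqrt_sq, resolventSqrt_sq, ← inner_resolvent, resolventSqrt_inner,
    resolventSqrt_sq]

theorem resolventSqrt_mul_add (A : Reg H) :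
    star (resolventSqrt A) * resolventSqrt A + star (boundedTransform A) * boundedTransform A =
      1 := by
  ext x
  refine ext_inner_right ℂ fun y => ?_
  change ⟪star (resolventSqrt A) (resolventSqrt A x) +
    star (boundedTransform A) (boundedTransform A x), y⟫_ℂ = ⟪x, y⟫_ℂ
  rw [inner_add_left, ContinuousLinearMap.star_eq_adjoint, ContinuousLinearMap.star_eq_adjoint,
    ContinuousLinearMap.adjoint_inner_left, ContinuousLinearMap.adjoint_inner_left,
    inner_boundedTransform]

theorem norm_sq_boundedTransform (A : Reg H) (x : H) :
    ‖resolventSqrt A x‖ ^ 2 + ‖boundedTransform A x‖ ^ 2 = ‖x‖ ^ 2 := by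
  have h := inner_boundedTransform A x x
  rw [inner_self_eq_norm_sq_to_K, inner_self_eq_norm_sq_to_K, inner_self_eq_norm_sq_to_K] at h
  exact_mod_cast h

theorem injective_resolventSqrt (A : Reg H) : Function.Injective (resolventSqrt A) := by
  rw [injective_iff_map_eq_zero]
  intro x hx
  refine (denseRange_resolventSqrt A).eq_zero_of_inner_right ℂ fun y => ?_
  rw [resolventSqrt_inner, hx, inner_zero_right]

theorem isParam_boundedTransform (A : Reg H) :
    IsParam A.1 (resolventSqrt A) (boundedTransform A) := by
  have hmem : ∀ y, (resolventSqrt A y, boundedTransform A y) ∈ A.1.graph := fun y =>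
    apply_mem_graph ⟨_, (apply_resolventSqrt A y).1⟩
  intro x z
  constructor
  · intro h
    set y := star (resolventSqrt A) x + star (boundedTransform A) z with hy
    have h0 : (x - resolventSqrt A y, z - boundedTransform A y) ∈ A.1.graph :=
      A.1.graph.sub_mem h (hmem y)
    obtain ⟨w, hw, hw'⟩ := (A.1.mem_graph_iff).1 h0
    change (w : H) = x - resolventSqrt A y at hw
    change A.1 w = z - boundedTransform A y at hw'
    -- The point of the graph left after subtracting the candidate is orthogonal to all parametrized
    -- points. Testing this with `resolventSqrt A w`, whose parametrized point involves `(1 + A*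
    -- A)⁻¹ w`, gives `⟪w, w⟫ = 0`.
    have h1 : star (resolventSqrt A) (w : H) + star (boundedTransform A) (A.1 w) = 0 := by
      have := congrArg (fun f : H →L[ℂ] H => f y) (resolventSqrt_mul_add A)
      change star (resolventSqrt A) (resolventSqrt A y) +
        star (boundedTransform A) (boundedTransform A y) = y at this
      rw [hw, hw', map_sub, map_sub, sub_add_sub_comm, this, sub_self]
    have h2 : (w : H) = 0 := by
      obtain ⟨k, k', e⟩ := resolvent_spec A (w : H)
      have h3 := LinearPMap.adjoint_isFormalAdjoint A.2.2 ⟨_, k'⟩ w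
      have h4 : ⟪resolventSqrt A (w : H),
          star (resolventSqrt A) (w : H) + star (boundedTransform A) (A.1 w)⟫_ℂ =
          ⟪(w : H), (w : H)⟫_ℂ := by
        rw [inner_add_right, ContinuousLinearMap.star_eq_adjoint,
          ContinuousLinearMap.star_eq_adjoint, ContinuousLinearMap.adjoint_inner_right,
          ContinuousLinearMap.adjoint_inner_right, resolventSqrt_sq]
        have e2 : boundedTransform A (resolventSqrt A w) = A.1 ⟨resolvent A w, k⟩ := by
          rw [boundedTransform_apply A _ (by rwa [resolventSqrt_sq])]
          congr 1
          exact Subtype.ext (resolventSqrt_sq A w)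
        rw [e2]
        conv_rhs => rw [← e, inner_add_left]
        congr 1
        · rw [e]
        · rw [e]
          exact h3.symm
      rw [h1, inner_zero_right] at h4
      exact inner_self_eq_zero.1 h4.symm
    have h5 : A.1 w = 0 := by
      rw [show w = 0 from Subtype.ext h2, A.1.map_zero]
    exact ⟨y, (sub_eq_zero.1 (hw.symm.trans h2)).symm, (sub_eq_zero.1 (hw'.symm.trans h5)).symm⟩
  · rintro ⟨y, rfl, rfl⟩
    exact hmem y

theorem resolvent_eq_boundedTransform (A : Reg H) :
    resolvent A = 1 - star (boundedTransform A) * boundedTransform A := by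
  rw [(isParam_boundedTransform A).resolvent_eq (N := 1)
    (by rw [mul_one]; exact resolventSqrt_mul_add A), mul_one,
    ← resolventSqrt_mul_add A, (isSelfAdjoint_resolventSqrt A).star_eq, add_sub_cancel_right]

theorem coresolvent_eq_boundedTransform (A : Reg H) :
    coresolvent A = 1 - boundedTransform A * star (boundedTransform A) := by
  rw [(isParam_boundedTransform A).coresolvent_eq (N := 1)
    (by rw [mul_one]; exact resolventSqrt_mul_add A), mul_one]

theorem apply_congr {A A' : H →ₗ.[ℂ] H} (h : A = A') {x y : H} (hxy : x = y) (hx : x ∈ A.domain)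
    (hy : y ∈ A'.domain) : A ⟨x, hx⟩ = A' ⟨y, hy⟩ := by
  subst h hxy
  rfl

theorem coresolvent_eq_resolvent {A : Reg H} (hA : A ∈ RegSA H) :
    coresolvent A = resolvent A := by
  have hA : A.1† = A.1 := hA
  ext x
  obtain ⟨h, h', e⟩ := resolvent_spec A x
  have k : resolvent A x ∈ (A.1†).domain := by rwa [hA]
  have e1 : A.1† ⟨_, k⟩ = A.1 ⟨_, h⟩ := apply_congr hA rfl _ _
  have k' : A.1† ⟨_, k⟩ ∈ A.1.domain := by
    rw [e1]
    exact (congrArg LinearPMap.domain hA).le h'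
  refine (coresolvent_unique A x _ k k' ?_).symm
  rw [apply_congr hA.symm e1 k' h', e]

theorem commute_resolventSqrt_of_commute {A : Reg H}
    (h : star (boundedTransform A) * boundedTransform A =
      boundedTransform A * star (boundedTransform A)) :
    Commute (resolventSqrt A) (boundedTransform A) := by
  have : Commute (resolvent A) (boundedTransform A) := by
    rw [resolvent_eq_boundedTransform]
    refine (Commute.one_left _).sub_left ?_
    change _ * _ = _ * _
    conv_lhs => rw [h]
    rw [mul_assoc]
  exact this.cfcₙ_nnreal _

/-- If `A` is self-adjoint, its two resolvents coincide, so the bounded transform is normal and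
commutes with `resolventSqrt A`. The description of the adjoint graph then shows that it equals its
adjoint on a dense range. Conversely, commutation lets a point of the adjoint graph be solved for
its parameter. -/
theorem mem_regSA_iff_boundedTransform {A : Reg H} :
    A ∈ RegSA H ↔ IsSelfAdjoint (boundedTransform A) := by
  have hp := isParam_boundedTransform A
  have hr := isSelfAdjoint_resolventSqrt A
  constructor
  · intro hA
    have h1 := coresolvent_eq_resolvent hA
    rw [coresolvent_eq_boundedTransform, resolvent_eq_boundedTransform, sub_right_inj] at h1
    have hc := commute_resolventSqrt_of_commute h1.symm
    have hA' : A.1† = A.1 := hA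
    change star (boundedTransform A) = boundedTransform A
    have hd : ⇑(star (boundedTransform A)) = ⇑(boundedTransform A) := by
      refine (denseRange_resolventSqrt A).equalizer (by fun_prop) (by fun_prop) (funext fun y => ?_)
      have h2 := (hp.mem_adjoint_graph_iff A.2.2 _ _).1 (by
        rw [hA']
        exact hp.mem_graph y)
      rw [hr.star_eq] at h2
      exact h2.symm.trans (congrArg (fun f : H →L[ℂ] H => f y) hc.eq)
    exact DFunLike.coe_injective hd
  · intro ha
    have hc : Commute (resolventSqrt A) (boundedTransform A) :=
      commute_resolventSqrt_of_commute (by rw [ha.star_eq])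
    have hc' : ∀ y, resolventSqrt A (boundedTransform A y) =
        boundedTransform A (resolventSqrt A y) :=
      fun y => congrArg (fun f : H →L[ℂ] H => f y) hc.eq
    have h1 : ∀ y, resolventSqrt A (resolventSqrt A y) +
        boundedTransform A (boundedTransform A y) = y := fun y => by
      have := congrArg (fun f : H →L[ℂ] H => f y) (resolventSqrt_mul_add A)
      rwa [hr.star_eq, ha.star_eq] at this
    change A.1† = A.1
    refine IsParam.congr_of_graph (c := resolventSqrt A) (d := boundedTransform A) ?_ hp
    intro x z
    rw [hp.mem_adjoint_graph_iff A.2.2, hr.star_eq, ha.star_eq]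
    constructor
    · intro hxz
      refine ⟨resolventSqrt A x + boundedTransform A z, ?_, ?_⟩
      · rw [map_add, hc', hxz, h1]
      · rw [map_add, ← hc', ← hxz, h1]
    · rintro ⟨y, rfl, rfl⟩
      exact hc' y

/-- The form of `A` is governed by the product of the bounded transform with the positive injective
`resolventSqrt A`, which commutes with it and so does not affect signs. -/
theorem mem_regStar_iff_boundedTransform {A : Reg H} :
    A ∈ RegStar H ↔ IsSelfAdjoint (boundedTransform A) ∧ EssIndefinite (boundedTransform A) := by
  have hp := isParam_boundedTransform A
  have hr := isSelfAdjoint_resolventSqrt A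
  have hi := injective_resolventSqrt A
  refine Iff.trans (and_congr_left fun _ => mem_regSA_iff_boundedTransform)
    (and_congr_right fun ha => ?_)
  have hc : Commute (resolventSqrt A) (boundedTransform A) :=
    commute_resolventSqrt_of_commute (by rw [ha.star_eq])
  have h0 : 0 ≤ resolventSqrt A := CFC.sqrt_nonneg (resolvent A)
  rw [hp.isEssPositive_iff, hp.isEssNegative_iff, isEssPositivePair_iff hr hi ha hc,
    isEssPositivePair_iff hr hi ha.neg hc.neg_right, ← hc.eq, ← hc.neg_right.eq,
    essNonneg_mul_iff h0 hi hc, essNonneg_mul_iff h0 hi hc.neg_right]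
  rfl

/-- The required operator has the graph parametrized by `(√(1 - star a * a), a)`. -/
theorem exists_boundedTransform_eq {a : H →L[ℂ] H} (ha : ‖a‖ ≤ 1)
    (hi : Function.Injective ⇑(1 - star a * a)) : ∃ A : Reg H, boundedTransform A = a := by
  have h0 : 0 ≤ 1 - star a * a := by
    rw [sub_nonneg, ← CStarAlgebra.norm_le_one_iff_of_nonneg _ (star_mul_self_nonneg a),
      CStarRing.norm_star_mul_self]
    exact mul_le_one₀ ha (norm_nonneg a) ha
  have hs : star (CFC.sqrt (1 - star a * a)) = CFC.sqrt (1 - star a * a) :=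
    (CFC.sqrt_nonneg _).isSelfAdjoint.star_eq
  have hr := injective_sqrt h0 hi
  have hN : star (CFC.sqrt (1 - star a * a)) * CFC.sqrt (1 - star a * a) + star a * a = 1 := by
    rw [hs, CFC.sqrt_mul_sqrt_self _ h0, sub_add_cancel]
  obtain ⟨A, hA⟩ := exists_isParam (N := 1) hr (by rwa [hs]) (by rwa [one_mul])
  have h1 : resolventSqrt A = CFC.sqrt (1 - star a * a) := by
    rw [resolventSqrt, hA.resolvent_eq (N := 1) (by rwa [mul_one]), mul_one, hs,
      CFC.sqrt_mul_sqrt_self _ h0]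
  refine ⟨A, ?_⟩
  ext x
  refine A.1.mem_graph_snd_inj ((isParam_boundedTransform A).mem_graph x) (hA.mem_graph x) ?_
  rw [h1]

theorem div_sqrt_lt_one (l : ℝ) : l / √(1 + l ^ 2) < 1 := by
  rw [div_lt_one (by positivity)]
  exact Real.lt_sqrt_of_sq_lt (by linarith)

/-- Writing `a` for the bounded transform, `B (a y) = resolventSqrt A y` gives `‖y‖ ^ 2 = ‖a y‖ ^ 2
+ ‖B (a y)‖ ^ 2`. So `(1 + ‖B‖ ^ 2)^(-1/2)` is a lower bound of `a`, and a lower bound `c` of `a` in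
turn bounds `‖B‖`. -/
theorem mul_norm_lt_one_iff {A : Reg H} {B : H →L[ℂ] H} (h : IsParam A.1 B 1) {l : ℝ}
    (hl : 0 ≤ l) : l * ‖B‖ < 1 ↔
      ∃ c, l / √(1 + l ^ 2) < c ∧ ∀ y, c * ‖y‖ ≤ ‖boundedTransform A y‖ := by
  have hp := isParam_boundedTransform A
  have hu : IsUnit (boundedTransform A) :=
    (hp.isInvertible_iff (injective_resolventSqrt A)).1 (h.isInvertible h.injective)
  have hB : ∀ y, B (boundedTransform A y) = resolventSqrt A y := fun y => by
    obtain ⟨w, hw, hw'⟩ := (h _ _).1 (hp.mem_graph y)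
    rw [← hw, ← hw']
    rfl
  have hs : 0 < √(1 + l ^ 2) := by positivity
  have hs2 : √(1 + l ^ 2) ^ 2 = 1 + l ^ 2 := Real.sq_sqrt (by positivity)
  constructor
  · intro hlt
    have hb : 0 < √(1 + ‖B‖ ^ 2) := by positivity
    have hb2 : √(1 + ‖B‖ ^ 2) ^ 2 = 1 + ‖B‖ ^ 2 := Real.sq_sqrt (by positivity)
    refine ⟨1 / √(1 + ‖B‖ ^ 2), ?_, fun y => ?_⟩
    · rw [div_lt_div_iff₀ hs hb, one_mul]
      refine lt_of_pow_lt_pow_left₀ 2 hs.le ?_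
      rw [mul_pow, hs2, hb2]
      have : (l * ‖B‖) ^ 2 < 1 := pow_lt_one₀ (by positivity) hlt two_ne_zero
      nlinarith
    · rw [one_div, inv_mul_le_iff₀ hb]
      refine le_of_sq_le_sq ?_ (by positivity)
      rw [mul_pow, hb2, ← norm_sq_boundedTransform A y, ← hB]
      have := pow_le_pow_left₀ (norm_nonneg _) (B.le_opNorm (boundedTransform A y)) 2
      rw [mul_pow] at this
      linarith
  · rintro ⟨c, hc, hcy⟩
    have hc0 : 0 < c := lt_of_le_of_lt (by positivity) hc
    have h1 : l ^ 2 < c ^ 2 * (1 + l ^ 2) := by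
      rw [div_lt_iff₀ hs] at hc
      have := pow_lt_pow_left₀ hc hl two_ne_zero
      rwa [mul_pow, hs2] at this
    have h2 : ∀ w, (c * ‖B w‖) ^ 2 ≤ (1 - c ^ 2) * ‖w‖ ^ 2 := fun w => by
      obtain ⟨y, rfl⟩ := (ContinuousLinearMap.isUnit_iff_bijective.1 hu).2 w
      have h3 := norm_sq_boundedTransform A y
      have h4 := pow_le_pow_left₀ (by positivity) (hcy y) 2
      rw [hB, mul_pow]
      rw [mul_pow] at h4
      nlinarith
    have hc2 : 0 < c ^ 2 := by positivity
    -- The maximum covers the case `c > 1`, in which the quotient is negative.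
    set q := max 0 ((1 - c ^ 2) / c ^ 2) with hq
    have h3 : ‖B‖ ≤ √q := by
      refine ContinuousLinearMap.opNorm_le_bound _ (Real.sqrt_nonneg _) fun w => ?_
      refine le_of_sq_le_sq ?_ (by positivity)
      rw [mul_pow, Real.sq_sqrt (le_max_left _ _)]
      have h4 : ‖B w‖ ^ 2 ≤ (1 - c ^ 2) / c ^ 2 * ‖w‖ ^ 2 := by
        rw [div_mul_eq_mul_div, le_div_iff₀ hc2]
        linarith [h2 w, mul_pow c ‖B w‖ 2]
      exact h4.trans (mul_le_mul_of_nonneg_right (le_max_right _ _) (sq_nonneg _))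
    have h5 : l ^ 2 * q < 1 := by
      rcases max_choice 0 ((1 - c ^ 2) / c ^ 2) with h | h
      · rw [hq, h, mul_zero]
        exact one_pos
      · rw [hq, h, mul_div_assoc', div_lt_one hc2]
        linarith
    refine lt_of_le_of_lt (mul_le_mul_of_nonneg_left h3 hl) ?_
    refine lt_of_pow_lt_pow_left₀ 2 zero_le_one ?_
    rwa [mul_pow, Real.sq_sqrt (le_max_left _ _), one_pow]

/-- The propositions `sa` and `k` switch between `RegStar` and all regular operators, and between
arbitrary and compact resolvents, so that one argument covers every Riesz case. -/
theorem mem_invertibleIn_iff {A : Reg H} {k sa : Prop} {l : ℝ} (hl : 0 ≤ l) :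
    A ∈ invertibleIn {A : Reg H | sa → A ∈ RegStar H} k l ↔
      boundedTransform A ∈ contractiveUnits H (l / √(1 + l ^ 2)) k sa := by
  have hp := isParam_boundedTransform A
  have hk : A ∈ RegK H ↔
      IsCompactOperator ⇑(1 - star (boundedTransform A) * boundedTransform A) ∧
        IsCompactOperator ⇑(1 - boundedTransform A * star (boundedTransform A)) := by
    rw [← resolvent_eq_boundedTransform, ← coresolvent_eq_boundedTransform]
    rfl
  have hu : (∃ B, IsParam A.1 B 1) ↔ IsUnit (boundedTransform A) := by
    rw [← mem_regInv_iff, ← hp.isInvertible_iff (injective_resolventSqrt A)]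
    rfl
  have h1 : ‖boundedTransform A‖ ≤ 1 :=
    ContinuousLinearMap.opNorm_le_bound _ zero_le_one fun x => by
      rw [one_mul]
      have h := norm_sq_boundedTransform A x
      have h' := sq_nonneg (norm (resolventSqrt A x))
      exact le_of_sq_le_sq (by linarith) (norm_nonneg x)
  have h2 : Function.Injective ⇑(1 - star (boundedTransform A) * boundedTransform A) := by
    rw [← resolvent_eq_boundedTransform]
    intro x y hxy
    rw [← resolventSqrt_sq, ← resolventSqrt_sq] at hxy
    exact injective_resolventSqrt A (injective_resolventSqrt A hxy)
  constructor
  · rintro ⟨⟨h3, h4⟩, B, hB, h5⟩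
    exact ⟨h1, h2, hu.1 ⟨B, hB⟩, (mul_norm_lt_one_iff hB hl).1 h5, fun h => hk.1 (h4 h),
      fun h => mem_regStar_iff_boundedTransform.1 (h3 h)⟩
  · rintro ⟨-, -, h3, h4, h5, h6⟩
    obtain ⟨B, hB⟩ := hu.2 h3
    exact ⟨⟨fun h => mem_regStar_iff_boundedTransform.2 (h6 h), fun h => hk.2 (h5 h)⟩, B, hB,
      (mul_norm_lt_one_iff hB hl).2 h4⟩

theorem isContractibleIn_rieszTopology [TopologicalSpace.SeparableSpace H]
    (hH : ¬ FiniteDimensional ℂ H) (sa k : Prop) {l : ℝ} (hl : 0 ≤ l) :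
    IsContractibleIn (rieszTopology H)
      (invertibleIn {A : Reg H | sa → A ∈ RegStar H} k l) := by
  refine isContractibleIn_of_isInducing 
    (S' := contractiveUnits H (l / √(1 + l ^ 2)) k sa) (fun A => boundedTransform A.1)
    (@IsInducing.mk _ _ (_) _ _ induced_compose) (fun A => (mem_invertibleIn_iff hl).1 A.2) (fun a ha => ?_)
    (contractibleSpace_contractiveUnits hH (by positivity) (div_sqrt_lt_one l) k sa)
  obtain ⟨A, rfl⟩ := exists_boundedTransform_eq ha.1 ha.2.1
  exact ⟨⟨A, (mem_invertibleIn_iff hl).2 ha⟩, rfl⟩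

end Riesz

/-! ### Assembling the classes -/

section Assembly

variable {H : Type u} [NormedAddCommGroup H] [InnerProductSpace ℂ H] [CompleteSpace H]

/-- For `l = 0` the norm condition is void. -/
theorem inter_regInv_eq (X : Set (Reg H)) :
    X ∩ RegInv H = invertibleIn X False 0 := by
  ext A
  simp [invertibleIn, mem_regInv_iff]

theorem inter_regK_inter_regInv_eq (X : Set (Reg H)) :
    (X ∩ RegK H) ∩ RegInv H = invertibleIn X True 0 := by
  ext A
  rw [Set.mem_inter_iff, mem_regInv_iff]
  simp only [invertibleIn, true_imp_iff, zero_mul, zero_lt_one, and_true]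
  rfl

theorem inter_specAvoids_eq {X : Set (Reg H)} (hX : X ⊆ RegSA H) {l : ℝ} (hl : 0 ≤ l) :
    X ∩ SpecAvoids H l = invertibleIn X False l := by
  ext A
  simp only [invertibleIn, false_imp_iff, and_true]
  exact and_congr_right fun hA => mem_specAvoids_iff (hX hA) hl

theorem inter_regK_inter_specAvoids_eq {X : Set (Reg H)} (hX : X ⊆ RegSA H) {l : ℝ} (hl : 0 ≤ l) :
    (X ∩ RegK H) ∩ SpecAvoids H l = invertibleIn X True l := by
  ext A
  simp only [invertibleIn, true_imp_iff]
  exact and_congr_right fun hA => mem_specAvoids_iff (hX hA.1) hl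

theorem hatSpecAvoids_eq {l : ℝ} (hl : 0 ≤ l) :
    HatSpecAvoids H l = invertibleIn Set.univ False l := by
  ext A
  rw [mem_hatSpecAvoids_iff hl]
  simp [invertibleIn]

theorem regK_inter_hatSpecAvoids_eq {l : ℝ} (hl : 0 ≤ l) :
    RegK H ∩ HatSpecAvoids H l = invertibleIn Set.univ True l := by
  ext A
  rw [Set.mem_inter_iff, mem_hatSpecAvoids_iff hl]
  simp [invertibleIn]

variable [TopologicalSpace.SeparableSpace H]

/-- In the graph topology only the target of the contraction varies: `1` for `RegSA` and `RegPos`,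
`-1` for `RegNeg`, and the symmetry `D.J` for `RegStar`, where a definite target would leave the
class. -/
theorem isContractibleIn_of_subset_regSA (hH : ¬ FiniteDimensional ℂ H)
    {t : TopologicalSpace (Reg H)} {X : Set (Reg H)}
    (h : (t = rieszTopology H ∧ X = RegStar H) ∨ (t = graphTopology H ∧
      (X = RegSA H ∨ X = RegNeg H ∨ X = RegPos H ∨ X = RegStar H))) (k : Prop) {l : ℝ}
    (hl : 0 ≤ l) : X ⊆ RegSA H ∧ IsContractibleIn t (invertibleIn X k l) := by
  obtain ⟨D⟩ := exists_contractionData hH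
  rcases h with ⟨rfl, rfl⟩ | ⟨rfl, rfl | rfl | rfl | rfl⟩
  · refine ⟨fun A hA => hA.1, ?_⟩
    simpa using isContractibleIn_rieszTopology hH True k hl
  · exact ⟨subset_rfl, isContractibleIn_graphTopology isContractionClass_isSelfAdjoint D
      (.one_right _) (fun _ => .one_right _) (fun A B hB => hB.mem_regSA_iff) hl k⟩
  · exact ⟨fun A hA => hA.1, isContractibleIn_graphTopology isContractionClass_essNonneg_neg D
      (Commute.one_right _).neg_right (fun _ => (Commute.one_right _).neg_right)
      (fun A B hB => hB.mem_regNeg_iff) hl k⟩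
  · exact ⟨fun A hA => hA.1, isContractibleIn_graphTopology isContractionClass_essNonneg D
      (.one_right _) (fun _ => .one_right _) (fun A B hB => hB.mem_regPos_iff) hl k⟩
  · exact ⟨fun A hA => hA.1, isContractibleIn_graphTopology
      (isContractionClass_essIndefinite D.J_mem) D D.commute_K D.commute_v
      (fun A B hB => hB.mem_regStar_iff) hl k⟩

theorem isContractibleIn_univ (hH : ¬ FiniteDimensional ℂ H) {t : TopologicalSpace (Reg H)}
    (h : t = rieszTopology H ∨ t = graphTopology H) (k : Prop) {l : ℝ} (hl : 0 ≤ l) :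
    IsContractibleIn t (invertibleIn Set.univ k l) := by
  rcases h with rfl | rfl
  · have := isContractibleIn_rieszTopology hH False k hl
    simpa only [false_imp_iff, Set.ofPred_true] using this
  · obtain ⟨D⟩ := exists_contractionData hH
    exact isContractibleIn_graphTopology isContractionClass_true D (.one_right _)
      (fun _ => .one_right _) (fun A B _ => iff_of_true trivial trivial) hl k

end Assembly

end RegOp

end

theorem theoremD {H : Type*} [NormedAddCommGroup H] [InnerProductSpace ℂ H] [CompleteSpace H]
    [TopologicalSpace.SeparableSpace H] (hH : ¬ FiniteDimensional ℂ H) :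
    (∀ (t : TopologicalSpace (RegOp.Reg H)) (X : Set (RegOp.Reg H)),
      ((t = RegOp.rieszTopology H ∧ X = RegOp.RegStar H) ∨
        (t = RegOp.graphTopology H ∧
          (X = RegOp.RegSA H ∨ X = RegOp.RegNeg H ∨ X = RegOp.RegPos H ∨
            X = RegOp.RegStar H))) →
        RegOp.IsContractibleIn t (X ∩ RegOp.RegInv H) ∧
        RegOp.IsContractibleIn t ((X ∩ RegOp.RegK H) ∩ RegOp.RegInv H) ∧
        ∀ l : ℝ, 0 ≤ l →
          RegOp.IsContractibleIn t (X ∩ RegOp.SpecAvoids H l) ∧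
          RegOp.IsContractibleIn t ((X ∩ RegOp.RegK H) ∩ RegOp.SpecAvoids H l)) ∧
    (∀ t : TopologicalSpace (RegOp.Reg H),
      (t = RegOp.rieszTopology H ∨ t = RegOp.graphTopology H) →
        RegOp.IsContractibleIn t (RegOp.RegInv H) ∧
        RegOp.IsContractibleIn t (RegOp.RegK H ∩ RegOp.RegInv H) ∧
        ∀ l : ℝ, 0 ≤ l →
          RegOp.IsContractibleIn t (RegOp.HatSpecAvoids H l) ∧
          RegOp.IsContractibleIn t (RegOp.RegK H ∩ RegOp.HatSpecAvoids H l)) := by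
  refine ⟨fun t X h => ?_, fun t h => ?_⟩
  · have key := fun (k : Prop) (l : ℝ) (hl : 0 ≤ l) =>
      RegOp.isContractibleIn_of_subset_regSA hH h k hl
    have hX := (key True 0 le_rfl).1
    refine ⟨?_, ?_, fun l hl => ⟨?_, ?_⟩⟩
    · rw [RegOp.inter_regInv_eq]
      exact (key _ _ le_rfl).2
    · rw [RegOp.inter_regK_inter_regInv_eq]
      exact (key _ _ le_rfl).2
    · rw [RegOp.inter_specAvoids_eq hX hl]
      exact (key _ _ hl).2
    · rw [RegOp.inter_regK_inter_specAvoids_eq hX hl]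
      exact (key _ _ hl).2
  · have key := fun (k : Prop) (l : ℝ) (hl : 0 ≤ l) => RegOp.isContractibleIn_univ hH h k hl
    refine ⟨?_, ?_, fun l hl => ⟨?_, ?_⟩⟩
    · rw [← Set.univ_inter (RegOp.RegInv H), RegOp.inter_regInv_eq]
      exact key _ _ le_rfl
    · rw [← Set.univ_inter (RegOp.RegK H), RegOp.inter_regK_inter_regInv_eq]
      exact key _ _ le_rfl
    · rw [RegOp.hatSpecAvoids_eq hl]
      exact key _ _ hl
    · rw [RegOp.regK_inter_hatSpecAvoids_eq hl]
      exact key _ _ hl
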